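/- **Setting.** Let $F(\cdot,\cdot;\xi)$ (differentiable) and $G(\cdot,\cdot;\zeta)$ (twice differentiable) be sample functions on $\mathbb R^m\times\mathbb R^n$, $f=\mathbb E_\xi F$, $g=\mathbb E_\zeta G$, with unbiased gradients $\nabla F,\nabla G$ and Hessians $\nabla^2G$. Put $y^*(x)=\arg\min_y g(x,y)$, $u^*(x)=[\nabla^2_{22}g(x,y^*(x))]^{-1}\nabla_2 f(x,y^*(x))$, $\Phi(x)=f(x,y^*(x))$, and let $\Phi^*=\inf\Phi>-\infty$. Let $L_{f,0},L_{f,1},C_{f,0},L_{g,1},L_{g,2},\sigma_{f,1},\sigma_{g,1},\sigma_{g,2}>0$, $r\ge 1$, $0<\mu\le L_{g,1}$, $\kappa=\max\{L_{g,1},L_{f,1}\}/\mu$ and $L_1=L_{f,1}+L_{g,2}L_{f,0}/\mu$. Norms are Euclidean for vectors and Frobenius for matrices. Assume: * $g(x,\cdot)$ is $\mu$-strongly convex for every $x$; $\nabla g$ is $L_{g,1}$-Lipschitz; $\nabla^2_{22}g$ and $\nabla^2_{12}g$ are $L_{g,2}$-Lipschitz; $\nabla f$ is $L_{f,1}$-Lipschitz;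 $\|\nabla_2 f(x,y^*(x))\|\le L_{f,0}$ for all $x$; $\|\nabla_1 f(x,y)\|\le C_{f,0}$ for all $x,y$; * for all $(x,y)$, $\mathbb E\|\nabla F-\nabla f\|^2\le\sigma_{f,1}^2$, $\mathbb E\|\nabla G-\nabla g\|^2\le\sigma_{g,1}^2$ and $\mathbb E\|\nabla^2G-\nabla^2g\|^2\le\sigma_{g,2}^2$. **Algorithm (NSBO-SGD).** Start at a (possibly random) $(x^0,y^0,u^0)$. For $k=0,\dots,K-1$ draw batches $B_1^k,B_2^k,B_4^k$ and $B_1^{t,k}$ ($-1\le t\le T-1$) of samples $\zeta$ and $B_3^k$ of samples $\xi$, all samples being independent of each other and of the initial point; a batch argument denotes the average over the batch. With $$D_y^k=\nabla_2G(x^k,y^k;B_2^k),\quad D_u^k=\nabla_{22}^2G(x^k,y^k;B_1^k)u^k-\nabla_2F(x^k,y^k;B_3^k),\quad D_x^k=\nabla_1F(x^k,y^k;B_3^k)-\nabla_{12}^2G(x^k,y^k;B_4^k)u^k,$$ set $v^{-1,k}=w^{-1,k}=0$ and, for $t=-1,\dots,T-1$, $$[v^{t+1,k},w^{t+1,k}]=[I-\gamma\nabla^2_{22}G(x^k,y^k;B_1^{t,k})][v^{t,k},w^{t,k}]+\gamma[D_y^k,D_u^k],$$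 and then $y^{k+1}=y^k-v^{T,k}$, $u^{k+1}=u^k-w^{T,k}$, $x^{k+1}=x^k-\alpha D_x^k$. Assume that the initial point is in BOX 2, i.e. $\mathbb E\|y^0-y^*(x^0)\|^2\le\min\{\frac{\mu^2}{20rL_{g,2}^2},\frac1{4L_1}\}$ and $\mathbb E\|u^0-u^*(x^0)\|^2\le\min\{\frac{4L_1^2}{5rL_{g,2}^2},\frac{L_1}{\mu^2}\}$, that $\mathbb E\,\Phi(x^0)-\Phi^*\le\Delta$, and that the iterates satisfy $\mathbb E\|y^k-y^*(x^k)\|^2\le r\,(\mathbb E\|y^k-y^*(x^k)\|)^2$ for $0\le k\le K$. **Theorem.** Fix $L_{f,0},L_{f,1},C_{f,0},L_{g,1},L_{g,2},\sigma_{f,1},\sigma_{g,1},\sigma_{g,2},r$ and a step size $0<\gamma\le1/L_{g,1}$. There are constants $c_\alpha,c_T,c_B>0$ depending only on these numbers, and for every $\Delta\ge0$ a constant $C>0$ depending only on these numbers and $\Delta$ (none of them depends on $\mu$, $K$, $T$, the dimensions or the problem), such that for every $0<\mu\le L_{g,1}$ the following holds with $\alpha=c_\alpha\kappa^{-3}$.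 (a) Let $K\ge1$, $T\ge c_T\kappa$, and for all $0\le k<K$, $-1\le t\le T-1$ let $|B_1^{t,k}|\ge c_B\kappa^2$, $|B_1^k|\ge c_B(\kappa K+\kappa^2)$, $|B_2^k|\ge c_B(\kappa^3K+\kappa^4)$, $|B_3^k|\ge c_B\kappa^{-1}K$, $|B_4^k|\ge c_B\kappa^{-1}K$. Then, under the assumptions above, $\Phi$ is differentiable and $$\min_{0\le k\le K-1}\mathbb E\|\nabla\Phi(x^k)\|^2\le C\,\frac{\kappa^3}{K}.$$ (b) For every $0<\epsilon\le1$ there are $1\le K\le C\kappa^3\epsilon^{-1}$, $c_T\kappa\le T\le C\kappa$ and batch sizes satisfying the bounds in (a) such that, under the assumptions above, $\min_{0\le k\le K-1}\mathbb E\|\nabla\Phi(x^k)\|^2\le\epsilon$, and the run of $K$ iterations uses at most $C\kappa^5\epsilon^{-2}$ sample gradients of $F$, $C\kappa^9\epsilon^{-2}$ sample gradients of $G$, $C\kappa^5\epsilon^{-2}$ Jacobian-vector products (with sample matrices $\nabla^2_{12}G$) and $C\kappa^7\epsilon^{-2}$ Hessian-vector products (with sample matrices $\nabla^2_{22}G$).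 -/

import Mathlib

open MeasureTheory ProbabilityTheory

noncomputable section

namespace NSBO

/-! ### Euclidean spaces, partial gradients, blocks of the Hessian -/

/-- The Euclidean space of dimension `d`. -/
abbrev Eu (d : ℕ) := EuclideanSpace ℝ (Fin d)

section Blocks

variable {X Y : Type*} [NormedAddCommGroup X] [InnerProductSpace ℝ X] [FiniteDimensional ℝ X]
  [NormedAddCommGroup Y] [InnerProductSpace ℝ Y] [FiniteDimensional ℝ Y]

/-- The space of pairs `(x, y)`, with the Euclidean norm of the product. -/
abbrev Pt (X Y : Type*) := WithLp 2 (X × Y)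

/-- The pair `(x, y)`. -/
def pt (x : X) (y : Y) : Pt X Y := WithLp.toLp 2 (x, y)

/-- The gradient of `h` with respect to the first variable: first block of the full gradient. -/
def grad1 (h : Pt X Y → ℝ) (z : Pt X Y) : X := (gradient h z).fst

/-- The gradient of `h` with respect to the second variable: second block of the full gradient. -/
def grad2 (h : Pt X Y → ℝ) (z : Pt X Y) : Y := (gradient h z).snd

/-- The full Hessian of `h`, as the derivative of the gradient. -/
def hess (h : Pt X Y → ℝ) (z : Pt X Y) : Pt X Y →L[ℝ] Pt X Y :=
  fderiv ℝ (gradient h) z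

/-- The inclusion `v ↦ (0, v)`. -/
def inY (X Y : Type*) [NormedAddCommGroup X] [InnerProductSpace ℝ X]
    [NormedAddCommGroup Y] [InnerProductSpace ℝ Y] : Y →L[ℝ] Pt X Y :=
  (WithLp.prodContinuousLinearEquiv 2 ℝ X Y).symm.toContinuousLinearMap ∘L
    ContinuousLinearMap.inr ℝ X Y

/-- The Jacobian of the first partial gradient with respect to the second variable. -/
def hess12 (h : Pt X Y → ℝ) (z : Pt X Y) : Y →L[ℝ] X :=
  WithLp.fstL 2 ℝ X Y ∘L hess h z ∘L inY X Y

/-- The Hessian with respect to the second variable. -/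
def hess22 (h : Pt X Y → ℝ) (z : Pt X Y) : Y →L[ℝ] Y :=
  WithLp.sndL 2 ℝ X Y ∘L hess h z ∘L inY X Y

end Blocks

/-- The Frobenius norm of a linear map: the `ℓ²` norm of its matrix in orthonormal bases. -/
def frobenius {V W : Type*} [NormedAddCommGroup V] [InnerProductSpace ℝ V]
    [FiniteDimensional ℝ V] [NormedAddCommGroup W] [NormedSpace ℝ W] (A : V →L[ℝ] W) : ℝ :=
  Real.sqrt (∑ i, ‖A (stdOrthonormalBasis ℝ V i)‖ ^ 2)

/-! ### The bilevel problem -/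

section Deterministic

variable {X Y : Type*} [NormedAddCommGroup X] [InnerProductSpace ℝ X] [FiniteDimensional ℝ X]
  [NormedAddCommGroup Y] [InnerProductSpace ℝ Y] [FiniteDimensional ℝ Y]
  (f g : Pt X Y → ℝ)

/-- The lower-level solution: a minimizer of `g (x, ·)`. -/
def yStar (x : X) : Y := Classical.epsilon fun y => ∀ y', g (pt x y) ≤ g (pt x y')

/-- The point `(x, y*(x))`. -/
def zStar (x : X) : Pt X Y := pt x (yStar g x)

/-- `u*(x) = [∇²₂₂ g (x, y*(x))]⁻¹ ∇₂ f (x, y*(x))`. -/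
def uStar (x : X) : Y :=
  ContinuousLinearMap.inverse (hess22 g (zStar g x)) (grad2 f (zStar g x))

/-- The upper-level objective `Φ(x) = f (x, y*(x))`. -/
def Phi (x : X) : ℝ := f (zStar g x)

end Deterministic

/-- The constants of the assumptions, apart from the strong convexity parameter `μ`. -/
structure Constants where
  Lf0 : ℝ
  Lf1 : ℝ
  Cf0 : ℝ
  Lg1 : ℝ
  Lg2 : ℝ
  σf1 : ℝ
  σg1 : ℝ
  σg2 : ℝ
  r : ℝ
  Lf0_pos : 0 < Lf0
  Lf1_pos : 0 < Lf1
  Cf0_pos : 0 < Cf0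
  Lg1_pos : 0 < Lg1
  Lg2_pos : 0 < Lg2
  σf1_pos : 0 < σf1
  σg1_pos : 0 < σg1
  σg2_pos : 0 < σg2
  one_le_r : 1 ≤ r

/-- The condition number `κ = max {L_{g,1}, L_{f,1}} / μ`. -/
def Constants.κ (c : Constants) (μ : ℝ) : ℝ := max c.Lg1 c.Lf1 / μ

/-- `L₁ = L_{f,1} + L_{g,2} L_{f,0} / μ`. -/
def Constants.L1 (c : Constants) (μ : ℝ) : ℝ := c.Lf1 + c.Lg2 * c.Lf0 / μ

/-- A stochastic bilevel problem: sample objectives `F`, `G` and the laws of the samples. -/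
structure Problem (X Y Ξ Z : Type*) [MeasurableSpace Ξ] [MeasurableSpace Z] where
  F : Pt X Y → Ξ → ℝ
  G : Pt X Y → Z → ℝ
  lawξ : Measure Ξ
  lawζ : Measure Z
  prob_ξ : IsProbabilityMeasure lawξ
  prob_ζ : IsProbabilityMeasure lawζ

section Assumptions

variable {X Y : Type*} [NormedAddCommGroup X] [InnerProductSpace ℝ X] [FiniteDimensional ℝ X]
  [NormedAddCommGroup Y] [InnerProductSpace ℝ Y] [FiniteDimensional ℝ Y]
  [MeasurableSpace X] [MeasurableSpace Y]
  {Ξ Z : Type*} [MeasurableSpace Ξ] [MeasurableSpace Z]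

/-- The upper-level function `f = E F`. -/
def Problem.f (p : Problem X Y Ξ Z) (z : Pt X Y) : ℝ := ∫ ξ, p.F z ξ ∂p.lawξ

/-- The lower-level function `g = E G`. -/
def Problem.g (p : Problem X Y Ξ Z) (z : Pt X Y) : ℝ := ∫ ζ, p.G z ζ ∂p.lawζ

/-- The sample objectives are measurable, integrable, differentiable (twice for `G`), and their
gradients and Hessians are unbiased. -/
structure Problem.Oracles (p : Problem X Y Ξ Z) : Prop where
  meas_F : Measurable (Function.uncurry p.F)
  meas_G : Measurable (Function.uncurry p.G)
  int_F : ∀ z, Integrable (p.F z) p.lawξ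
  int_G : ∀ z, Integrable (p.G z) p.lawζ
  diff_F : ∀ ξ, Differentiable ℝ (fun z => p.F z ξ)
  diff_G : ∀ ζ, Differentiable ℝ (fun z => p.G z ζ)
  diff_grad_G : ∀ ζ, Differentiable ℝ (gradient fun z => p.G z ζ)
  unbiased_grad_F : ∀ z, ∫ ξ, gradient (fun z' => p.F z' ξ) z ∂p.lawξ = gradient p.f z
  unbiased_grad_G : ∀ z, ∫ ζ, gradient (fun z' => p.G z' ζ) z ∂p.lawζ = gradient p.g z
  unbiased_hess_G : ∀ z, ∫ ζ, hess (fun z' => p.G z' ζ) z ∂p.lawζ = hess p.g z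

/-- Smoothness and strong convexity of the deterministic problem. -/
structure Problem.Base (p : Problem X Y Ξ Z) (c : Constants) (μ : ℝ) : Prop where
  diff_f : Differentiable ℝ p.f
  diff_g : Differentiable ℝ p.g
  diff_grad_g : Differentiable ℝ (gradient p.g)
  strong_convex : ∀ x, StrongConvexOn Set.univ μ (fun y => p.g (pt x y))
  lip_grad_g : ∀ z z', ‖gradient p.g z - gradient p.g z'‖ ≤ c.Lg1 * ‖z - z'‖
  lip_hess22_g : ∀ z z', frobenius (hess22 p.g z - hess22 p.g z') ≤ c.Lg2 * ‖z - z'‖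
  lip_hess12_g : ∀ z z', frobenius (hess12 p.g z - hess12 p.g z') ≤ c.Lg2 * ‖z - z'‖
  lip_grad_f : ∀ z z', ‖gradient p.f z - gradient p.f z'‖ ≤ c.Lf1 * ‖z - z'‖
  bound_grad2_f : ∀ x, ‖grad2 p.f (zStar p.g x)‖ ≤ c.Lf0
  bound_grad1_f : ∀ z, ‖grad1 p.f z‖ ≤ c.Cf0

/-- Bounded variance of the stochastic oracles. -/
structure Problem.BoundedVariance (p : Problem X Y Ξ Z) (c : Constants) : Prop where
  int_grad_F : ∀ z,
    Integrable (fun ξ => ‖gradient (fun z' => p.F z' ξ) z - gradient p.f z‖ ^ 2) p.lawξ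
  int_grad_G : ∀ z,
    Integrable (fun ζ => ‖gradient (fun z' => p.G z' ζ) z - gradient p.g z‖ ^ 2) p.lawζ
  int_hess_G : ∀ z,
    Integrable (fun ζ => frobenius (hess (fun z' => p.G z' ζ) z - hess p.g z) ^ 2) p.lawζ
  var_grad_F : ∀ z,
    ∫ ξ, ‖gradient (fun z' => p.F z' ξ) z - gradient p.f z‖ ^ 2 ∂p.lawξ ≤ c.σf1 ^ 2
  var_grad_G : ∀ z,
    ∫ ζ, ‖gradient (fun z' => p.G z' ζ) z - gradient p.g z‖ ^ 2 ∂p.lawζ ≤ c.σg1 ^ 2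
  var_hess_G : ∀ z,
    ∫ ζ, frobenius (hess (fun z' => p.G z' ζ) z - hess p.g z) ^ 2 ∂p.lawζ ≤ c.σg2 ^ 2

end Assumptions

/-! ### The algorithm, with oracle counters -/

/-- Batch sizes. The inner loop `t = -1, ..., T - 1` is indexed by `s = t + 1 = 0, ..., T`, so
that `b1t k s` is the size of the batch used in inner step `s` of outer iteration `k`. -/
structure BatchSizes where
  b1t : ℕ → ℕ → ℕ
  b1 : ℕ → ℕ
  b2 : ℕ → ℕ
  b3 : ℕ → ℕ
  b4 : ℕ → ℕ

/-- The lower bounds on the batch sizes in the first `K` outer iterations, with constant `cB`. -/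
structure BatchSizes.AtLeast (B : BatchSizes) (cB κ : ℝ) (K T : ℕ) : Prop where
  b1t_ge : ∀ k < K, ∀ s ≤ T, cB * κ ^ 2 ≤ (B.b1t k s : ℝ)
  b1_ge : ∀ k < K, cB * (κ * K + κ ^ 2) ≤ (B.b1 k : ℝ)
  b2_ge : ∀ k < K, cB * (κ ^ 3 * K + κ ^ 4) ≤ (B.b2 k : ℝ)
  b3_ge : ∀ k < K, cB * (K / κ) ≤ (B.b3 k : ℝ)
  b4_ge : ∀ k < K, cB * (K / κ) ≤ (B.b4 k : ℝ)

/-- Labels of the batches of lower-level samples. -/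
inductive GBatch where
  | b1t (k s : ℕ)
  | b1 (k : ℕ)
  | b2 (k : ℕ)
  | b4 (k : ℕ)

/-- The average of the first `b` terms. -/
def batchMean {V : Type*} [AddCommGroup V] [Module ℝ V] (b : ℕ) (h : ℕ → V) : V :=
  (b : ℝ)⁻¹ • ∑ i ∈ Finset.range b, h i

/-- State of the inner loop, with the number of Hessian-vector products made so far. -/
structure Inner (Y : Type*) where
  v : Y
  w : Y
  hvp : ℕ

/-- The inner SGD loop started at zero: after `s` steps, with stochastic Hessians `H` (step `s`
averages `size s` samples, each of which is applied to both `v` and `w`). -/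
def sgd {Y : Type*} [NormedAddCommGroup Y] [InnerProductSpace ℝ Y] (γ : ℝ) (H : ℕ → Y →L[ℝ] Y) (size : ℕ → ℕ) (Dy Du : Y) : ℕ → Inner Y
  | 0 => ⟨0, 0, 0⟩
  | s + 1 =>
    let q := sgd γ H size Dy Du s
    { v := q.v - γ • H s q.v + γ • Dy
      w := q.w - γ • H s q.w + γ • Du
      hvp := q.hvp + 2 * size s }

/-- Numbers of sample oracle calls: gradients of `F`, gradients of `G`, Jacobian-vector products
and Hessian-vector products with sample second derivatives of `G`. -/
structure OracleCount where
  gradF : ℕ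
  gradG : ℕ
  jvp : ℕ
  hvp : ℕ

/-- State of the outer loop, with the oracle calls made so far. -/
structure State (X Y : Type*) where
  x : X
  y : Y
  u : Y
  count : OracleCount

section Algorithm

variable {X Y : Type*} [NormedAddCommGroup X] [InnerProductSpace ℝ X] [FiniteDimensional ℝ X]
  [NormedAddCommGroup Y] [InnerProductSpace ℝ Y] [FiniteDimensional ℝ Y]
  [MeasurableSpace X] [MeasurableSpace Y]
  {Ξ Z : Type*} [MeasurableSpace Ξ] [MeasurableSpace Z]

/-- One outer iteration: `ξ i` are the samples of the batch `B₃ᵏ`, and `ζ` are the samples of the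
other batches. -/
def step (p : Problem X Y Ξ Z) (B : BatchSizes) (α γ : ℝ) (T k : ℕ) (ξ : ℕ → Ξ)
    (ζ : GBatch → ℕ → Z) (S : State X Y) : State X Y :=
  let z := pt S.x S.y
  let gF := batchMean (B.b3 k) fun i => gradient (fun z' => p.F z' (ξ i)) z
  let Dy := batchMean (B.b2 k) fun i => grad2 (fun z' => p.G z' (ζ (.b2 k) i)) z
  let Hu := batchMean (B.b1 k) fun i => hess22 (fun z' => p.G z' (ζ (.b1 k) i)) z S.u
  let Ju := batchMean (B.b4 k) fun i => hess12 (fun z' => p.G z' (ζ (.b4 k) i)) z S.u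
  let Du := Hu - gF.snd
  let Dx := gF.fst - Ju
  let H := fun s => batchMean (B.b1t k s) fun i => hess22 (fun z' => p.G z' (ζ (.b1t k s) i)) z
  let q := sgd γ H (B.b1t k) Dy Du (T + 1)
  { x := S.x - α • Dx
    y := S.y - q.v
    u := S.u - q.w
    count :=
      { gradF := S.count.gradF + B.b3 k
        gradG := S.count.gradG + B.b2 k
        jvp := S.count.jvp + B.b4 k
        hvp := S.count.hvp + B.b1 k + q.hvp } }

/-- The state after `k` outer iterations, started at `(x₀, y₀, u₀)`. -/
def iterate (p : Problem X Y Ξ Z) (B : BatchSizes) (α γ : ℝ) (T : ℕ) (ξ : ℕ → ℕ → Ξ)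
    (ζ : GBatch → ℕ → Z) (x₀ : X) (y₀ u₀ : Y) : ℕ → State X Y
  | 0 => ⟨x₀, y₀, u₀, ⟨0, 0, 0, 0⟩⟩
  | k + 1 => step p B α γ T k (ξ k) ζ (iterate p B α γ T ξ ζ x₀ y₀ u₀ k)

variable {Ω : Type*} [MeasurableSpace Ω]

/-- The sigma-algebras generated by the initial point and by the single samples. -/
@[reducible] def sourceAlgebra (x₀ : Ω → X) (y₀ u₀ : Ω → Y) (ξ : ℕ → ℕ → Ω → Ξ)
    (ζ : GBatch → ℕ → Ω → Z) : Option (ℕ × ℕ ⊕ GBatch × ℕ) → MeasurableSpace Ω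
  | none => MeasurableSpace.comap (fun ω => (x₀ ω, y₀ ω, u₀ ω)) inferInstance
  | some (.inl a) => MeasurableSpace.comap (ξ a.1 a.2) inferInstance
  | some (.inr a) => MeasurableSpace.comap (ζ a.1 a.2) inferInstance

/-- The randomness of a run: a random initial point and independent samples of the two laws. -/
structure Randomness (p : Problem X Y Ξ Z) (P : Measure Ω) where
  x₀ : Ω → X
  y₀ : Ω → Y
  u₀ : Ω → Y
  ξ : ℕ → ℕ → Ω → Ξ
  ζ : GBatch → ℕ → Ω → Z
  meas_x₀ : Measurable x₀
  meas_y₀ : Measurable y₀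
  meas_u₀ : Measurable u₀
  meas_ξ : ∀ k i, Measurable (ξ k i)
  meas_ζ : ∀ b i, Measurable (ζ b i)
  law_ξ : ∀ k i, P.map (ξ k i) = p.lawξ
  law_ζ : ∀ b i, P.map (ζ b i) = p.lawζ
  indep : iIndep (sourceAlgebra x₀ y₀ u₀ ξ ζ) P

/-- The random state of the algorithm after `k` outer iterations. -/
def Randomness.state {p : Problem X Y Ξ Z} {P : Measure Ω} (R : Randomness p P) (B : BatchSizes)
    (α γ : ℝ) (T k : ℕ) (ω : Ω) : State X Y :=
  iterate p B α γ T (fun j i => R.ξ j i ω) (fun b i => R.ζ b i ω) (R.x₀ ω) (R.y₀ ω) (R.u₀ ω) k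

/-- The initial point lies in the box. -/
structure Randomness.InBox {p : Problem X Y Ξ Z} {P : Measure Ω} (R : Randomness p P)
    (c : Constants) (μ : ℝ) : Prop where
  int_y : Integrable (fun ω => ‖R.y₀ ω - yStar p.g (R.x₀ ω)‖ ^ 2) P
  int_u : Integrable (fun ω => ‖R.u₀ ω - uStar p.f p.g (R.x₀ ω)‖ ^ 2) P
  box_y : ∫ ω, ‖R.y₀ ω - yStar p.g (R.x₀ ω)‖ ^ 2 ∂P
    ≤ min (μ ^ 2 / (20 * c.r * c.Lg2 ^ 2)) (1 / (4 * c.L1 μ))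
  box_u : ∫ ω, ‖R.u₀ ω - uStar p.f p.g (R.x₀ ω)‖ ^ 2 ∂P
    ≤ min (4 * c.L1 μ ^ 2 / (5 * c.r * c.Lg2 ^ 2)) (c.L1 μ / μ ^ 2)

/-- The optimal value `Φ*` is finite and the expected initial gap `E Φ(x⁰) - Φ*` is at most
`Δ`. -/
structure Randomness.InitialGap {p : Problem X Y Ξ Z} {P : Measure Ω} (R : Randomness p P)
    (Δ : ℝ) : Prop where
  bddBelow : BddBelow (Set.range (Phi p.f p.g))
  int_Phi : Integrable (fun ω => Phi p.f p.g (R.x₀ ω)) P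
  gap_le : ∫ ω, Phi p.f p.g (R.x₀ ω) ∂P - ⨅ x, Phi p.f p.g x ≤ Δ

/-- The moment-ratio bound along the iterates `k = 0, ..., K`. -/
def Randomness.MomentBound {p : Problem X Y Ξ Z} {P : Measure Ω} (R : Randomness p P)
    (B : BatchSizes) (α γ : ℝ) (T K : ℕ) (r : ℝ) : Prop :=
  ∀ k ≤ K,
    ∫ ω, ‖(R.state B α γ T k ω).y - yStar p.g (R.state B α γ T k ω).x‖ ^ 2 ∂P
      ≤ r * (∫ ω, ‖(R.state B α γ T k ω).y - yStar p.g (R.state B α γ T k ω).x‖ ∂P) ^ 2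

/-- All standing hypotheses on a problem and on a run of `K` outer iterations on it. -/
structure Setting (c : Constants) (μ Δ : ℝ) (p : Problem X Y Ξ Z) (P : Measure Ω)
    (R : Randomness p P) (B : BatchSizes) (α γ : ℝ) (T K : ℕ) : Prop where
  oracles : p.Oracles
  base : p.Base c μ
  variance : p.BoundedVariance c
  moment : R.MomentBound B α γ T K c.r
  box : R.InBox c μ
  gap : R.InitialGap Δ

/-- `Φ` is differentiable and `min_{0 ≤ k ≤ K - 1} E ‖∇Φ(xᵏ)‖² ≤ ε`. -/
def Randomness.Reaches {p : Problem X Y Ξ Z} {P : Measure Ω} (R : Randomness p P)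
    (B : BatchSizes) (α γ : ℝ) (T K : ℕ) (ε : ℝ) : Prop :=
  Differentiable ℝ (Phi p.f p.g) ∧
    ∃ k < K,
      Integrable (fun ω => ‖gradient (Phi p.f p.g) (R.state B α γ T k ω).x‖ ^ 2) P ∧
      ∫ ω, ‖gradient (Phi p.f p.g) (R.state B α γ T k ω).x‖ ^ 2 ∂P ≤ ε

end Algorithm

end NSBO

end

set_option linter.unusedSectionVars false

noncomputable section

namespace NSBO

/-! ### Linear algebra and convexity -/

section General

variable {E : Type*} [NormedAddCommGroup E] [InnerProductSpace ℝ E]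

/-! Each outer iteration is a noisy Newton step for the lower level. Run on `D_y`, the inner loop
approximates `H⁻¹ ∇₂g` at the current point, so `y` lands within `(L_{g,2}/μ) ‖y - y*‖²` of `y*(x)`,
up to a relative error `ρ` and sampling noise. Run on `D_u`, it replaces `u` by an approximation of
`H⁻¹ ∇₂f`, which is within `(L₁/μ) ‖y - y*‖` of `u*(x)` whatever `u` was. The upper variable makes a
stochastic gradient step on `Φ`, whose gradient `∇₁f - ∇²₁₂g u*` at `(x, y*)` has a Lipschitz
constant of order `κ³`; this forces `α ~ κ⁻³`.

The difficulty is the quadratic term: squaring it would produce a fourth moment. Instead the first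
moment of `‖y - y*‖` is propagated (`fixed_y`, `devY_succ`), which involves only `E‖y - y*‖²`, and
the moment-ratio bound `r` converts the result back into a second moment. Inside the box
`(L_{g,2}/μ)² E‖y - y*‖² ≤ 1/(20r)`, so the quadratic term acts like a small linear one and `E‖y -
y*‖²` contracts by `1/4` (`sq_moment_step`). The error of `u` propagates linearly, so second moments
suffice there (`devU_succ`).

Put `a = κ⁴ E‖y - y*‖²`, `b = E‖u - u*‖²` and `d = E‖D̄ₓ‖²`. The Lipschitz constants of `y*` and
`u*` are of order `κ` and `κ³`, which `α` compensates, so that `a' ≤ a/4 + O(κ³/K) + O(cα) d` and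
`b' ≤ b/4 + O(1) a + O(κ³/K) + O(cα) d` (`Tuned.y_step`, `Tuned.u_step`). The descent inequality for
`Φ` loses `O(α)(a + b)` but leaves `-(α/4) d` to pay for the movement of the targets (`fixed_Phi`,
`Phi_succ`). Hence `E Φ + α (weightY a + weightU b)` decreases by `(α/2) E‖∇Φ‖²` up to noise, and
telescoping gives the rate `κ³/K` (`exists_le_of_potential`). The parts of the batch sizes
proportional to `K` make every noise term of order `κ³/K`; the summands `κ²` and `κ⁴` keep `E‖y -
y*‖²` in its box and `b ≤ Cb κ²`.

All estimates are first proved at a deterministic point. The iterate depends only on earlier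
samples, hence is independent of the fresh ones, and the estimates are then integrated over its law
(`integrable_of_decouple`, `integral_le_of_decouple`). -/

/-- A strongly convex differentiable function lies above its tangent paraboloids. -/
theorem strongConvex_tangent_le {φ : E → ℝ} {μ : ℝ} (h : StrongConvexOn Set.univ μ φ)
    {φ' : E →L[ℝ] ℝ} {y : E} (hd : HasFDerivAt φ φ' y) (y' : E) :
    φ y + φ' (y' - y) + μ / 2 * ‖y' - y‖ ^ 2 ≤ φ y' := by
  -- Subtracting `μ/2 ‖·‖²` leaves a convex function; on the line from `y` to `y'` its chord slope
  -- over `[0, 1]` dominates its derivative at `0`.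
  rw [strongConvexOn_iff_convex] at h
  have hl : HasDerivAt (fun t : ℝ => y + t • (y' - y)) (y' - y) 0 := by
    simpa using ((hasDerivAt_id (0 : ℝ)).smul_const (y' - y)).const_add y
  have hφ : HasDerivAt (fun t : ℝ => φ (y + t • (y' - y))) (φ' (y' - y)) 0 := by
    have hd' : HasFDerivAt φ φ' (y + (0 : ℝ) • (y' - y)) := by simpa using hd
    exact hd'.comp_hasDerivAt 0 hl
  have hn : HasDerivAt (fun t : ℝ => ‖y + t • (y' - y)‖ ^ 2) (2 * inner ℝ y (y' - y)) 0 := by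
    simpa using hl.norm_sq
  have hc : ConvexOn ℝ Set.univ
      (fun t : ℝ => φ (y + t • (y' - y)) - μ / 2 * ‖y + t • (y' - y)‖ ^ 2) := by
    have := h.comp_affineMap (AffineMap.lineMap y y' : ℝ →ᵃ[ℝ] E)
    have hfun : ((fun x => φ x - μ / 2 * ‖x‖ ^ 2) ∘ (AffineMap.lineMap y y' : ℝ →ᵃ[ℝ] E))
        = fun t : ℝ => φ (y + t • (y' - y)) - μ / 2 * ‖y + t • (y' - y)‖ ^ 2 := by
      funext t
      simp [AffineMap.lineMap_apply, add_comm]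
    rw [hfun] at this
    simpa using this
  have key := hc.le_slope_of_hasDerivAt (Set.mem_univ 0) (Set.mem_univ 1) zero_lt_one
    (hφ.sub (hn.const_mul (μ / 2)))
  simp only [slope_def_field, one_smul, zero_smul, add_zero, sub_zero, div_one,
    add_sub_cancel] at key
  have e : ‖y'‖ ^ 2 = ‖y‖ ^ 2 + 2 * inner ℝ y (y' - y) + ‖y' - y‖ ^ 2 := by
    rw [← norm_add_sq_real]; simp
  rw [e] at key
  linarith

/-- A symmetric operator with quadratic form in `[0, q]` has norm at most `q`. -/
theorem norm_apply_le_of_quadForm {A : E →L[ℝ] E} {q : ℝ}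
    (hs : ∀ v w, inner ℝ (A v) w = inner ℝ v (A w))
    (h0 : ∀ v, 0 ≤ inner ℝ (A v) v) (h1 : ∀ v, inner ℝ (A v) v ≤ q * ‖v‖ ^ 2) (v : E) :
    ‖A v‖ ≤ q * ‖v‖ := by
  by_cases hv : v = 0
  · simp [hv]
  have hv0 : 0 < ‖v‖ := norm_pos_iff.mpr hv
  have hq : 0 ≤ q := by
    have := (h0 v).trans (h1 v)
    by_contra hn
    have : q * ‖v‖ ^ 2 < 0 := mul_neg_of_neg_of_pos (not_le.mp hn) (by positivity)
    linarith
  -- The form is nonnegative at `v - t A v`. The resulting quadratic in `t` is smallest at `t =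
  -- 1/q`, which is the choice below when `q > 0`.
  have key : ∀ t : ℝ, 0 ≤ inner ℝ (A v) v - 2 * t * ‖A v‖ ^ 2 + t ^ 2 * (q * ‖A v‖ ^ 2) := by
    intro t
    have h := h0 (v - t • A v)
    have e : inner ℝ (A (v - t • A v)) (v - t • A v)
        = inner ℝ (A v) v - 2 * t * ‖A v‖ ^ 2 + t ^ 2 * inner ℝ (A (A v)) (A v) := by
      simp only [map_sub, map_smul, inner_sub_left, inner_sub_right, inner_smul_left,
        inner_smul_right, hs (A v) v, real_inner_self_eq_norm_sq]
      simp
      ring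
    rw [e] at h
    nlinarith [h1 (A v), sq_nonneg t]
  rcases hq.eq_or_lt with rfl | hq
  · have := key 1
    have h1v := h1 v
    have : ‖A v‖ ^ 2 ≤ 0 := by nlinarith
    have : ‖A v‖ = 0 := by
      have := le_antisymm this (sq_nonneg _)
      exact pow_eq_zero_iff (two_ne_zero) |>.mp this
    simp [this]
  · have h := key q⁻¹
    have h1v := h1 v
    have e : q⁻¹ ^ 2 * (q * ‖A v‖ ^ 2) = q⁻¹ * ‖A v‖ ^ 2 := by field_simp
    rw [e] at h
    have h2 : q⁻¹ * ‖A v‖ ^ 2 ≤ q * ‖v‖ ^ 2 := by linarith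
    have h3 : ‖A v‖ ^ 2 ≤ (q * ‖v‖) ^ 2 := by
      rw [inv_mul_le_iff₀ hq] at h2
      linarith
    exact (pow_le_pow_iff_left₀ (norm_nonneg _) (by positivity) two_ne_zero).mp h3

variable [FiniteDimensional ℝ E]

/-- A coercive operator in finite dimension is inverted by `ContinuousLinearMap.inverse`. -/
theorem coercive_inverse {A : E →L[ℝ] E} {μ : ℝ} (hμ : 0 < μ)
    (h : ∀ v, μ * ‖v‖ ^ 2 ≤ inner ℝ (A v) v) :
    (∀ v, A.inverse (A v) = v) ∧ (∀ v, A (A.inverse v) = v) ∧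
      ∀ v, ‖A.inverse v‖ ≤ ‖v‖ / μ := by
  have hlow : ∀ v, ‖v‖ ≤ ‖A v‖ / μ := by
    intro v
    rw [le_div_iff₀ hμ]
    by_cases hv : v = 0
    · simp [hv]
    have h2 := (h v).trans (real_inner_le_norm _ _)
    have hv0 : 0 < ‖v‖ := norm_pos_iff.mpr hv
    nlinarith
  have hinj : Function.Injective A := by
    rw [injective_iff_map_eq_zero]
    intro v hv
    have := hlow v
    rw [hv] at this
    simpa using this
  -- Finite dimension upgrades injectivity to invertibility, so `inverse` is not its default value
  -- `0`.
  let e : E ≃L[ℝ] E := (LinearEquiv.ofInjectiveEndo (A : E →ₗ[ℝ] E) hinj).toContinuousLinearEquiv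
  have he : (e : E →L[ℝ] E) = A := by ext v; rfl
  have hinv : A.inverse = e.symm := by rw [← he, ContinuousLinearMap.inverse_equiv]
  have h2 : ∀ v, A (A.inverse v) = v := by
    intro v
    have : A (A.inverse v) = e (e.symm v) := by rw [hinv]; rfl
    rw [this]; simp
  refine ⟨fun v => ?_, h2, fun v => ?_⟩
  · exact hinj (h2 (A v))
  · have := hlow (A.inverse v)
    rwa [h2] at this

/-- The operator norm is at most the Frobenius norm. -/
theorem norm_apply_le_frobenius {W : Type*} [NormedAddCommGroup W] [NormedSpace ℝ W]
    (A : E →L[ℝ] W) (v : E) : ‖A v‖ ≤ frobenius A * ‖v‖ := by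
  set b := stdOrthonormalBasis ℝ E
  have hv : A v = ∑ i, inner ℝ (b i) v • A (b i) := by
    conv_lhs => rw [← b.sum_repr' v]
    simp
  calc ‖A v‖ ≤ ∑ i, |inner ℝ (b i) v| * ‖A (b i)‖ := by
        rw [hv]
        refine (norm_sum_le _ _).trans (le_of_eq ?_)
        simp [norm_smul]
    _ ≤ Real.sqrt (∑ i, |inner ℝ (b i) v| ^ 2) * Real.sqrt (∑ i, ‖A (b i)‖ ^ 2) :=
        Real.sum_mul_le_sqrt_mul_sqrt _ _ _
    _ = frobenius A * ‖v‖ := by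
        have : ∑ i, |inner ℝ (b i) v| ^ 2 = ‖v‖ ^ 2 := by
          simpa [Real.norm_eq_abs] using b.sum_sq_norm_inner_right v
        rw [this, Real.sqrt_sq (norm_nonneg _), mul_comm]
        rfl

theorem norm_le_frobenius {W : Type*} [NormedAddCommGroup W] [NormedSpace ℝ W]
    (A : E →L[ℝ] W) : ‖A‖ ≤ frobenius A :=
  A.opNorm_le_bound (Real.sqrt_nonneg _) (norm_apply_le_frobenius A)

end General

/-! ### The product space -/

section Product

variable {X Y : Type*} [NormedAddCommGroup X] [InnerProductSpace ℝ X] [FiniteDimensional ℝ X]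
  [NormedAddCommGroup Y] [InnerProductSpace ℝ Y] [FiniteDimensional ℝ Y]

theorem norm_pt_sq (x : X) (y : Y) : ‖pt x y‖ ^ 2 = ‖x‖ ^ 2 + ‖y‖ ^ 2 :=
  WithLp.prod_norm_sq_eq_of_L2 (pt x y)

theorem norm_pt_le (x : X) (y : Y) : ‖pt x y‖ ≤ ‖x‖ + ‖y‖ := by
  refine (pow_le_pow_iff_left₀ (norm_nonneg _) (by positivity) two_ne_zero).mp ?_
  rw [norm_pt_sq]
  nlinarith [norm_nonneg x, norm_nonneg y]

theorem pt_sub (x x' : X) (y y' : Y) : pt x y - pt x' y' = pt (x - x') (y - y') := rfl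

theorem norm_pt_zero_left (y : Y) : ‖pt (0 : X) y‖ = ‖y‖ := by
  have := norm_pt_sq (0 : X) y
  simp only [norm_zero, ne_eq, OfNat.ofNat_ne_zero, not_false_eq_true, zero_pow, zero_add] at this
  exact (pow_left_inj₀ (norm_nonneg _) (norm_nonneg _) two_ne_zero).mp this

theorem norm_pt_zero_right (x : X) : ‖pt x (0 : Y)‖ = ‖x‖ := by
  have := norm_pt_sq x (0 : Y)
  simp only [norm_zero, ne_eq, OfNat.ofNat_ne_zero, not_false_eq_true, zero_pow, add_zero] at this
  exact (pow_left_inj₀ (norm_nonneg _) (norm_nonneg _) two_ne_zero).mp this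

theorem inner_pt (z : Pt X Y) (x : X) (y : Y) :
    inner ℝ z (pt x y) = inner ℝ z.fst x + inner ℝ z.snd y := rfl

theorem inner_pt_left (z : Pt X Y) (x : X) (y : Y) :
    inner ℝ (pt x y) z = inner ℝ x z.fst + inner ℝ y z.snd := rfl

theorem pt_eq_add (x : X) (y : Y) : pt x y = pt x 0 + pt 0 y := by
  simp [pt, ← WithLp.toLp_add]

theorem norm_fst_le (z : Pt X Y) : ‖z.fst‖ ≤ ‖z‖ := WithLp.norm_fst_le _ z

theorem norm_snd_le (z : Pt X Y) : ‖z.snd‖ ≤ ‖z‖ := WithLp.norm_snd_le _ z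

theorem hasFDerivAt_pt_right (x : X) (y : Y) :
    HasFDerivAt (fun y => pt x y) (inY X Y) y := by
  have h : (fun y : Y => pt x y) = fun y => pt x 0 + inY X Y y := by
    funext y'; exact pt_eq_add x y'
  rw [h]
  exact (inY X Y).hasFDerivAt.const_add _

theorem continuous_pt : Continuous fun q : X × Y => pt q.1 q.2 :=
  WithLp.prod_continuous_toLp 2 X Y

theorem hess22_apply (h : Pt X Y → ℝ) (z : Pt X Y) (v : Y) :
    hess22 h z v = (hess h z (pt 0 v)).snd := rfl

theorem hess12_apply (h : Pt X Y → ℝ) (z : Pt X Y) (v : Y) :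
    hess12 h z v = (hess h z (pt 0 v)).fst := rfl

end Product

/-! ### The deterministic bilevel problem -/

section Bilevel

variable {X Y : Type*} [NormedAddCommGroup X] [InnerProductSpace ℝ X] [FiniteDimensional ℝ X]
  [NormedAddCommGroup Y] [InnerProductSpace ℝ Y] [FiniteDimensional ℝ Y]
  [MeasurableSpace X] [MeasurableSpace Y]
  {Ξ Z : Type*} [MeasurableSpace Ξ] [MeasurableSpace Z]
  {p : Problem X Y Ξ Z} {c : Constants} {μ : ℝ}

theorem hasFDerivAt_of_gradient {h : Pt X Y → ℝ} (hh : Differentiable ℝ h) (z : Pt X Y) :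
    HasFDerivAt h (innerSL ℝ (gradient h z)) z :=
  (hh z).hasGradientAt.hasFDerivAt

theorem hasFDerivAt_right {h : Pt X Y → ℝ} (hh : Differentiable ℝ h) (x : X) (y : Y) :
    HasFDerivAt (fun y => h (pt x y)) (innerSL ℝ (grad2 h (pt x y))) y := by
  have := (hasFDerivAt_of_gradient hh (pt x y)).comp y (hasFDerivAt_pt_right x y)
  have e : innerSL ℝ (grad2 h (pt x y)) = innerSL ℝ (gradient h (pt x y)) ∘L inY X Y := by
    refine ContinuousLinearMap.ext fun v => ?_
    change inner ℝ (gradient h (pt x y)).snd v = inner ℝ (gradient h (pt x y)) (pt 0 v)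
    rw [inner_pt]
    simp
  rw [e]
  exact this

theorem hasFDerivAt_grad2_right {h : Pt X Y → ℝ} (hh : Differentiable ℝ (gradient h)) (x : X)
    (y : Y) : HasFDerivAt (fun y => grad2 h (pt x y)) (hess22 h (pt x y)) y :=
  ((WithLp.sndL 2 ℝ X Y).hasFDerivAt).comp y
    ((hh (pt x y)).hasFDerivAt.comp y (hasFDerivAt_pt_right x y))

/-- Symmetry of the second derivative needs only differentiability of the gradient, not continuity
of the Hessian. -/
theorem hess_symm {h : Pt X Y → ℝ} (hh : Differentiable ℝ h) (hh' : Differentiable ℝ (gradient h))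
    (z v w : Pt X Y) : inner ℝ (hess h z v) w = inner ℝ v (hess h z w) := by
  have h2 : HasFDerivAt (fun z => innerSL ℝ (gradient h z)) ((innerSL ℝ) ∘L hess h z) z :=
    ((innerSL ℝ (E := Pt X Y)).hasFDerivAt).comp z (hh' z).hasFDerivAt
  have := second_derivative_symmetric (fun y => hasFDerivAt_of_gradient hh y) h2 v w
  rw [real_inner_comm (hess h z w) v]
  exact this

theorem hess22_symm {h : Pt X Y → ℝ} (hh : Differentiable ℝ h)
    (hh' : Differentiable ℝ (gradient h)) (z : Pt X Y) (v w : Y) :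
    inner ℝ (hess22 h z v) w = inner ℝ v (hess22 h z w) := by
  have := hess_symm hh hh' z (pt 0 v) (pt 0 w)
  rw [inner_pt, inner_pt_left] at this
  simpa [hess22_apply] using this

/-! ### Consequences of strong convexity and smoothness. -/

namespace Problem.Base

variable (hb : p.Base c μ)

include hb

theorem norm_hess_le (z : Pt X Y) : ‖hess p.g z‖ ≤ c.Lg1 := by
  have : LipschitzWith (Real.toNNReal c.Lg1) (gradient p.g) :=
    LipschitzWith.of_dist_le' fun z z' => by simpa [dist_eq_norm] using hb.lip_grad_g z z'
  have h := norm_fderiv_le_of_lipschitz ℝ this (x₀ := z)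
  rwa [Real.coe_toNNReal _ c.Lg1_pos.le] at h

theorem norm_hess_apply_le (z v : Pt X Y) : ‖hess p.g z v‖ ≤ c.Lg1 * ‖v‖ :=
  (hess p.g z).le_of_opNorm_le (hb.norm_hess_le z) v

theorem norm_hess22_apply_le (z : Pt X Y) (v : Y) : ‖hess22 p.g z v‖ ≤ c.Lg1 * ‖v‖ := by
  have := hb.norm_hess_apply_le z (pt 0 v)
  rw [norm_pt_zero_left] at this
  exact (norm_snd_le _).trans this

theorem norm_hess12_apply_le (z : Pt X Y) (v : Y) : ‖hess12 p.g z v‖ ≤ c.Lg1 * ‖v‖ := by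
  have := hb.norm_hess_apply_le z (pt 0 v)
  rw [norm_pt_zero_left] at this
  exact (norm_fst_le _).trans this

theorem tangent_le (x : X) (y y' : Y) :
    p.g (pt x y) + inner ℝ (grad2 p.g (pt x y)) (y' - y) + μ / 2 * ‖y' - y‖ ^ 2
      ≤ p.g (pt x y') :=
  strongConvex_tangent_le (hb.strong_convex x) (hasFDerivAt_right hb.diff_g x y) y'

theorem strong_mono (x : X) (y y' : Y) :
    μ * ‖y - y'‖ ^ 2 ≤ inner ℝ (grad2 p.g (pt x y) - grad2 p.g (pt x y')) (y - y') := by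
  have h1 := hb.tangent_le x y y'
  have h2 := hb.tangent_le x y' y
  have e1 : inner ℝ (grad2 p.g (pt x y)) (y' - y) = - inner ℝ (grad2 p.g (pt x y)) (y - y') := by
    rw [← inner_neg_right, neg_sub]
  rw [inner_sub_left]
  rw [e1, norm_sub_rev y' y] at h1
  linarith

/-- By strong monotonicity, the partial gradient along `y + t v`, paired with `v` and reduced by `t
μ ‖v‖²`, is monotone in `t`; its derivative at `0` is therefore nonnegative. -/
theorem coercive (z : Pt X Y) (v : Y) : μ * ‖v‖ ^ 2 ≤ inner ℝ (hess22 p.g z v) v := by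
  obtain ⟨x, y, rfl⟩ : ∃ x y, z = pt x y := ⟨z.fst, z.snd, rfl⟩
  have hl : HasDerivAt (fun t : ℝ => y + t • v) v 0 := by
    simpa using ((hasDerivAt_id (0 : ℝ)).smul_const v).const_add y
  have hg : HasDerivAt (fun t : ℝ => grad2 p.g (pt x (y + t • v))) (hess22 p.g (pt x y) v) 0 := by
    have hd : HasFDerivAt (fun y => grad2 p.g (pt x y)) (hess22 p.g (pt x y))
        (y + (0 : ℝ) • v) := by
      simpa using hasFDerivAt_grad2_right hb.diff_grad_g x y
    exact hd.comp_hasDerivAt 0 hl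
  have hi : HasDerivAt (fun t : ℝ => inner ℝ (grad2 p.g (pt x (y + t • v))) v - t * (μ * ‖v‖ ^ 2))
      (inner ℝ (hess22 p.g (pt x y) v) v - 1 * (μ * ‖v‖ ^ 2)) 0 := by
    refine HasDerivAt.sub ?_ ((hasDerivAt_id (0 : ℝ)).mul_const _)
    simpa using hg.inner ℝ (hasDerivAt_const (0 : ℝ) v)
  have hm : Monotone
      (fun t : ℝ => inner ℝ (grad2 p.g (pt x (y + t • v))) v - t * (μ * ‖v‖ ^ 2)) := by
    intro s t hst
    rcases hst.eq_or_lt with rfl | hst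
    · exact le_rfl
    have h := hb.strong_mono x (y + t • v) (y + s • v)
    have e : y + t • v - (y + s • v) = (t - s) • v := by rw [sub_smul]; abel
    rw [e, norm_smul, inner_smul_right, inner_sub_left, Real.norm_of_nonneg (by linarith)] at h
    have h' : (t - s) * ((t - s) * (μ * ‖v‖ ^ 2)) ≤ (t - s) *
        (inner ℝ (grad2 p.g (pt x (y + t • v))) v - inner ℝ (grad2 p.g (pt x (y + s • v))) v) := by
      linarith
    have := le_of_mul_le_mul_left h' (by linarith)
    simp only
    linarith
  have := hi.nonneg_of_monotone hm
  linarith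

variable (hμ : 0 < μ)

include hμ

theorem hess22_inverse_apply (z : Pt X Y) (v : Y) :
    (hess22 p.g z).inverse (hess22 p.g z v) = v :=
  (coercive_inverse hμ (hb.coercive z)).1 v

theorem hess22_apply_inverse (z : Pt X Y) (v : Y) :
    hess22 p.g z ((hess22 p.g z).inverse v) = v :=
  (coercive_inverse hμ (hb.coercive z)).2.1 v

theorem norm_inverse_le (z : Pt X Y) (v : Y) :
    ‖(hess22 p.g z).inverse v‖ ≤ ‖v‖ / μ :=
  (coercive_inverse hμ (hb.coercive z)).2.2 v

omit hμ in
-- This is the contraction of the mean inner step. `I - γH` is symmetric; its form is nonnegative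
-- because `γ L_{g,1} ≤ 1`, and coercivity of `H` bounds it above.
theorem norm_sub_smul_hess22_le {γ : ℝ} (hγ : 0 ≤ γ) (hγ1 : γ * c.Lg1 ≤ 1) (z : Pt X Y) (v : Y) :
    ‖v - γ • hess22 p.g z v‖ ≤ (1 - γ * μ) * ‖v‖ := by
  have key := norm_apply_le_of_quadForm (A := ContinuousLinearMap.id ℝ Y - γ • hess22 p.g z)
    (q := 1 - γ * μ) ?_ ?_ ?_ v
  · simpa using key
  · intro v w
    have := hess22_symm hb.diff_g hb.diff_grad_g z v w
    simp only [_root_.sub_apply, ContinuousLinearMap.id_apply,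
      _root_.smul_apply, inner_sub_left, inner_sub_right, inner_smul_left,
      inner_smul_right, this]
    simp
  · intro v
    have h1 := (real_inner_le_norm (hess22 p.g z v) v)
    have h2 := mul_le_mul_of_nonneg_right (hb.norm_hess22_apply_le z v) (norm_nonneg v)
    simp only [_root_.sub_apply, ContinuousLinearMap.id_apply,
      _root_.smul_apply, inner_sub_left, inner_smul_left, real_inner_self_eq_norm_sq]
    simp only [conj_trivial]
    nlinarith [sq_nonneg ‖v‖]
  · intro v
    have h1 := hb.coercive z v
    simp only [_root_.sub_apply, ContinuousLinearMap.id_apply,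
      _root_.smul_apply, inner_sub_left, inner_smul_left, real_inner_self_eq_norm_sq]
    simp only [conj_trivial]
    nlinarith

/-- The tangent paraboloid at `y = 0` forces growth at infinity. Existence makes the choice in
`yStar` an actual minimizer. -/
theorem exists_minimizer (x : X) : ∃ y, ∀ y', p.g (pt x y) ≤ p.g (pt x y') := by
  refine Continuous.exists_forall_le ?_ ?_
  · exact continuous_iff_continuousAt.mpr fun y => (hasFDerivAt_right hb.diff_g x y).continuousAt
  · set G := grad2 p.g (pt x 0)
    have hlow : ∀ y, p.g (pt x 0) + ‖y‖ * (μ / 2 * ‖y‖ - ‖G‖) ≤ p.g (pt x y) := by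
      intro y
      have h := hb.tangent_le x 0 y
      have h2 := neg_le_of_abs_le (abs_real_inner_le_norm G y)
      simp only [sub_zero] at h
      nlinarith
    refine Filter.tendsto_atTop_mono hlow ?_
    refine Filter.tendsto_atTop_add_const_left _ _ ?_
    have hn := tendsto_norm_cocompact_atTop (E := Y)
    refine hn.atTop_mul_atTop₀ ?_
    exact Filter.tendsto_atTop_add_const_right _ _ (hn.const_mul_atTop (by positivity))

theorem yStar_le (x : X) (y : Y) : p.g (pt x (yStar p.g x)) ≤ p.g (pt x y) :=
  Classical.epsilon_spec (hb.exists_minimizer hμ x) y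

theorem grad2_zStar (x : X) : grad2 p.g (zStar p.g x) = 0 := by
  have hm : IsLocalMin (fun y => p.g (pt x y)) (yStar p.g x) :=
    Filter.Eventually.of_forall (hb.yStar_le hμ x)
  have := hm.hasFDerivAt_eq_zero (hasFDerivAt_right hb.diff_g x _)
  have h2 := congrArg (fun A => A (grad2 p.g (zStar p.g x))) this
  have h3 : inner ℝ (grad2 p.g (zStar p.g x)) (grad2 p.g (zStar p.g x)) = 0 := h2
  simpa using h3

/-- Strong monotonicity is applied at the same `x` to `y*(x)` and `y*(x')`. The gradient at `(x,
y*(x'))` is small because it vanishes at `(x', y*(x'))`. -/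
theorem norm_yStar_sub_le (x x' : X) :
    ‖yStar p.g x - yStar p.g x'‖ ≤ c.Lg1 / μ * ‖x - x'‖ := by
  set y := yStar p.g x
  set y' := yStar p.g x'
  have h := hb.strong_mono x y y'
  have e1 : grad2 p.g (pt x y) = 0 := hb.grad2_zStar hμ x
  have e2 : grad2 p.g (pt x' y') = 0 := hb.grad2_zStar hμ x'
  have h2 : ‖grad2 p.g (pt x y')‖ ≤ c.Lg1 * ‖x - x'‖ := by
    have e3 : grad2 p.g (pt x y') = (gradient p.g (pt x y') - gradient p.g (pt x' y')).snd := by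
      have : (gradient p.g (pt x y') - gradient p.g (pt x' y')).snd
        = grad2 p.g (pt x y') - grad2 p.g (pt x' y') := rfl
      rw [this, e2, sub_zero]
    rw [e3]
    refine (norm_snd_le _).trans ((hb.lip_grad_g _ _).trans (le_of_eq ?_))
    rw [pt_sub, sub_self, norm_pt_zero_right]
  rw [e1, zero_sub, inner_neg_left] at h
  have h3 := neg_le_of_abs_le (abs_real_inner_le_norm (grad2 p.g (pt x y')) (y - y'))
  rw [div_mul_eq_mul_div, le_div_iff₀ hμ]
  by_cases hy : ‖y - y'‖ = 0
  · rw [hy]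
    have := c.Lg1_pos
    have := norm_nonneg (x - x')
    nlinarith
  · have hy : 0 < ‖y - y'‖ := lt_of_le_of_ne (norm_nonneg _) (Ne.symm hy)
    have : ‖y - y'‖ * (‖y - y'‖ * μ) ≤ ‖y - y'‖ * (c.Lg1 * ‖x - x'‖) := by nlinarith
    exact le_of_mul_le_mul_left this hy

theorem norm_zStar_sub_le (x x' : X) :
    ‖zStar p.g x - zStar p.g x'‖ ≤ (1 + c.Lg1 / μ) * ‖x - x'‖ := by
  have h := hb.norm_yStar_sub_le hμ x x'
  have := norm_pt_le (x - x') (yStar p.g x - yStar p.g x')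
  rw [zStar, zStar, pt_sub]
  linarith

theorem continuous_yStar : Continuous (yStar p.g) := by
  have : LipschitzWith (Real.toNNReal (c.Lg1 / μ)) (yStar p.g) :=
    LipschitzWith.of_dist_le' fun z z' => by
      simpa [dist_eq_norm] using hb.norm_yStar_sub_le hμ z z'
  exact this.continuous

theorem continuous_zStar : Continuous (zStar p.g) :=
  continuous_pt.comp (continuous_id.prodMk (hb.continuous_yStar hμ))

omit hμ in
theorem norm_hess22_sub_apply_le (z z' : Pt X Y) (v : Y) :
    ‖hess22 p.g z v - hess22 p.g z' v‖ ≤ c.Lg2 * ‖z - z'‖ * ‖v‖ :=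
  (norm_apply_le_frobenius (hess22 p.g z - hess22 p.g z') v).trans
    (mul_le_mul_of_nonneg_right (hb.lip_hess22_g z z') (norm_nonneg v))

omit hμ in
theorem norm_hess12_sub_apply_le (z z' : Pt X Y) (v : Y) :
    ‖hess12 p.g z v - hess12 p.g z' v‖ ≤ c.Lg2 * ‖z - z'‖ * ‖v‖ :=
  (norm_apply_le_frobenius (hess12 p.g z - hess12 p.g z') v).trans
    (mul_le_mul_of_nonneg_right (hb.lip_hess12_g z z') (norm_nonneg v))

omit hμ in
theorem norm_grad2_f_sub_le (z z' : Pt X Y) :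
    ‖grad2 p.f z - grad2 p.f z'‖ ≤ c.Lf1 * ‖z - z'‖ :=
  (norm_snd_le (gradient p.f z - gradient p.f z')).trans (hb.lip_grad_f z z')

omit hμ in
theorem norm_grad1_f_sub_le (z z' : Pt X Y) :
    ‖grad1 p.f z - grad1 p.f z'‖ ≤ c.Lf1 * ‖z - z'‖ :=
  (norm_fst_le (gradient p.f z - gradient p.f z')).trans (hb.lip_grad_f z z')

/-- The hypergradient `∇₁ f(x, y*) - ∇²₁₂ g(x, y*) u*`. -/
theorem hasGradientAt_Phi (x : X) :
    HasGradientAt (Phi p.f p.g)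
      (grad1 p.f (zStar p.g x) - hess12 p.g (zStar p.g x) (uStar p.f p.g x)) x := by
  set z := zStar p.g x with hz
  set H := hess p.g z
  set I := (hess22 p.g z).inverse
  -- the derivative of `y*`
  let D : X →L[ℝ] Y := -(I ∘L WithLp.sndL 2 ℝ X Y ∘L H ∘L
    ((WithLp.prodContinuousLinearEquiv 2 ℝ X Y).symm.toContinuousLinearMap ∘L
      ContinuousLinearMap.inl ℝ X Y))
  have hD : ∀ v, D v = -I (H (pt v 0)).snd := fun v => rfl
  have hy : HasFDerivAt (yStar p.g) D x := by
    have hg := (hb.diff_grad_g z).hasFDerivAt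
    have ho := hg.isLittleO
    -- The Lipschitz bound on `z*` turns a remainder `o(z*(x') - z)` into `o(x' - x)`, so no
    -- implicit function theorem is needed.
    have hbig : (fun x' => zStar p.g x' - z) =O[nhds x] fun x' => x' - x := by
      refine Asymptotics.IsBigO.of_bound (1 + c.Lg1 / μ) (Filter.Eventually.of_forall fun x' => ?_)
      exact hb.norm_zStar_sub_le hμ x' x
    have ht : Filter.Tendsto (zStar p.g) (nhds x) (nhds z) := (hb.continuous_zStar hμ).tendsto x
    have ho2 := (ho.comp_tendsto ht).trans_isBigO hbig
    rw [hasFDerivAt_iff_isLittleO]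
    refine Asymptotics.IsBigO.trans_isLittleO ?_ ho2
    refine Asymptotics.IsBigO.of_bound (1 / μ) (Filter.Eventually.of_forall fun x' => ?_)
    -- The partial gradient `∇₂g` vanishes at both `z*(x')` and `z`, so solving its linearization
    -- for the increment of `y*` leaves only the Taylor remainder.
    have e : yStar p.g x' - yStar p.g x - D (x' - x)
        = -I (gradient p.g (zStar p.g x') - gradient p.g z - H (zStar p.g x' - z)).snd := by
      have e1 : (gradient p.g (zStar p.g x') - gradient p.g z - H (zStar p.g x' - z)).snd
          = grad2 p.g (zStar p.g x') - grad2 p.g z - (H (zStar p.g x' - z)).snd := rfl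
      have e2 : zStar p.g x' - z = pt (x' - x) 0 + pt 0 (yStar p.g x' - yStar p.g x) := by
        rw [← pt_eq_add]; rfl
      have e3 : (H (pt (x' - x) 0 + pt 0 (yStar p.g x' - yStar p.g x))).snd
          = (H (pt (x' - x) 0)).snd + hess22 p.g z (yStar p.g x' - yStar p.g x) := by
        rw [map_add]; rfl
      rw [e1, hb.grad2_zStar hμ, hb.grad2_zStar hμ, e2, e3, hD, sub_zero, zero_sub, map_neg,
        map_add, hb.hess22_inverse_apply hμ]
      abel
    rw [e, norm_neg]
    refine (hb.norm_inverse_le hμ z _).trans ?_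
    rw [div_eq_inv_mul, one_div]
    exact mul_le_mul_of_nonneg_left (norm_snd_le _) (by positivity)
  have hzd : HasFDerivAt (zStar p.g)
      ((WithLp.prodContinuousLinearEquiv 2 ℝ X Y).symm.toContinuousLinearMap ∘L
        (ContinuousLinearMap.id ℝ X).prod D) x :=
    ((WithLp.prodContinuousLinearEquiv 2 ℝ X Y).symm.toContinuousLinearMap.hasFDerivAt).comp x
      ((hasFDerivAt_id x).prodMk hy)
  have hf := (hasFDerivAt_of_gradient hb.diff_f z).comp x hzd
  have : HasFDerivAt (Phi p.f p.g) (innerSL ℝ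
      (grad1 p.f z - hess12 p.g z (uStar p.f p.g x))) x := by
    refine hf.congr_fderiv (ContinuousLinearMap.ext fun v => Eq.symm ?_)
    change inner ℝ (grad1 p.f z - hess12 p.g z (uStar p.f p.g x)) v
      = inner ℝ (gradient p.f z) (pt v (D v))
    rw [inner_pt, hD, inner_sub_left, inner_neg_right, sub_eq_add_neg]
    congr 2
    set u := uStar p.f p.g x
    -- Writing `∇₂f` as `H u*` lets the symmetric `H` cancel its inverse in `D`; symmetry of the
    -- full Hessian then produces the block `∇²₁₂g`.
    have hu : (gradient p.f z).snd = hess22 p.g z u :=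
      (hb.hess22_apply_inverse hμ z _).symm
    rw [hu, hess22_symm hb.diff_g hb.diff_grad_g, hb.hess22_apply_inverse hμ]
    have := hess_symm hb.diff_g hb.diff_grad_g z (pt 0 u) (pt v 0)
    rw [inner_pt, inner_pt_left] at this
    simpa [hess12_apply] using this
  exact this

theorem gradient_Phi (x : X) : gradient (Phi p.f p.g) x
    = grad1 p.f (zStar p.g x) - hess12 p.g (zStar p.g x) (uStar p.f p.g x) :=
  (hb.hasGradientAt_Phi hμ x).gradient

theorem differentiable_Phi : Differentiable ℝ (Phi p.f p.g) :=
  fun x => (hb.hasGradientAt_Phi hμ x).differentiableAt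

theorem norm_uStar_le (x : X) : ‖uStar p.f p.g x‖ ≤ c.Lf0 / μ :=
  (hb.norm_inverse_le hμ _ _).trans
    (div_le_div_of_nonneg_right (hb.bound_grad2_f x) hμ.le)

/-- The Newton point of the quadratic system at `z` is close to `u*(x)`. -/
theorem norm_inverse_grad2_sub_uStar_le (z : Pt X Y) (x : X) :
    ‖(hess22 p.g z).inverse (grad2 p.f z) - uStar p.f p.g x‖
      ≤ c.L1 μ / μ * ‖z - zStar p.g x‖ := by
  set u := uStar p.f p.g x
  have hu : grad2 p.f (zStar p.g x) = hess22 p.g (zStar p.g x) u :=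
    (hb.hess22_apply_inverse hμ _ _).symm
  -- Both `∇₂f` and the Hessian are compared between `z` and `z*`. The Hessian difference acts on
  -- `u*`, of norm at most `L_{f,0}/μ`; the two contributions add up to `L₁`.
  have e : (hess22 p.g z).inverse (grad2 p.f z) - u = (hess22 p.g z).inverse
      ((grad2 p.f z - grad2 p.f (zStar p.g x)) - (hess22 p.g z u - hess22 p.g (zStar p.g x) u)) := by
    rw [hu, sub_sub_sub_cancel_right, map_sub, hb.hess22_inverse_apply hμ]
  rw [e]
  refine (hb.norm_inverse_le hμ _ _).trans ?_
  rw [div_mul_eq_mul_div]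
  refine div_le_div_of_nonneg_right ?_ hμ.le
  refine (norm_sub_le _ _).trans ?_
  have h1 := hb.norm_grad2_f_sub_le z (zStar p.g x)
  have h2 := hb.norm_hess22_sub_apply_le z (zStar p.g x) u
  have h3 : c.Lg2 * ‖z - zStar p.g x‖ * ‖u‖ ≤ c.Lg2 * ‖z - zStar p.g x‖ * (c.Lf0 / μ) :=
    mul_le_mul_of_nonneg_left (hb.norm_uStar_le hμ x)
      (mul_nonneg c.Lg2_pos.le (norm_nonneg _))
  have h4 : c.L1 μ * ‖z - zStar p.g x‖
      = c.Lf1 * ‖z - zStar p.g x‖ + c.Lg2 * ‖z - zStar p.g x‖ * (c.Lf0 / μ) := by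
    rw [Constants.L1]; ring
  linarith

omit hμ in
theorem norm_sub_zStar (x : X) (y : Y) : ‖pt x y - zStar p.g x‖ = ‖y - yStar p.g x‖ := by
  rw [zStar, pt_sub, sub_self, norm_pt_zero_left]

/-- The preceding estimate is taken at `z = z*(x)`, where the Newton point is `u*(x)` itself. -/
theorem norm_uStar_sub_le (x x' : X) : ‖uStar p.f p.g x - uStar p.f p.g x'‖
    ≤ c.L1 μ / μ * ((1 + c.Lg1 / μ) * ‖x - x'‖) := by
  refine (hb.norm_inverse_grad2_sub_uStar_le hμ (zStar p.g x) x').trans ?_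
  refine mul_le_mul_of_nonneg_left (hb.norm_zStar_sub_le hμ x x') ?_
  have := c.Lf1_pos
  have := c.Lg2_pos
  have := c.Lf0_pos
  rw [Constants.L1]
  positivity

theorem continuous_uStar : Continuous (uStar p.f p.g) := by
  have : LipschitzWith (Real.toNNReal (c.L1 μ / μ * (1 + c.Lg1 / μ))) (uStar p.f p.g) :=
    LipschitzWith.of_dist_le' fun z z' => by
      simpa [dist_eq_norm, mul_assoc] using hb.norm_uStar_sub_le hμ z z'
  exact this.continuous

/-- The expected update direction `D̄ₓ` approximates the hypergradient. -/
theorem norm_direction_sub_gradient_le (x : X) (z : Pt X Y) (u : Y) :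
    ‖grad1 p.f z - hess12 p.g z u - gradient (Phi p.f p.g) x‖
      ≤ c.L1 μ * ‖z - zStar p.g x‖ + c.Lg1 * ‖u - uStar p.f p.g x‖ := by
  rw [hb.gradient_Phi hμ]
  set us := uStar p.f p.g x
  set zs := zStar p.g x
  -- The Jacobian difference is made to act on the bounded vector `u*` rather than on `u`, for which
  -- no deterministic bound is available.
  have e : grad1 p.f z - hess12 p.g z u - (grad1 p.f zs - hess12 p.g zs us)
      = (grad1 p.f z - grad1 p.f zs) - (hess12 p.g z us - hess12 p.g zs us)
        - hess12 p.g z (u - us) := by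
    rw [map_sub]; abel
  rw [e]
  have h1 := hb.norm_grad1_f_sub_le z zs
  have h2 := hb.norm_hess12_sub_apply_le z zs us
  have h3 : c.Lg2 * ‖z - zs‖ * ‖us‖ ≤ c.Lg2 * ‖z - zs‖ * (c.Lf0 / μ) :=
    mul_le_mul_of_nonneg_left (hb.norm_uStar_le hμ x)
      (mul_nonneg c.Lg2_pos.le (norm_nonneg _))
  have h4 : c.L1 μ * ‖z - zs‖
      = c.Lf1 * ‖z - zs‖ + c.Lg2 * ‖z - zs‖ * (c.Lf0 / μ) := by
    rw [Constants.L1]; ring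
  have h5 := hb.norm_hess12_apply_le z (u - us)
  have h6 := norm_sub_le (grad1 p.f z - grad1 p.f zs) (hess12 p.g z us - hess12 p.g zs us)
  have h7 := norm_sub_le ((grad1 p.f z - grad1 p.f zs) - (hess12 p.g z us - hess12 p.g zs us))
    (hess12 p.g z (u - us))
  linarith

/-- At `(z*(x), u*(x))` the update direction is exactly `∇Φ(x)`, so the bias estimate relative to
`x'` becomes a Lipschitz estimate. -/
theorem norm_gradient_Phi_sub_le (x x' : X) :
    ‖gradient (Phi p.f p.g) x - gradient (Phi p.f p.g) x'‖
      ≤ c.L1 μ * (1 + c.Lg1 / μ) ^ 2 * ‖x - x'‖ := by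
  have h := hb.norm_direction_sub_gradient_le hμ x' (zStar p.g x) (uStar p.f p.g x)
  rw [← hb.gradient_Phi hμ] at h
  have h1 := hb.norm_uStar_sub_le hμ x x'
  have h2 := hb.norm_zStar_sub_le hμ x x'
  have hL : 0 ≤ c.L1 μ := by
    have := c.Lf1_pos
    have := c.Lg2_pos
    have := c.Lf0_pos
    rw [Constants.L1]
    positivity
  have h3 := mul_le_mul_of_nonneg_left h1 c.Lg1_pos.le
  have h4 := mul_le_mul_of_nonneg_left h2 hL
  have e : c.L1 μ * (1 + c.Lg1 / μ) ^ 2 * ‖x - x'‖ = c.L1 μ * ((1 + c.Lg1 / μ) * ‖x - x'‖)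
    + c.Lg1 * (c.L1 μ / μ * ((1 + c.Lg1 / μ) * ‖x - x'‖)) := by ring
  linarith

theorem continuous_gradient_Phi : Continuous (gradient (Phi p.f p.g)) := by
  have : LipschitzWith (Real.toNNReal (c.L1 μ * (1 + c.Lg1 / μ) ^ 2)) (gradient (Phi p.f p.g)) :=
    LipschitzWith.of_dist_le' fun z z' => by
      simpa [dist_eq_norm] using hb.norm_gradient_Phi_sub_le hμ z z'
  exact this.continuous

/-- This uniform bound serves integrability only: that of `‖∇Φ(xᵏ)‖²` and, through the Lipschitz
property of `Φ`, that of `Φ(xᵏ)`. -/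
theorem norm_gradient_Phi_le (x : X) :
    ‖gradient (Phi p.f p.g) x‖ ≤ c.Cf0 + c.Lg1 * (c.Lf0 / μ) := by
  rw [hb.gradient_Phi hμ]
  refine (norm_sub_le _ _).trans (add_le_add (hb.bound_grad1_f _) ?_)
  exact (hb.norm_hess12_apply_le _ _).trans
    (mul_le_mul_of_nonneg_left (hb.norm_uStar_le hμ x) c.Lg1_pos.le)

theorem hasFDerivAt_Phi (x : X) :
    HasFDerivAt (Phi p.f p.g) (innerSL ℝ (gradient (Phi p.f p.g) x)) x :=
  (hb.differentiable_Phi hμ x).hasGradientAt.hasFDerivAt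

/-- The mean value inequality on the segment, applied to `Φ` minus its linearization, gives the
constant `L` instead of `L/2`, which is harmless for the rate. -/
theorem Phi_descent (x x' : X) : Phi p.f p.g x' ≤ Phi p.f p.g x
    + inner ℝ (gradient (Phi p.f p.g) x) (x' - x)
    + c.L1 μ * (1 + c.Lg1 / μ) ^ 2 * ‖x' - x‖ ^ 2 := by
  have hL : 0 ≤ c.L1 μ * (1 + c.Lg1 / μ) ^ 2 := by
    have := c.Lf1_pos
    have := c.Lg2_pos
    have := c.Lf0_pos
    rw [Constants.L1]
    positivity
  have h := Convex.norm_image_sub_le_of_norm_hasFDerivWithin_le'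
    (f := Phi p.f p.g) (f' := fun w => innerSL ℝ (gradient (Phi p.f p.g) w))
    (φ := innerSL ℝ (gradient (Phi p.f p.g) x)) (s := segment ℝ x x') (x := x) (y := x')
    (C := c.L1 μ * (1 + c.Lg1 / μ) ^ 2 * ‖x' - x‖)
    (fun w _ => (hb.hasFDerivAt_Phi hμ w).hasFDerivWithinAt) ?_ (convex_segment x x')
    (left_mem_segment ℝ x x') (right_mem_segment ℝ x x')
  · rw [Real.norm_eq_abs] at h
    have := le_of_abs_le h
    simp only [innerSL_apply_apply] at this
    nlinarith
  · intro w hw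
    rw [← map_sub, innerSL_apply_norm]
    refine (hb.norm_gradient_Phi_sub_le hμ w x).trans (mul_le_mul_of_nonneg_left ?_ hL)
    rw [segment_eq_image'] at hw
    obtain ⟨t, ⟨ht0, ht1⟩, rfl⟩ := hw
    rw [add_sub_cancel_left, norm_smul, Real.norm_of_nonneg ht0]
    exact mul_le_of_le_one_left (norm_nonneg _) ht1

theorem abs_Phi_sub_le (x x' : X) :
    |Phi p.f p.g x' - Phi p.f p.g x| ≤ (c.Cf0 + c.Lg1 * (c.Lf0 / μ)) * ‖x' - x‖ := by
  have := convex_univ.norm_image_sub_le_of_norm_hasFDerivWithin_le (f := Phi p.f p.g)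
    (fun w _ => (hb.hasFDerivAt_Phi hμ w).hasFDerivWithinAt) (fun w _ => by
      rw [innerSL_apply_norm]; exact hb.norm_gradient_Phi_le hμ w) (Set.mem_univ x)
    (Set.mem_univ x')
  rwa [Real.norm_eq_abs] at this

/-- Quadratic convergence of the Newton step for `y`. -/
theorem norm_newton_le (x : X) (y : Y) :
    ‖y - (hess22 p.g (pt x y)).inverse (grad2 p.g (pt x y)) - yStar p.g x‖
      ≤ c.Lg2 / μ * ‖y - yStar p.g x‖ ^ 2 := by
  set ys := yStar p.g x
  set z := pt x y
  -- The first-order expansion of `∇₂g(x, ·)` about `y` is evaluated at `y*`, where `∇₂g` vanishes;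
  -- the inverse Hessian turns its remainder into the error of the Newton step.
  have h := Convex.norm_image_sub_le_of_norm_hasFDerivWithin_le'
    (f := fun y => grad2 p.g (pt x y)) (f' := fun w => hess22 p.g (pt x w))
    (φ := hess22 p.g z) (s := segment ℝ y ys) (x := y) (y := ys)
    (C := c.Lg2 * ‖y - ys‖)
    (fun w _ => (hasFDerivAt_grad2_right hb.diff_grad_g x w).hasFDerivWithinAt) ?_
    (convex_segment y ys) (left_mem_segment ℝ y ys) (right_mem_segment ℝ y ys)
  · have e1 : grad2 p.g (pt x ys) = 0 := hb.grad2_zStar hμ x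
    have e : y - (hess22 p.g z).inverse (grad2 p.g z) - ys = (hess22 p.g z).inverse
        (grad2 p.g (pt x ys) - grad2 p.g z - hess22 p.g z (ys - y)) := by
      rw [e1, map_sub, hb.hess22_inverse_apply hμ, zero_sub, map_neg]
      abel
    rw [e]
    refine (hb.norm_inverse_le hμ _ _).trans ?_
    rw [div_mul_eq_mul_div]
    refine div_le_div_of_nonneg_right (h.trans (le_of_eq ?_)) hμ.le
    rw [norm_sub_rev ys y]
    ring
  · intro w hw
    refine (norm_le_frobenius _).trans ((hb.lip_hess22_g _ _).trans ?_)
    refine mul_le_mul_of_nonneg_left ?_ c.Lg2_pos.le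
    rw [pt_sub, sub_self, norm_pt_zero_left]
    rw [segment_eq_image'] at hw
    obtain ⟨t, ⟨ht0, ht1⟩, rfl⟩ := hw
    rw [add_sub_cancel_left, norm_smul, Real.norm_of_nonneg ht0, norm_sub_rev ys y]
    exact mul_le_of_le_one_left (norm_nonneg _) ht1

/-- The leading coefficient is `1` rather than `κ`, so a relative error `ρ` of the inner loop costs
only `ρ ‖y - y*‖` to first order and `ρ` need not shrink with `κ`. -/
theorem norm_newton_direction_le (x : X) (y : Y) :
    ‖(hess22 p.g (pt x y)).inverse (grad2 p.g (pt x y))‖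
      ≤ ‖y - yStar p.g x‖ + c.Lg2 / μ * ‖y - yStar p.g x‖ ^ 2 := by
  have h := hb.norm_newton_le hμ x y
  set v := (hess22 p.g (pt x y)).inverse (grad2 p.g (pt x y))
  have := norm_sub_le (y - yStar p.g x) (y - v - yStar p.g x)
  have e : y - yStar p.g x - (y - v - yStar p.g x) = v := by abel
  rw [e] at this
  linarith

/-- This version has no quadratic term, so its square is integrable as soon as `‖y - y*‖²` is. -/
theorem norm_newton_direction_le' (x : X) (y : Y) :
    ‖(hess22 p.g (pt x y)).inverse (grad2 p.g (pt x y))‖ ≤ c.Lg1 / μ * ‖y - yStar p.g x‖ := by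
  refine (hb.norm_inverse_le hμ _ _).trans ?_
  rw [div_mul_eq_mul_div]
  refine div_le_div_of_nonneg_right ?_ hμ.le
  have h := (norm_snd_le _).trans (hb.lip_grad_g (pt x y) (zStar p.g x))
  have e : (gradient p.g (pt x y) - gradient p.g (zStar p.g x)).snd
      = grad2 p.g (pt x y) - grad2 p.g (zStar p.g x) := rfl
  rwa [e, hb.grad2_zStar hμ, sub_zero, hb.norm_sub_zStar] at h

end Problem.Base

end Bilevel

/-! ### Decoupling of independent variables -/

section Decoupling

variable {Ω 𝒮 𝒩 : Type*} [MeasurableSpace Ω] [MeasurableSpace 𝒮] [MeasurableSpace 𝒩]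
  {P : Measure Ω} [IsProbabilityMeasure P] {S : Ω → 𝒮} {N : Ω → 𝒩}

/-- Independence makes the joint law a product. By nonnegativity the section integrals are those of
`‖h‖`, and the integrable majorant `B` gives integrability on the product. -/
theorem integrable_of_decouple (hS : Measurable S) (hN : Measurable N) (hind : IndepFun S N P)
    {h : 𝒮 × 𝒩 → ℝ} (hh : Measurable h) (h0 : ∀ q, 0 ≤ h q) {B : 𝒮 → ℝ} (hB : Measurable B)
    (hint : ∀ s, Integrable (fun ω => h (s, N ω)) P) (hle : ∀ s, ∫ ω, h (s, N ω) ∂P ≤ B s)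
    (hBi : Integrable (fun ω => B (S ω)) P) : Integrable (fun ω => h (S ω, N ω)) P := by
  have := Measure.isProbabilityMeasure_map (μ := P) hS.aemeasurable
  have := Measure.isProbabilityMeasure_map (μ := P) hN.aemeasurable
  have hmap := (indepFun_iff_map_prod_eq_prod_map_map hS.aemeasurable hN.aemeasurable).mp hind
  have hSN : Measurable fun ω => (S ω, N ω) := hS.prodMk hN
  have e1 : ∀ s, ∫ n, ‖h (s, n)‖ ∂(P.map N) = ∫ ω, h (s, N ω) ∂P := by
    intro s
    have hm : AEStronglyMeasurable (fun n => ‖h (s, n)‖) (P.map N) :=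
      (hh.norm.comp measurable_prodMk_left).aestronglyMeasurable
    rw [integral_map hN.aemeasurable hm]
    simp only [Real.norm_of_nonneg (h0 _)]
  have key : Integrable h ((P.map S).prod (P.map N)) := by
    rw [integrable_prod_iff hh.aestronglyMeasurable]
    refine ⟨Filter.Eventually.of_forall fun s => ?_, ?_⟩
    · have hm : AEStronglyMeasurable (fun n => h (s, n)) (P.map N) :=
        (hh.comp measurable_prodMk_left).aestronglyMeasurable
      rw [integrable_map_measure hm hN.aemeasurable]
      exact hint s
    · have hBm : Integrable B (P.map S) := by
        rw [integrable_map_measure hB.aestronglyMeasurable hS.aemeasurable]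
        exact hBi
      refine hBm.mono' ?_ (Filter.Eventually.of_forall fun s => ?_)
      · exact (hh.norm.stronglyMeasurable.integral_prod_right).aestronglyMeasurable
      · rw [e1, Real.norm_of_nonneg (integral_nonneg fun ω => h0 _)]
        exact hle s
  rw [← hmap, integrable_map_measure hh.aestronglyMeasurable hSN.aemeasurable] at key
  exact key

/-- No sign is required here, joint integrability being assumed; this is the form needed for `Φ`,
which may be negative. -/
theorem integral_le_of_decouple (hS : Measurable S) (hN : Measurable N) (hind : IndepFun S N P)
    {h : 𝒮 × 𝒩 → ℝ} (hh : Measurable h) {B : 𝒮 → ℝ} (hB : Measurable B)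
    (hi : Integrable (fun ω => h (S ω, N ω)) P) (hle : ∀ s, ∫ ω, h (s, N ω) ∂P ≤ B s)
    (hBi : Integrable (fun ω => B (S ω)) P) : ∫ ω, h (S ω, N ω) ∂P ≤ ∫ ω, B (S ω) ∂P := by
  have := Measure.isProbabilityMeasure_map (μ := P) hS.aemeasurable
  have := Measure.isProbabilityMeasure_map (μ := P) hN.aemeasurable
  have hmap := (indepFun_iff_map_prod_eq_prod_map_map hS.aemeasurable hN.aemeasurable).mp hind
  have hSN : Measurable fun ω => (S ω, N ω) := hS.prodMk hN
  have key : Integrable h ((P.map S).prod (P.map N)) := by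
    rw [← hmap, integrable_map_measure hh.aestronglyMeasurable hSN.aemeasurable]
    exact hi
  have hBm : Integrable B (P.map S) := by
    rw [integrable_map_measure hB.aestronglyMeasurable hS.aemeasurable]
    exact hBi
  calc ∫ ω, h (S ω, N ω) ∂P = ∫ q, h q ∂((P.map S).prod (P.map N)) := by
        rw [← hmap, integral_map hSN.aemeasurable hh.aestronglyMeasurable]
    _ = ∫ s, ∫ n, h (s, n) ∂(P.map N) ∂(P.map S) := integral_prod _ key
    _ ≤ ∫ s, B s ∂(P.map S) := by
        refine integral_mono key.integral_prod_left hBm fun s => ?_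
        simp only
        have hm : AEStronglyMeasurable (fun n => h (s, n)) (P.map N) :=
          (hh.comp measurable_prodMk_left).aestronglyMeasurable
        rw [integral_map hN.aemeasurable hm]
        exact hle s
    _ = ∫ ω, B (S ω) ∂P := integral_map hS.aemeasurable hB.aestronglyMeasurable

end Decoupling

/-! ### Batch averages -/

section Batch

variable {Ω Z V : Type*} [MeasurableSpace Ω] [MeasurableSpace Z] {P : Measure Ω}
  [IsProbabilityMeasure P]
  [NormedAddCommGroup V] [InnerProductSpace ℝ V] [FiniteDimensional ℝ V] [MeasurableSpace V]
  [BorelSpace V]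

theorem integrable_of_norm_sq {φ : Ω → V} (hφ : AEStronglyMeasurable φ P)
    (h : Integrable (fun ω => ‖φ ω‖ ^ 2) P) : Integrable φ P :=
  ((memLp_two_iff_integrable_sq_norm hφ).mpr h).integrable one_le_two

theorem integrable_inner_of_norm_sq {φ ψ : Ω → V} (hφ : AEStronglyMeasurable φ P)
    (hψ : AEStronglyMeasurable ψ P) (h : Integrable (fun ω => ‖φ ω‖ ^ 2) P)
    (h' : Integrable (fun ω => ‖ψ ω‖ ^ 2) P) : Integrable (fun ω => inner ℝ (φ ω) (ψ ω)) P := by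
  refine (h.add h').mono' (hφ.inner hψ) (Filter.Eventually.of_forall fun ω => ?_)
  refine (abs_real_inner_le_norm _ _).trans ?_
  simp only [Pi.add_apply]
  nlinarith [sq_nonneg (‖φ ω‖ - ‖ψ ω‖), sq_nonneg (‖φ ω‖ + ‖ψ ω‖)]

theorem integral_norm_const_sub_sq {n : Ω → V} (c : V) (hn : Integrable n P)
    (h0 : ∫ ω, n ω ∂P = 0) (h2 : Integrable (fun ω => ‖n ω‖ ^ 2) P) :
    Integrable (fun ω => ‖c - n ω‖ ^ 2) P ∧
      ∫ ω, ‖c - n ω‖ ^ 2 ∂P = ‖c‖ ^ 2 + ∫ ω, ‖n ω‖ ^ 2 ∂P := by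
  have e : (fun ω => ‖c - n ω‖ ^ 2)
      = fun ω => ‖c‖ ^ 2 - 2 * inner ℝ c (n ω) + ‖n ω‖ ^ 2 := by
    funext ω; exact norm_sub_sq_real _ _
  have hi : Integrable (fun ω => inner ℝ c (n ω)) P := hn.const_inner c
  have hi2 : Integrable (fun ω => ‖c‖ ^ 2 - 2 * inner ℝ c (n ω)) P :=
    (integrable_const _).sub (hi.const_mul 2)
  rw [e]
  refine ⟨hi2.add h2, ?_⟩
  rw [integral_add hi2 h2, integral_sub (integrable_const _) (hi.const_mul 2),
    integral_const_mul, integral_inner hn, h0]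
  simp

theorem integral_inner_eq_zero_of_indepFun {φ ψ : Ω → V} (hφ : Integrable φ P)
    (hψ : Integrable ψ P)
    (hind : IndepFun φ ψ P) (h0 : ∫ ω, ψ ω ∂P = 0) :
    ∫ ω, inner ℝ (φ ω) (ψ ω) ∂P = 0 := by
  have := hind.integral_bilin hφ hψ (innerSL ℝ)
  rw [h0, map_zero] at this
  exact this

/-- Only cross terms of two summands occur, so pairwise independence together with zero means
suffices. -/
theorem integral_norm_sum_sq_le {X : ℕ → Ω → V} (hX : ∀ i, Measurable (X i))
    (hind : Pairwise fun i j => IndepFun (X i) (X j) P) (h0 : ∀ i, ∫ ω, X i ω ∂P = 0)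
    (h2 : ∀ i, Integrable (fun ω => ‖X i ω‖ ^ 2) P) {s : ℝ}
    (hs : ∀ i, ∫ ω, ‖X i ω‖ ^ 2 ∂P ≤ s) (b : ℕ) :
    Integrable (fun ω => ‖∑ i ∈ Finset.range b, X i ω‖ ^ 2) P ∧
      ∫ ω, ‖∑ i ∈ Finset.range b, X i ω‖ ^ 2 ∂P ≤ b * s := by
  have hin : ∀ i j, Integrable (fun ω => inner ℝ (X i ω) (X j ω)) P := fun i j =>
    integrable_inner_of_norm_sq (hX i).aestronglyMeasurable (hX j).aestronglyMeasurable
      (h2 i) (h2 j)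
  induction b with
  | zero => simp
  | succ b ih =>
    have e : (fun ω => ‖∑ i ∈ Finset.range (b + 1), X i ω‖ ^ 2) = fun ω =>
        (‖∑ i ∈ Finset.range b, X i ω‖ ^ 2
          + 2 * ∑ i ∈ Finset.range b, inner ℝ (X i ω) (X b ω)) + ‖X b ω‖ ^ 2 := by
      funext ω
      rw [Finset.sum_range_succ, norm_add_sq_real, sum_inner]
    have hc : Integrable (fun ω => 2 * ∑ i ∈ Finset.range b, inner ℝ (X i ω) (X b ω)) P :=
      (integrable_finsetSum _ fun i _ => hin i b).const_mul 2
    have hic : Integrable (fun ω => ‖∑ i ∈ Finset.range b, X i ω‖ ^ 2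
          + 2 * ∑ i ∈ Finset.range b, inner ℝ (X i ω) (X b ω)) P := ih.1.add hc
    rw [e]
    refine ⟨hic.add (h2 b), ?_⟩
    rw [integral_add hic (h2 b), integral_add ih.1 hc, integral_const_mul,
      integral_finsetSum _ fun i _ => hin i b]
    have hz : ∑ i ∈ Finset.range b, ∫ ω, inner ℝ (X i ω) (X b ω) ∂P = 0 := by
      refine Finset.sum_eq_zero fun i hi => ?_
      exact integral_inner_eq_zero_of_indepFun
        (integrable_of_norm_sq (hX i).aestronglyMeasurable (h2 i))
        (integrable_of_norm_sq (hX b).aestronglyMeasurable (h2 b))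
        (hind (Finset.mem_range.mp hi).ne) (h0 b)
    rw [hz]
    push_cast
    linarith [ih.2, hs b]

theorem batchMean_apply {U W : Type*} [NormedAddCommGroup U] [NormedSpace ℝ U]
    [NormedAddCommGroup W] [NormedSpace ℝ W] (b : ℕ) (A : ℕ → U →L[ℝ] W) (v : U) :
    batchMean b A v = batchMean b fun i => A i v := by
  simp [batchMean]

theorem batchMean_sub_const {b : ℕ} (hb : 0 < b) (h : ℕ → V) (m : V) :
    batchMean b h - m = (b : ℝ)⁻¹ • ∑ i ∈ Finset.range b, (h i - m) := by
  have : (b : ℝ) ≠ 0 := by positivity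
  rw [Finset.sum_sub_distrib, smul_sub, batchMean]
  simp only [Finset.sum_const, Finset.card_range]
  rw [← Nat.cast_smul_eq_nsmul ℝ, smul_smul, inv_mul_cancel₀ this, one_smul]

theorem measurable_batchMean {α : Type*} [MeasurableSpace α] {h : ℕ → α → V}
    {b : ℕ} (hh : ∀ i < b, Measurable (h i)) : Measurable fun a => batchMean b fun i => h i a :=
  (Finset.measurable_fun_sum _ fun i hi => hh i (Finset.mem_range.mp hi)).const_smul _

/-- The average of a batch of independent samples is unbiased with variance `s / b`. -/
theorem batchMean_variance {ν : Measure Z} {ζ : ℕ → Ω → Z} (hm : ∀ i, Measurable (ζ i))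
    (hlaw : ∀ i, P.map (ζ i) = ν) (hind : Pairwise fun i j => IndepFun (ζ i) (ζ j) P)
    {φ : Z → V} (hφ : Measurable φ) {m : V} (hφi : Integrable φ ν) (hmean : ∫ z, φ z ∂ν = m)
    {s : ℝ} (hvi : Integrable (fun z => ‖φ z - m‖ ^ 2) ν) (hv : ∫ z, ‖φ z - m‖ ^ 2 ∂ν ≤ s)
    {b : ℕ} (hb : 0 < b) :
    Integrable (fun ω => batchMean b (fun i => φ (ζ i ω)) - m) P ∧
    ∫ ω, (batchMean b (fun i => φ (ζ i ω)) - m) ∂P = 0 ∧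
    Integrable (fun ω => ‖batchMean b (fun i => φ (ζ i ω)) - m‖ ^ 2) P ∧
      ∫ ω, ‖batchMean b (fun i => φ (ζ i ω)) - m‖ ^ 2 ∂P ≤ s / b := by
  have : IsProbabilityMeasure ν := by
    rw [← hlaw 0]; exact Measure.isProbabilityMeasure_map (hm 0).aemeasurable
  have hb0 : (0 : ℝ) < b := by positivity
  set X : ℕ → Ω → V := fun i ω => φ (ζ i ω) - m with hX
  have hXm : ∀ i, Measurable (X i) := fun i => (hφ.comp (hm i)).sub_const m
  have hXi : ∀ i, Integrable (X i) P := by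
    intro i
    have h : Integrable (fun z => φ z - m) (P.map (ζ i)) := by
      rw [hlaw]; exact hφi.sub (integrable_const _)
    exact h.comp_measurable (hm i)
  have hX0 : ∀ i, ∫ ω, X i ω ∂P = 0 := by
    intro i
    have h := integral_map (μ := P) (hm i).aemeasurable
      (f := fun z => φ z - m) (by fun_prop)
    rw [hlaw, integral_sub hφi (integrable_const _), hmean] at h
    simpa using h.symm
  have hX2 : ∀ i, Integrable (fun ω => ‖X i ω‖ ^ 2) P := by
    intro i
    have h : Integrable (fun z => ‖φ z - m‖ ^ 2) (P.map (ζ i)) := by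
      rw [hlaw]; exact hvi
    exact h.comp_measurable (hm i)
  have hXs : ∀ i, ∫ ω, ‖X i ω‖ ^ 2 ∂P ≤ s := by
    intro i
    have h := integral_map (μ := P) (hm i).aemeasurable
      (f := fun z => ‖φ z - m‖ ^ 2) (by fun_prop)
    rw [hlaw] at h
    exact h ▸ hv
  have hXind : Pairwise fun i j => IndepFun (X i) (X j) P := fun i j hij =>
    (hind hij).comp (hφ.sub_const m) (hφ.sub_const m)
  have e : ∀ ω, batchMean b (fun i => φ (ζ i ω)) - m
      = (b : ℝ)⁻¹ • ∑ i ∈ Finset.range b, X i ω := fun ω => batchMean_sub_const hb _ _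
  have hsum := integral_norm_sum_sq_le hXm hXind hX0 hX2 hXs b
  have en : ∀ ω, ‖batchMean b (fun i => φ (ζ i ω)) - m‖ ^ 2
      = ((b : ℝ)⁻¹) ^ 2 * ‖∑ i ∈ Finset.range b, X i ω‖ ^ 2 := by
    intro ω
    rw [e, norm_smul, mul_pow, Real.norm_of_nonneg (by positivity)]
  simp only [en]
  simp only [e]
  refine ⟨(integrable_finsetSum _ fun i _ => hXi i).smul _, ?_, hsum.1.const_mul _, ?_⟩
  · rw [integral_smul, integral_finsetSum _ fun i _ => hXi i]
    simp [hX0]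
  · rw [integral_const_mul]
    calc ((b : ℝ)⁻¹) ^ 2 * _ ≤ ((b : ℝ)⁻¹) ^ 2 * (b * s) :=
          mul_le_mul_of_nonneg_left hsum.2 (by positivity)
      _ = s / b := by field_simp

end Batch

/-! ### The inner stochastic gradient loop -/

section Recursion

variable {Y : Type*} [NormedAddCommGroup Y] [InnerProductSpace ℝ Y]

/-- One component of the inner loop. -/
noncomputable def sgdVec (γ : ℝ) (H : ℕ → Y →L[ℝ] Y) (D : Y) : ℕ → Y
  | 0 => 0
  | s + 1 => sgdVec γ H D s - γ • H s (sgdVec γ H D s) + γ • D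

/-- The two components share the sample matrices but do not interact, so each can be analysed as a
separate linear recursion. -/
theorem sgd_v (γ : ℝ) (H : ℕ → Y →L[ℝ] Y) (size : ℕ → ℕ) (Dy Du : Y) (s : ℕ) :
    (sgd γ H size Dy Du s).v = sgdVec γ H Dy s := by
  induction s with
  | zero => rfl
  | succ s ih => simp only [sgd, sgdVec, ih]

theorem sgd_w (γ : ℝ) (H : ℕ → Y →L[ℝ] Y) (size : ℕ → ℕ) (Dy Du : Y) (s : ℕ) :
    (sgd γ H size Dy Du s).w = sgdVec γ H Du s := by
  induction s with
  | zero => rfl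
  | succ s ih => simp only [sgd, sgdVec, ih]

theorem sgd_hvp (γ : ℝ) (H : ℕ → Y →L[ℝ] Y) (size : ℕ → ℕ) (Dy Du : Y) (s : ℕ) :
    (sgd γ H size Dy Du s).hvp = ∑ t ∈ Finset.range s, 2 * size t := by
  induction s with
  | zero => rfl
  | succ s ih => rw [Finset.sum_range_succ, ← ih]; rfl

end Recursion

/-! ### Mean square analysis of the inner recursion. -/

section InnerLoop

variable {Ω Z Y : Type*} [MeasurableSpace Ω] [MeasurableSpace Z] {P : Measure Ω}
  [IsProbabilityMeasure P]
  [NormedAddCommGroup Y] [InnerProductSpace ℝ Y] [FiniteDimensional ℝ Y] [MeasurableSpace Y]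
  [BorelSpace Y]

/-- The sample matrices `A ζ` are unbiased for `H`, with variance at most `σ²` in every
direction. -/
structure MatrixOracle {W : Type*} [NormedAddCommGroup W] [InnerProductSpace ℝ W]
    [MeasurableSpace W] (ν : Measure Z) (A : Z → Y →L[ℝ] W) (H : Y →L[ℝ] W) (σ : ℝ) : Prop where
  meas : Measurable fun q : Z × Y => A q.1 q.2
  int : ∀ v, Integrable (fun z => A z v) ν
  mean : ∀ v, ∫ z, A z v ∂ν = H v
  int_sq : ∀ v, Integrable (fun z => ‖A z v - H v‖ ^ 2) ν
  var : ∀ v, ∫ z, ‖A z v - H v‖ ^ 2 ∂ν ≤ σ ^ 2 * ‖v‖ ^ 2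

/-- A finite Frobenius second moment gives Bochner integrability of the operator itself, which lets
evaluation at a vector pass through the expectation. -/
theorem integrable_clm_of_frobenius {E V : Type*} [NormedAddCommGroup E] [InnerProductSpace ℝ E]
    [FiniteDimensional ℝ E] [NormedAddCommGroup V] [NormedSpace ℝ V] {ν : Measure Z}
    [IsProbabilityMeasure ν] {A : Z → E →L[ℝ] V} {A₀ : E →L[ℝ] V} (hA : StronglyMeasurable A)
    (h : Integrable (fun z => frobenius (A z - A₀) ^ 2) ν) : Integrable A ν := by
  have hms : AEStronglyMeasurable (fun z => A z - A₀) ν :=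
    (hA.sub stronglyMeasurable_const).aestronglyMeasurable
  have h2 : Integrable (fun z => ‖A z - A₀‖ ^ 2) ν := by
    refine h.mono' (hms.norm.pow 2) (Filter.Eventually.of_forall fun ζ => ?_)
    rw [Real.norm_of_nonneg (sq_nonneg _)]
    exact pow_le_pow_left₀ (norm_nonneg _) (norm_le_frobenius _) 2
  have h3 := ((memLp_two_iff_integrable_sq_norm hms).mpr h2).integrable one_le_two
  have h4 : Integrable (fun z => A z - A₀ + A₀) ν := h3.add (integrable_const A₀)
  simpa only [sub_add_cancel] using h4

/-- In the applications `J` is the inclusion of the second factor and `L` a coordinate projection.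
Neither increases norms, so each block inherits the variance of the full Hessian. -/
theorem MatrixOracle.of_frobenius {E V W : Type*} [NormedAddCommGroup E] [InnerProductSpace ℝ E]
    [FiniteDimensional ℝ E] [NormedAddCommGroup V] [NormedSpace ℝ V] [FiniteDimensional ℝ V]
    [NormedAddCommGroup W] [InnerProductSpace ℝ W] [FiniteDimensional ℝ W] [MeasurableSpace W]
    [BorelSpace W] {ν : Measure Z}
    [IsProbabilityMeasure ν] {A : Z → E →L[ℝ] V} {A₀ : E →L[ℝ] V} {σ : ℝ}
    (hA : StronglyMeasurable A) (hmean : ∫ z, A z ∂ν = A₀)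
    (h : Integrable (fun z => frobenius (A z - A₀) ^ 2) ν)
    (hvar : ∫ z, frobenius (A z - A₀) ^ 2 ∂ν ≤ σ ^ 2)
    (L : V →L[ℝ] W) (hL : ∀ v, ‖L v‖ ≤ ‖v‖) (J : Y →L[ℝ] E) (hJ : ∀ v, ‖J v‖ = ‖v‖)
    (hm : Measurable fun q : Z × Y => L (A q.1 (J q.2))) :
    MatrixOracle ν (fun z => L ∘L A z ∘L J) (L ∘L A₀ ∘L J) σ := by
  have hbd : ∀ v z, ‖L (A z (J v)) - L (A₀ (J v))‖ ^ 2
      ≤ frobenius (A z - A₀) ^ 2 * ‖v‖ ^ 2 := by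
    intro v z
    rw [← mul_pow, ← map_sub, ← _root_.sub_apply]
    refine pow_le_pow_left₀ (norm_nonneg _) ?_ 2
    refine (hL _).trans ((norm_apply_le_frobenius _ _).trans (le_of_eq ?_))
    rw [hJ]
  have hi : ∀ v, Integrable (fun z => ‖L (A z (J v)) - L (A₀ (J v))‖ ^ 2) ν := by
    intro v
    refine (h.mul_const (‖v‖ ^ 2)).mono' ?_ (Filter.Eventually.of_forall fun ζ => ?_)
    · have : Measurable fun z => L (A z (J v)) := hm.comp (measurable_id.prodMk measurable_const)
      exact ((this.sub_const _).norm.pow_const 2).aestronglyMeasurable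
    · rw [Real.norm_of_nonneg (sq_nonneg _)]
      exact hbd v ζ
  have hH := integrable_clm_of_frobenius hA h
  refine ⟨hm, fun v => ?_, fun v => ?_, hi, fun v => ?_⟩
  · exact L.integrable_comp (hH.apply_continuousLinearMap (J v))
  · have h1 := L.integral_comp_comm (hH.apply_continuousLinearMap (J v))
    rw [← ContinuousLinearMap.integral_apply hH, hmean] at h1
    exact h1
  · refine (integral_mono (hi v) (h.mul_const (‖v‖ ^ 2)) (hbd v)).trans ?_
    rw [integral_mul_const]
    exact mul_le_mul_of_nonneg_right hvar (sq_nonneg _)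

/-- This is convexity of the square, with weights `1 - γμ` and `γμ` on `a` and `m/μ`. -/
theorem sgd_contract {γ μ a m : ℝ} (hγ : 0 ≤ γ) (hμ : 0 < μ) (hq : γ * μ ≤ 1) :
    ((1 - γ * μ) * a + γ * m) ^ 2 ≤ (1 - γ * μ) * a ^ 2 + γ / μ * m ^ 2 := by
  have h : 0 ≤ (1 - γ * μ) * (γ / μ) * (μ * a - m) ^ 2 := by
    have : 0 ≤ 1 - γ * μ := by linarith
    positivity
  have e : (1 - γ * μ) * a ^ 2 + γ / μ * m ^ 2 - ((1 - γ * μ) * a + γ * m) ^ 2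
      = (1 - γ * μ) * (γ / μ) * (μ * a - m) ^ 2 := by
    field_simp
    ring
  linarith

/-- One step of the inner loop, for a given state. -/
theorem sgd_step_fixed {ν : Measure Z} {A : Z → Y →L[ℝ] Y} {H : Y →L[ℝ] Y} {σ γ μ τ : ℝ}
    (hA : MatrixOracle ν A H σ) (hγ : 0 < γ) (hμ : 0 < μ) (hq : γ * μ ≤ 1)
    (hc : ∀ v, ‖v - γ • H v‖ ≤ (1 - γ * μ) * ‖v‖)
    {ζ : ℕ → Ω → Z} (hm : ∀ i, Measurable (ζ i)) (hlaw : ∀ i, P.map (ζ i) = ν)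
    (hind : Pairwise fun i j => IndepFun (ζ i) (ζ j) P) {b : ℕ} (hb : 0 < b)
    (hbτ : 2 * γ * σ ^ 2 ≤ τ * μ * b) (hτ : τ ≤ 1 / 2) (v d w : Y) :
    Integrable (fun ω => ‖v - γ • batchMean b (fun i => A (ζ i ω)) v + γ • d - w‖ ^ 2) P ∧
    ∫ ω, ‖v - γ • batchMean b (fun i => A (ζ i ω)) v + γ • d - w‖ ^ 2 ∂P
      ≤ (1 - γ * μ / 2) * ‖v - w‖ ^ 2 + γ / μ * ‖d - H w‖ ^ 2 + γ * μ * τ * ‖w‖ ^ 2 := by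
  obtain ⟨h1, h2, h3, h4⟩ := batchMean_variance hm hlaw hind (φ := fun z => A z v)
    (hA.meas.comp (measurable_id.prodMk measurable_const)) (hA.int v) (hA.mean v) (hA.int_sq v)
    (hA.var v) hb
  -- This is the mean of the new error. The sampled `d` need not equal `H w`, so `d - H w` remains
  -- as a forcing term.
  set c := (v - w) - γ • H (v - w) + γ • (d - H w)
  have e : ∀ ω, v - γ • batchMean b (fun i => A (ζ i ω)) v + γ • d - w
      = c - γ • (batchMean b (fun i => A (ζ i ω) v) - H v) := by
    intro ω
    rw [batchMean_apply]
    simp only [c, map_sub, smul_sub]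
    abel
  simp only [e]
  have hn2 : ∀ ω, ‖γ • (batchMean b (fun i => A (ζ i ω) v) - H v)‖ ^ 2
      = γ ^ 2 * ‖batchMean b (fun i => A (ζ i ω) v) - H v‖ ^ 2 := by
    intro ω; rw [norm_smul, mul_pow, Real.norm_of_nonneg hγ.le]
  have key := integral_norm_const_sub_sq (P := P) c (h1.smul γ)
    (by simp only [Pi.smul_apply]; rw [integral_smul, h2, smul_zero])
    (by simp only [Pi.smul_apply, hn2]; exact h3.const_mul _)
  simp only [Pi.smul_apply, hn2] at key
  refine ⟨key.1, ?_⟩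
  rw [key.2, integral_const_mul]
  have hcn : ‖c‖ ≤ (1 - γ * μ) * ‖v - w‖ + γ * ‖d - H w‖ := by
    refine (norm_add_le _ _).trans (add_le_add (hc _) ?_)
    rw [norm_smul, Real.norm_of_nonneg hγ.le]
  have hcs : ‖c‖ ^ 2 ≤ (1 - γ * μ) * ‖v - w‖ ^ 2 + γ / μ * ‖d - H w‖ ^ 2 :=
    (pow_le_pow_left₀ (norm_nonneg _) hcn 2).trans (sgd_contract hγ.le hμ hq)
  have hb0 : (0 : ℝ) < b := by positivity
  have hv2 : ‖v‖ ^ 2 ≤ 2 * ‖v - w‖ ^ 2 + 2 * ‖w‖ ^ 2 := by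
    have h := norm_add_le (v - w) w
    rw [sub_add_cancel] at h
    have := norm_nonneg v
    nlinarith [sq_nonneg (‖v - w‖ - ‖w‖)]
  have hγσ : γ ^ 2 * (σ ^ 2 / b) ≤ γ * μ * τ / 2 := by
    have : γ ^ 2 * (σ ^ 2 / b) = γ / (2 * b) * (2 * γ * σ ^ 2) := by field_simp
    rw [this]
    refine (mul_le_mul_of_nonneg_left hbτ (by positivity)).trans (le_of_eq ?_)
    field_simp
  have hγσ0 : 0 ≤ γ ^ 2 * (σ ^ 2 / b) := by positivity
  have h5 : γ ^ 2 * ∫ ω, ‖batchMean b (fun i => A (ζ i ω) v) - H v‖ ^ 2 ∂P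
      ≤ γ * μ * τ / 2 * (2 * ‖v - w‖ ^ 2 + 2 * ‖w‖ ^ 2) := by
    calc _ ≤ γ ^ 2 * (σ ^ 2 * ‖v‖ ^ 2 / b) := mul_le_mul_of_nonneg_left h4 (sq_nonneg γ)
      _ = γ ^ 2 * (σ ^ 2 / b) * ‖v‖ ^ 2 := by ring
      _ ≤ γ * μ * τ / 2 * ‖v‖ ^ 2 := mul_le_mul_of_nonneg_right hγσ (sq_nonneg _)
      _ ≤ _ := mul_le_mul_of_nonneg_left hv2 (hγσ0.trans hγσ)
  -- The matrix noise grows with `‖v‖²`. Since `τ ≤ 1/2`, its part proportional to `‖v - w‖²` uses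
  -- at most half of the contraction, turning `1 - γμ` into `1 - γμ/2`.
  have h6 : γ * μ * τ * ‖v - w‖ ^ 2 ≤ γ * μ / 2 * ‖v - w‖ ^ 2 := by
    refine mul_le_mul_of_nonneg_right ?_ (sq_nonneg _)
    have : 0 < γ * μ := by positivity
    nlinarith
  linarith

/-- Mean square error of the inner loop against the solution `w` of `H w = E D`. -/
theorem sgdVec_error {ν : Measure Z} {A : Z → Y →L[ℝ] Y} {H : Y →L[ℝ] Y} {σ γ μ τ : ℝ}
    (hA : MatrixOracle ν A H σ) (hγ : 0 < γ) (hμ : 0 < μ) (hq : γ * μ ≤ 1)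
    (hc : ∀ v, ‖v - γ • H v‖ ≤ (1 - γ * μ) * ‖v‖)
    {ζ : ℕ → ℕ → Ω → Z} (hm : ∀ t i, Measurable (ζ t i)) (hlaw : ∀ t i, P.map (ζ t i) = ν)
    (hind : ∀ t, Pairwise fun i j => IndepFun (ζ t i) (ζ t j) P) {b : ℕ → ℕ} {T : ℕ}
    (hb : ∀ t < T, 0 < b t) (hbτ : ∀ t < T, 2 * γ * σ ^ 2 ≤ τ * μ * b t) (hτ0 : 0 ≤ τ)
    (hτ : τ ≤ 1 / 2)
    {D : Ω → Y} (hD : Measurable D)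
    (hv : ∀ t, Measurable fun ω => sgdVec γ (fun t => batchMean (b t) fun i => A (ζ t i ω)) (D ω) t)
    (hindV : ∀ t, IndepFun
      (fun ω => (sgdVec γ (fun t => batchMean (b t) fun i => A (ζ t i ω)) (D ω) t, D ω))
      (fun ω i => ζ t i ω) P)
    (w : Y) {s : ℝ} (hDi : Integrable (fun ω => ‖D ω - H w‖ ^ 2) P)
    (hDs : ∫ ω, ‖D ω - H w‖ ^ 2 ∂P ≤ s) :
    ∀ t ≤ T, Integrable (fun ω =>
      ‖sgdVec γ (fun t => batchMean (b t) fun i => A (ζ t i ω)) (D ω) t - w‖ ^ 2) P ∧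
    ∫ ω, ‖sgdVec γ (fun t => batchMean (b t) fun i => A (ζ t i ω)) (D ω) t - w‖ ^ 2 ∂P
      ≤ ((1 - γ * μ / 2) ^ t + 2 * τ) * ‖w‖ ^ 2 + 2 * s / μ ^ 2 := by
  have hs : 0 ≤ s := (integral_nonneg fun ω => sq_nonneg _).trans hDs
  intro t
  induction t with
  | zero =>
    intro _
    simp only [sgdVec, zero_sub, norm_neg, pow_zero]
    refine ⟨integrable_const _, ?_⟩
    simp only [integral_const, probReal_univ, smul_eq_mul, one_mul]
    have : 0 ≤ 2 * τ * ‖w‖ ^ 2 := by positivity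
    have : 0 ≤ 2 * s / μ ^ 2 := by positivity
    linarith
  | succ t ih =>
    intro ht
    obtain ⟨ih1, ih2⟩ := ih (by omega)
    set V : Ω → Y := fun ω => sgdVec γ (fun t => batchMean (b t) fun i => A (ζ t i ω)) (D ω) t
    -- The direction `D` belongs to the state next to `V`: the same random vector is reused in every
    -- inner step, so `V` and `D` are dependent and are conditioned on together.
    let h : (Y × Y) × (ℕ → Z) → ℝ := fun q =>
      ‖q.1.1 - γ • batchMean (b t) (fun i => A (q.2 i)) q.1.1 + γ • q.1.2 - w‖ ^ 2
    let B : Y × Y → ℝ := fun q =>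
      (1 - γ * μ / 2) * ‖q.1 - w‖ ^ 2 + γ / μ * ‖q.2 - H w‖ ^ 2 + γ * μ * τ * ‖w‖ ^ 2
    have hh : Measurable h := by
      simp only [h, batchMean_apply]
      have : ∀ i, Measurable fun q : (Y × Y) × (ℕ → Z) => A (q.2 i) q.1.1 := by
        intro i
        have hq : Measurable fun q : (Y × Y) × (ℕ → Z) => (q.2 i, q.1.1) := by fun_prop
        exact hA.meas.comp hq
      have hs : Measurable fun q : (Y × Y) × (ℕ → Z) =>
          batchMean (b t) fun i => A (q.2 i) q.1.1 := measurable_batchMean fun i _ => this i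
      have hv : Measurable fun q : (Y × Y) × (ℕ → Z) => q.1.1 := by fun_prop
      have hd : Measurable fun q : (Y × Y) × (ℕ → Z) => q.1.2 := by fun_prop
      exact ((((hv.sub (hs.const_smul γ)).add (hd.const_smul γ)).sub_const w).norm.pow_const 2)
    have hB : Measurable B := by fun_prop
    have hfix : ∀ q : Y × Y, Integrable (fun ω => h (q, fun i => ζ t i ω)) P ∧
        ∫ ω, h (q, fun i => ζ t i ω) ∂P ≤ B q := fun q =>
      sgd_step_fixed hA hγ hμ hq hc (hm t) (hlaw t) (hind t) (hb t (by omega))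
        (hbτ t (by omega)) hτ q.1 q.2 w
    have hBi : Integrable (fun ω => B (V ω, D ω)) P :=
      ((ih1.const_mul _).add (hDi.const_mul _)).add (integrable_const _)
    have hS : Measurable fun ω => (V ω, D ω) := (hv t).prodMk hD
    have hN : Measurable fun ω i => ζ t i ω := measurable_pi_lambda _ fun i => hm t i
    have hi := integrable_of_decouple hS hN (hindV t) hh (fun q => sq_nonneg _) hB
      (fun q => (hfix q).1) (fun q => (hfix q).2) hBi
    have hle := integral_le_of_decouple hS hN (hindV t) hh hB hi (fun q => (hfix q).2) hBi
    refine ⟨hi, hle.trans ?_⟩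
    have e : ∫ ω, B (V ω, D ω) ∂P = (1 - γ * μ / 2) * ∫ ω, ‖V ω - w‖ ^ 2 ∂P
        + γ / μ * ∫ ω, ‖D ω - H w‖ ^ 2 ∂P + γ * μ * τ * ‖w‖ ^ 2 := by
      have hi2 : Integrable (fun ω => (1 - γ * μ / 2) * ‖V ω - w‖ ^ 2
          + γ / μ * ‖D ω - H w‖ ^ 2) P := (ih1.const_mul _).add (hDi.const_mul _)
      simp only [B]
      rw [integral_add hi2 (integrable_const _),
        integral_add (ih1.const_mul _) (hDi.const_mul _), integral_const_mul, integral_const_mul,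
        integral_const, probReal_univ, one_smul]
    rw [e]
    have h1 : (1 - γ * μ / 2) * ∫ ω, ‖V ω - w‖ ^ 2 ∂P ≤ (1 - γ * μ / 2) *
        (((1 - γ * μ / 2) ^ t + 2 * τ) * ‖w‖ ^ 2 + 2 * s / μ ^ 2) :=
      mul_le_mul_of_nonneg_left ih2 (by linarith)
    have h2 : γ / μ * ∫ ω, ‖D ω - H w‖ ^ 2 ∂P ≤ γ / μ * s :=
      mul_le_mul_of_nonneg_left hDs (by positivity)
    -- The constants `2τ` and `2s/μ²` are the fixed points of the recursion: the forcings `γμτ` and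
    -- `γs/μ` divided by the contraction `γμ/2`.
    have e2 : (1 - γ * μ / 2) * (((1 - γ * μ / 2) ^ t + 2 * τ) * ‖w‖ ^ 2 + 2 * s / μ ^ 2)
        + γ / μ * s + γ * μ * τ * ‖w‖ ^ 2
        = ((1 - γ * μ / 2) ^ (t + 1) + 2 * τ) * ‖w‖ ^ 2 + 2 * s / μ ^ 2 := by
      field_simp
      ring
    linarith

end InnerLoop

/-! ### Measurability of gradients and Hessians of the samples -/

section JointMeasurability

variable {E V Ξ : Type*} [NormedAddCommGroup E] [InnerProductSpace ℝ E] [FiniteDimensional ℝ E]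
  [MeasurableSpace E] [BorelSpace E]
  [NormedAddCommGroup V] [NormedSpace ℝ V] [FiniteDimensional ℝ V]
  [MeasurableSpace V] [BorelSpace V] [MeasurableSpace Ξ]

/-- The derivative in a direction is the pointwise limit of difference quotients with step `1/n`,
each jointly measurable in point, parameter and direction. -/
theorem measurable_fderiv_apply_param {K : E → Ξ → V} (hK : Measurable (Function.uncurry K))
    (hd : ∀ ξ, Differentiable ℝ fun z => K z ξ) :
    Measurable fun q : (E × Ξ) × E => fderiv ℝ (fun z => K z q.1.2) q.1.1 q.2 := by
  have := FiniteDimensional.proper ℝ V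
  have : SecondCountableTopology V := inferInstance
  refine measurable_of_tendsto_metrizable (f := fun (n : ℕ) (q : (E × Ξ) × E) =>
    (n : ℝ) • (K (q.1.1 + (n : ℝ)⁻¹ • q.2) q.1.2 - K q.1.1 q.1.2)) ?_ ?_
  · intro n
    have h1 : Measurable fun q : (E × Ξ) × E => K (q.1.1 + (n : ℝ)⁻¹ • q.2) q.1.2 := by
      have : Measurable fun q : (E × Ξ) × E => (q.1.1 + (n : ℝ)⁻¹ • q.2, q.1.2) := by fun_prop
      exact hK.comp this
    have h2 : Measurable fun q : (E × Ξ) × E => K q.1.1 q.1.2 := hK.comp measurable_fst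
    exact (h1.sub h2).const_smul _
  · rw [tendsto_pi_nhds]
    intro q
    refine ((hd q.1.2 q.1.1).hasFDerivAt).lim q.2 ?_
    simpa using tendsto_natCast_atTop_atTop

theorem measurable_gradient_param {F : E → Ξ → ℝ} (hF : Measurable (Function.uncurry F))
    (hd : ∀ ξ, Differentiable ℝ fun z => F z ξ) :
    Measurable fun q : E × Ξ => gradient (fun z => F z q.2) q.1 := by
  have hb := stdOrthonormalBasis ℝ E
  have e : (fun q : E × Ξ => gradient (fun z => F z q.2) q.1)
      = fun q => ∑ i, (fderiv ℝ (fun z => F z q.2) q.1 (stdOrthonormalBasis ℝ E i)) •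
        stdOrthonormalBasis ℝ E i := by
    funext q
    rw [← (stdOrthonormalBasis ℝ E).sum_repr' (gradient (fun z => F z q.2) q.1)]
    refine Finset.sum_congr rfl fun i _ => ?_
    congr 1
    rw [real_inner_comm, gradient, InnerProductSpace.toDual_symm_apply]
  rw [e]
  refine Finset.measurable_fun_sum _ fun i _ => Measurable.smul_const ?_ _
  have := measurable_fderiv_apply_param hF hd
  exact this.comp (measurable_id.prodMk measurable_const)

/-- An operator is a finite sum of rank-one operators determined continuously by its values on an
orthonormal basis. -/
theorem stronglyMeasurable_clm {A : Ξ → E →L[ℝ] V} (hA : ∀ v, Measurable fun ξ => A ξ v) :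
    StronglyMeasurable A := by
  have := FiniteDimensional.proper ℝ V
  have : SecondCountableTopology V := inferInstance
  have e : A = fun ξ => ∑ i, (innerSL ℝ (stdOrthonormalBasis ℝ E i)).smulRight
      (A ξ (stdOrthonormalBasis ℝ E i)) := by
    funext ξ
    ext v
    conv_lhs => rw [← (stdOrthonormalBasis ℝ E).sum_repr' v]
    simp
  rw [e]
  refine Finset.stronglyMeasurable_fun_sum _ fun i _ => ?_
  have hc : Continuous fun w : V =>
      (innerSL ℝ (stdOrthonormalBasis ℝ E i)).smulRight w :=
    (ContinuousLinearMap.smulRightL ℝ E V (innerSL ℝ (stdOrthonormalBasis ℝ E i))).continuous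
  exact hc.comp_stronglyMeasurable (hA _).stronglyMeasurable

end JointMeasurability

/-! ### The stochastic oracles at a fixed point -/

section Oracles

variable {X Y : Type*} [NormedAddCommGroup X] [InnerProductSpace ℝ X] [FiniteDimensional ℝ X]
  [NormedAddCommGroup Y] [InnerProductSpace ℝ Y] [FiniteDimensional ℝ Y]
  [MeasurableSpace X] [MeasurableSpace Y] [BorelSpace X] [BorelSpace Y]
  {Ξ Z : Type*} [MeasurableSpace Ξ] [MeasurableSpace Z]
  {p : Problem X Y Ξ Z} {c : Constants}

theorem continuous_fst_pt : Continuous fun z : Pt X Y => z.fst := (WithLp.fstL 2 ℝ X Y).continuous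

theorem continuous_snd_pt : Continuous fun z : Pt X Y => z.snd := (WithLp.sndL 2 ℝ X Y).continuous

namespace Problem.Oracles

variable (ho : p.Oracles)

include ho

theorem measurable_gradient_F :
    Measurable fun q : Pt X Y × Ξ => gradient (fun z => p.F z q.2) q.1 :=
  measurable_gradient_param ho.meas_F ho.diff_F

theorem measurable_gradient_G :
    Measurable fun q : Pt X Y × Z => gradient (fun z => p.G z q.2) q.1 :=
  measurable_gradient_param ho.meas_G ho.diff_G

theorem measurable_hess_G :
    Measurable fun q : (Pt X Y × Z) × Pt X Y => hess (fun z => p.G z q.1.2) q.1.1 q.2 :=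
  measurable_fderiv_apply_param (K := fun z ζ => gradient (fun z => p.G z ζ) z)
    ho.measurable_gradient_G ho.diff_grad_G

theorem measurable_hess_G_inY : Measurable fun q : (Pt X Y × Z) × Y =>
    hess (fun z => p.G z q.1.2) q.1.1 (pt 0 q.2) := by
  have : Measurable fun q : (Pt X Y × Z) × Y => (q.1, (pt 0 q.2 : Pt X Y)) := by
    refine measurable_fst.prodMk ?_
    exact (inY X Y).continuous.measurable.comp measurable_snd
  exact ho.measurable_hess_G.comp this

theorem measurable_hess22_G :
    Measurable fun q : (Pt X Y × Z) × Y => hess22 (fun z => p.G z q.1.2) q.1.1 q.2 :=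
  continuous_snd_pt.measurable.comp ho.measurable_hess_G_inY

theorem measurable_hess12_G :
    Measurable fun q : (Pt X Y × Z) × Y => hess12 (fun z => p.G z q.1.2) q.1.1 q.2 :=
  continuous_fst_pt.measurable.comp ho.measurable_hess_G_inY

theorem measurable_hess22_G_comp {α : Type*} {mα : MeasurableSpace α} {z : α → Pt X Y}
    {ζ : α → Z} {u : α → Y} (hz : Measurable z) (hζ : Measurable ζ) (hu : Measurable u) :
    Measurable fun a => hess22 (fun z => p.G z (ζ a)) (z a) (u a) := by
  have h : Measurable fun a => ((z a, ζ a), u a) := (hz.prodMk hζ).prodMk hu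
  have h2 := ho.measurable_hess22_G.comp h
  simp only [Function.comp_def] at h2
  exact h2

theorem measurable_hess12_G_comp {α : Type*} {mα : MeasurableSpace α} {z : α → Pt X Y}
    {ζ : α → Z} {u : α → Y} (hz : Measurable z) (hζ : Measurable ζ) (hu : Measurable u) :
    Measurable fun a => hess12 (fun z => p.G z (ζ a)) (z a) (u a) := by
  have h : Measurable fun a => ((z a, ζ a), u a) := (hz.prodMk hζ).prodMk hu
  have h2 := ho.measurable_hess12_G.comp h
  simp only [Function.comp_def] at h2
  exact h2

variable (hv : p.BoundedVariance c)

include hv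

theorem integrable_gradient_F (z : Pt X Y) :
    Integrable (fun ξ => gradient (fun z' => p.F z' ξ) z) p.lawξ := by
  have := p.prob_ξ
  have hm : Measurable fun ξ => gradient (fun z' => p.F z' ξ) z :=
    ho.measurable_gradient_F.comp (measurable_const.prodMk measurable_id)
  have h := integrable_of_norm_sq (P := p.lawξ) (hm.sub_const _).aestronglyMeasurable
    (hv.int_grad_F z)
  have h4 : Integrable (fun ξ => gradient (fun z' => p.F z' ξ) z - gradient p.f z
      + gradient p.f z) p.lawξ := h.add (integrable_const (gradient p.f z))
  simpa only [sub_add_cancel] using h4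

theorem integrable_gradient_G (z : Pt X Y) :
    Integrable (fun ζ => gradient (fun z' => p.G z' ζ) z) p.lawζ := by
  have := p.prob_ζ
  have hm : Measurable fun ζ => gradient (fun z' => p.G z' ζ) z :=
    ho.measurable_gradient_G.comp (measurable_const.prodMk measurable_id)
  have h := integrable_of_norm_sq (P := p.lawζ) (hm.sub_const _).aestronglyMeasurable
    (hv.int_grad_G z)
  have h4 : Integrable (fun ζ => gradient (fun z' => p.G z' ζ) z - gradient p.g z
      + gradient p.g z) p.lawζ := h.add (integrable_const (gradient p.g z))
  simpa only [sub_add_cancel] using h4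

omit hv in
theorem stronglyMeasurable_hess_G (z : Pt X Y) :
    StronglyMeasurable fun ζ => hess (fun z' => p.G z' ζ) z := by
  refine stronglyMeasurable_clm fun v => ?_
  have : Measurable fun ζ : Z => (((z, ζ), v) : (Pt X Y × Z) × Pt X Y) := by fun_prop
  exact ho.measurable_hess_G.comp this

theorem oracle_hess22 (z : Pt X Y) : MatrixOracle p.lawζ
    (fun ζ => hess22 (fun z' => p.G z' ζ) z) (hess22 p.g z) c.σg2 := by
  have := p.prob_ζ
  refine MatrixOracle.of_frobenius (ho.stronglyMeasurable_hess_G z) (ho.unbiased_hess_G z)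
    (hv.int_hess_G z) (hv.var_hess_G z) (WithLp.sndL 2 ℝ X Y) norm_snd_le (inY X Y)
    norm_pt_zero_left ?_
  have : Measurable fun q : Z × Y => (((z, q.1), q.2) : (Pt X Y × Z) × Y) := by fun_prop
  exact ho.measurable_hess22_G.comp this

theorem oracle_hess12 (z : Pt X Y) : MatrixOracle p.lawζ
    (fun ζ => hess12 (fun z' => p.G z' ζ) z) (hess12 p.g z) c.σg2 := by
  have := p.prob_ζ
  refine MatrixOracle.of_frobenius (ho.stronglyMeasurable_hess_G z) (ho.unbiased_hess_G z)
    (hv.int_hess_G z) (hv.var_hess_G z) (WithLp.fstL 2 ℝ X Y) norm_fst_le (inY X Y)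
    norm_pt_zero_left ?_
  have : Measurable fun q : Z × Y => (((z, q.1), q.2) : (Pt X Y × Z) × Y) := by fun_prop
  exact ho.measurable_hess12_G.comp this

end Problem.Oracles

end Oracles

/-! ### The update directions -/

section Directions

variable {X Y : Type*} [NormedAddCommGroup X] [InnerProductSpace ℝ X] [FiniteDimensional ℝ X]
  [NormedAddCommGroup Y] [InnerProductSpace ℝ Y] [FiniteDimensional ℝ Y]
  [MeasurableSpace X] [MeasurableSpace Y]
  {Ξ Z : Type*} [MeasurableSpace Ξ] [MeasurableSpace Z]
  (p : Problem X Y Ξ Z) (B : BatchSizes) (k : ℕ)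

/-- The direction `D_y`. -/
def dirY (ζ : GBatch → ℕ → Z) (z : Pt X Y) : Y :=
  batchMean (B.b2 k) fun i => grad2 (fun z' => p.G z' (ζ (.b2 k) i)) z

/-- The batch gradient of `F`. -/
def batchGradF (ξ : ℕ → Ξ) (z : Pt X Y) : Pt X Y :=
  batchMean (B.b3 k) fun i => gradient (fun z' => p.F z' (ξ i)) z

/-- The batch Hessian-vector product. -/
def batchHess (ζ : GBatch → ℕ → Z) (z : Pt X Y) (u : Y) : Y :=
  batchMean (B.b1 k) fun i => hess22 (fun z' => p.G z' (ζ (.b1 k) i)) z u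

/-- The batch Jacobian-vector product. -/
def batchJac (ζ : GBatch → ℕ → Z) (z : Pt X Y) (u : Y) : X :=
  batchMean (B.b4 k) fun i => hess12 (fun z' => p.G z' (ζ (.b4 k) i)) z u

/-- The direction `D_u`. -/
def dirU (ξ : ℕ → Ξ) (ζ : GBatch → ℕ → Z) (z : Pt X Y) (u : Y) : Y :=
  batchHess p B k ζ z u - (batchGradF p B k ξ z).snd

/-- The direction `D_x`. -/
def dirX (ξ : ℕ → Ξ) (ζ : GBatch → ℕ → Z) (z : Pt X Y) (u : Y) : X :=
  (batchGradF p B k ξ z).fst - batchJac p B k ζ z u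

/-- The correction computed by the inner loop from a direction `D`. -/
def innerLoop (γ : ℝ) (ζ : GBatch → ℕ → Z) (z : Pt X Y) (D : Y) (t : ℕ) : Y :=
  sgdVec γ (fun s => batchMean (B.b1t k s) fun i =>
    hess22 (fun z' => p.G z' (ζ (.b1t k s) i)) z) D t

theorem step_x (α γ : ℝ) (T : ℕ) (ξ : ℕ → Ξ) (ζ : GBatch → ℕ → Z) (S : State X Y) :
    (step p B α γ T k ξ ζ S).x = S.x - α • dirX p B k ξ ζ (pt S.x S.y) S.u := rfl

theorem step_y (α γ : ℝ) (T : ℕ) (ξ : ℕ → Ξ) (ζ : GBatch → ℕ → Z) (S : State X Y) :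
    (step p B α γ T k ξ ζ S).y
      = S.y - innerLoop p B k γ ζ (pt S.x S.y) (dirY p B k ζ (pt S.x S.y)) (T + 1) := by
  simp only [step, sgd_v]
  rfl

theorem step_u (α γ : ℝ) (T : ℕ) (ξ : ℕ → Ξ) (ζ : GBatch → ℕ → Z) (S : State X Y) :
    (step p B α γ T k ξ ζ S).u
      = S.u - innerLoop p B k γ ζ (pt S.x S.y) (dirU p B k ξ ζ (pt S.x S.y) S.u) (T + 1) := by
  simp only [step, sgd_w]
  rfl

section Measurability

variable [BorelSpace X] [BorelSpace Y] {α : Type*} {mα : MeasurableSpace α}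
  {ξ : ℕ → α → Ξ} {ζ : GBatch → ℕ → α → Z} {z : α → Pt X Y} {u D : α → Y}

variable {p}

theorem measurable_dirY (ho : p.Oracles) (hz : Measurable z)
    (hζ : ∀ i, Measurable (ζ (.b2 k) i)) :
    Measurable fun a => dirY p B k (fun g i => ζ g i a) (z a) :=
  measurable_batchMean fun i _ => continuous_snd_pt.measurable.comp
    (ho.measurable_gradient_G.comp (hz.prodMk (hζ i)))

theorem measurable_batchGradF (ho : p.Oracles) (hz : Measurable z)
    (hξ : ∀ i, Measurable (ξ i)) :
    Measurable fun a => batchGradF p B k (fun i => ξ i a) (z a) :=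
  measurable_batchMean fun i _ => ho.measurable_gradient_F.comp (hz.prodMk (hξ i))

theorem measurable_batchHess (ho : p.Oracles) (hz : Measurable z) (hu : Measurable u)
    (hζ : ∀ i, Measurable (ζ (.b1 k) i)) :
    Measurable fun a => batchHess p B k (fun g i => ζ g i a) (z a) (u a) :=
  measurable_batchMean fun i _ => ho.measurable_hess22_G_comp hz (hζ i) hu

theorem measurable_batchJac (ho : p.Oracles) (hz : Measurable z) (hu : Measurable u)
    (hζ : ∀ i, Measurable (ζ (.b4 k) i)) :
    Measurable fun a => batchJac p B k (fun g i => ζ g i a) (z a) (u a) :=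
  measurable_batchMean fun i _ => ho.measurable_hess12_G_comp hz (hζ i) hu

theorem measurable_dirU (ho : p.Oracles) (hz : Measurable z) (hu : Measurable u)
    (hξ : ∀ i, Measurable (ξ i)) (hζ : ∀ i, Measurable (ζ (.b1 k) i)) :
    Measurable fun a => dirU p B k (fun i => ξ i a) (fun g i => ζ g i a) (z a) (u a) :=
  (measurable_batchHess B k ho hz hu hζ).sub
    (continuous_snd_pt.measurable.comp (measurable_batchGradF B k ho hz hξ))

theorem measurable_dirX (ho : p.Oracles) (hz : Measurable z) (hu : Measurable u)
    (hξ : ∀ i, Measurable (ξ i)) (hζ : ∀ i, Measurable (ζ (.b4 k) i)) :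
    Measurable fun a => dirX p B k (fun i => ξ i a) (fun g i => ζ g i a) (z a) (u a) :=
  (continuous_fst_pt.measurable.comp (measurable_batchGradF B k ho hz hξ)).sub
    (measurable_batchJac B k ho hz hu hζ)

theorem measurable_innerLoop (γ : ℝ) (ho : p.Oracles) (hz : Measurable z) (hD : Measurable D)
    (t : ℕ) (hζ : ∀ s < t, ∀ i, Measurable (ζ (.b1t k s) i)) :
    Measurable fun a => innerLoop p B k γ (fun g i => ζ g i a) (z a) (D a) t := by
  induction t with
  | zero => exact measurable_const
  | succ t ih =>
    have ih' := ih fun s hs => hζ s (by omega)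
    have hH : Measurable fun a => batchMean (B.b1t k t) fun i =>
        hess22 (fun z' => p.G z' (ζ (.b1t k t) i a)) (z a)
          (innerLoop p B k γ (fun g i => ζ g i a) (z a) (D a) t) :=
      measurable_batchMean fun i _ => ho.measurable_hess22_G_comp hz
        (hζ t (by omega) i) ih'
    have e : (fun a => innerLoop p B k γ (fun g i => ζ g i a) (z a) (D a) (t + 1))
        = fun a => innerLoop p B k γ (fun g i => ζ g i a) (z a) (D a) t
          - γ • (batchMean (B.b1t k t) fun i =>
            hess22 (fun z' => p.G z' (ζ (.b1t k t) i a)) (z a)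
              (innerLoop p B k γ (fun g i => ζ g i a) (z a) (D a) t)) + γ • D a := by
      funext a
      rw [← batchMean_apply]
      rfl
    rw [e]
    exact (ih'.sub (hH.const_smul γ)).add (hD.const_smul γ)

end Measurability

end Directions

/-! ### Independence of the sources of randomness -/

/-- The outer iteration to which a batch belongs. -/
def GBatch.idx : GBatch → ℕ
  | .b1t k _ => k
  | .b1 k => k
  | .b2 k => k
  | .b4 k => k

/-- The batch with the same role in outer iteration `k`. -/
def GBatch.at (k : ℕ) : GBatch → GBatch
  | .b1t _ s => .b1t k s
  | .b1 _ => .b1 k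
  | .b2 _ => .b2 k
  | .b4 _ => .b4 k

theorem GBatch.idx_at (k : ℕ) (g : GBatch) : (g.at k).idx = k := by
  cases g <;> rfl

/-- The time at which a source of randomness is first used. -/
def srcTime : Option (ℕ × ℕ ⊕ GBatch × ℕ) → ℕ
  | none => 0
  | some (.inl a) => a.1 + 1
  | some (.inr a) => a.1.idx + 1

theorem measurable_of_coord {α ι β : Type*} {mα : MeasurableSpace α} [MeasurableSpace β]
    {f : α → ι → β} (hf : ∀ i, Measurable fun a => f a i) : Measurable f :=
  measurable_pi_lambda f hf

theorem measurable_pi_of_pi {α ι ι' β : Type*} {mα : MeasurableSpace α} [MeasurableSpace β]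
    {f : α → ι → ι' → β} (hf : ∀ i j, Measurable fun a => f a i j) : Measurable f :=
  measurable_of_coord fun i => measurable_of_coord (hf i)

theorem norm_sub_sq_le_two_mul {V : Type*} [NormedAddCommGroup V] (a b : V) :
    ‖a - b‖ ^ 2 ≤ 2 * ‖a‖ ^ 2 + 2 * ‖b‖ ^ 2 := by
  have h := norm_sub_le a b
  have := norm_nonneg (a - b)
  nlinarith [sq_nonneg (‖a‖ - ‖b‖), norm_nonneg a, norm_nonneg b]

section Sources

variable {X Y : Type*} [NormedAddCommGroup X] [InnerProductSpace ℝ X] [FiniteDimensional ℝ X]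
  [NormedAddCommGroup Y] [InnerProductSpace ℝ Y] [FiniteDimensional ℝ Y]
  [MeasurableSpace X] [MeasurableSpace Y] [BorelSpace X] [BorelSpace Y]
  {Ξ Z Ω : Type*} [MeasurableSpace Ξ] [MeasurableSpace Z] [MeasurableSpace Ω]
  {p : Problem X Y Ξ Z} {P : Measure Ω} (R : Randomness p P)

namespace Randomness

/-- The sigma-algebra generated by a set of sources. -/
@[reducible] def sigma (A : Set (Option (ℕ × ℕ ⊕ GBatch × ℕ))) : MeasurableSpace Ω :=
  ⨆ i ∈ A, sourceAlgebra R.x₀ R.y₀ R.u₀ R.ξ R.ζ i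

theorem sourceAlgebra_le (i : Option (ℕ × ℕ ⊕ GBatch × ℕ)) :
    sourceAlgebra R.x₀ R.y₀ R.u₀ R.ξ R.ζ i ≤ ‹MeasurableSpace Ω› := by
  match i with
  | none => exact (R.meas_x₀.prodMk (R.meas_y₀.prodMk R.meas_u₀)).comap_le
  | some (.inl a) => exact (R.meas_ξ a.1 a.2).comap_le
  | some (.inr a) => exact (R.meas_ζ a.1 a.2).comap_le

theorem sigma_le (A : Set (Option (ℕ × ℕ ⊕ GBatch × ℕ))) : R.sigma A ≤ ‹MeasurableSpace Ω› :=
  iSup₂_le fun i _ => R.sourceAlgebra_le i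

theorem sigma_mono {A A' : Set (Option (ℕ × ℕ ⊕ GBatch × ℕ))} (h : A ⊆ A') :
    R.sigma A ≤ R.sigma A' :=
  biSup_mono h

theorem le_sigma {A : Set (Option (ℕ × ℕ ⊕ GBatch × ℕ))} {i} (hi : i ∈ A) :
    sourceAlgebra R.x₀ R.y₀ R.u₀ R.ξ R.ζ i ≤ R.sigma A :=
  le_iSup₂ (f := fun i (_ : i ∈ A) => sourceAlgebra R.x₀ R.y₀ R.u₀ R.ξ R.ζ i) i hi

theorem measurable_ξ {A : Set (Option (ℕ × ℕ ⊕ GBatch × ℕ))} {k i : ℕ}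
    (h : some (.inl (k, i)) ∈ A) : Measurable[R.sigma A] (R.ξ k i) :=
  (comap_measurable (R.ξ k i)).mono (R.le_sigma h) le_rfl

theorem measurable_ζ {A : Set (Option (ℕ × ℕ ⊕ GBatch × ℕ))} {g : GBatch} {i : ℕ}
    (h : some (.inr (g, i)) ∈ A) : Measurable[R.sigma A] (R.ζ g i) :=
  (comap_measurable (R.ζ g i)).mono (R.le_sigma h) le_rfl

theorem measurable_init {A : Set (Option (ℕ × ℕ ⊕ GBatch × ℕ))} (h : none ∈ A) :
    Measurable[R.sigma A] fun ω => (R.x₀ ω, R.y₀ ω, R.u₀ ω) :=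
  (comap_measurable fun ω => (R.x₀ ω, R.y₀ ω, R.u₀ ω)).mono (R.le_sigma h) le_rfl

theorem indepFun_of_disjoint {α β : Type*} [MeasurableSpace α] [MeasurableSpace β]
    {A A' : Set (Option (ℕ × ℕ ⊕ GBatch × ℕ))} (hA : Disjoint A A') {f : Ω → α} {g : Ω → β}
    (hf : Measurable[R.sigma A] f) (hg : Measurable[R.sigma A'] g) : IndepFun f g P := by
  rw [IndepFun_iff_Indep]
  exact indep_of_indep_of_le_left
    (indep_of_indep_of_le_right (indep_iSup_of_disjoint R.sourceAlgebra_le R.indep hA)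
      hg.comap_le) hf.comap_le

theorem pairwise_indepFun_ζ (g : GBatch) :
    Pairwise fun i j => IndepFun (R.ζ g i) (R.ζ g j) P := by
  intro i j hij
  refine R.indepFun_of_disjoint (A := {some (.inr (g, i))}) (A' := {some (.inr (g, j))}) ?_
    (R.measurable_ζ (Set.mem_singleton _)) (R.measurable_ζ (Set.mem_singleton _))
  simpa using hij

theorem pairwise_indepFun_ξ (k : ℕ) :
    Pairwise fun i j => IndepFun (R.ξ k i) (R.ξ k j) P := by
  intro i j hij
  refine R.indepFun_of_disjoint (A := {some (.inl (k, i))}) (A' := {some (.inl (k, j))}) ?_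
    (R.measurable_ξ (Set.mem_singleton _)) (R.measurable_ξ (Set.mem_singleton _))
  simpa using hij

/-- The upper-level samples of iteration `k`. -/
def xi (k : ℕ) (ω : Ω) : ℕ → Ξ := fun i => R.ξ k i ω

/-- The lower-level samples. -/
def zeta (ω : Ω) : GBatch → ℕ → Z := fun g i => R.ζ g i ω

/-- The samples used in iteration `k`. -/
def noise (k : ℕ) (ω : Ω) : (ℕ → Ξ) × (GBatch → ℕ → Z) :=
  (fun i => R.ξ k i ω, fun g i => R.ζ (g.at k) i ω)

/-- Relabelling every batch by `g.at k` exposes only samples of iteration `k`. The labels that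
iteration `k` reads are fixed by it, so the algorithm run on `noise k` is unchanged. -/
theorem measurable_noise_sigma (k : ℕ) :
    Measurable[R.sigma {i | srcTime i = k + 1}] (R.noise k) := by
  refine Measurable.prodMk ?_ ?_
  · exact measurable_of_coord fun i => R.measurable_ξ rfl
  · refine measurable_pi_of_pi fun g i => R.measurable_ζ ?_
    change (g.at k).idx + 1 = k + 1
    rw [GBatch.idx_at]

theorem measurable_noise (k : ℕ) : Measurable (R.noise k) :=
  (R.measurable_noise_sigma k).mono (R.sigma_le _) le_rfl

theorem state_succ (B : BatchSizes) (α γ : ℝ) (T k : ℕ) (ω : Ω) :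
    R.state B α γ T (k + 1) ω
      = step p B α γ T k (R.xi k ω) (R.zeta ω) (R.state B α γ T k ω) := rfl

/-- The iterates are adapted: the initial point has time `0` and the samples of iteration `k` have
time `k + 1`. -/
theorem measurable_state_sigma (ho : p.Oracles) (B : BatchSizes) (α γ : ℝ) (T k : ℕ) :
    Measurable[R.sigma {i | srcTime i ≤ k}] (fun ω => (R.state B α γ T k ω).x) ∧
    Measurable[R.sigma {i | srcTime i ≤ k}] (fun ω => (R.state B α γ T k ω).y) ∧
    Measurable[R.sigma {i | srcTime i ≤ k}] (fun ω => (R.state B α γ T k ω).u) := by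
  induction k with
  | zero =>
    have h := R.measurable_init (A := {i | srcTime i ≤ 0}) (le_refl 0)
    exact ⟨measurable_fst.comp h, (measurable_fst.comp measurable_snd).comp h,
      (measurable_snd.comp measurable_snd).comp h⟩
  | succ k ih =>
    obtain ⟨hx, hy, hu⟩ := ih
    have hle : R.sigma {i | srcTime i ≤ k} ≤ R.sigma {i | srcTime i ≤ k + 1} :=
      R.sigma_mono fun i (hi : srcTime i ≤ k) => show srcTime i ≤ k + 1 by omega
    replace hx := hx.mono hle le_rfl
    replace hy := hy.mono hle le_rfl
    replace hu := hu.mono hle le_rfl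
    have hz : Measurable[R.sigma {i | srcTime i ≤ k + 1}]
        fun ω => pt (R.state B α γ T k ω).x (R.state B α γ T k ω).y :=
      continuous_pt.measurable.comp (hx.prodMk hy)
    have hξ : ∀ i, Measurable[R.sigma {i | srcTime i ≤ k + 1}] (R.ξ k i) := fun i =>
      R.measurable_ξ (show k + 1 ≤ k + 1 from le_rfl)
    have hζ : ∀ g : GBatch, g.idx = k → ∀ i,
        Measurable[R.sigma {i | srcTime i ≤ k + 1}] (R.ζ g i) := fun g hg i =>
      R.measurable_ζ (show g.idx + 1 ≤ k + 1 by omega)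
    have hdx := measurable_dirX B k ho hz hu hξ (hζ (.b4 k) rfl)
    have hdy := measurable_dirY B k ho hz (hζ (.b2 k) rfl)
    have hdu := measurable_dirU B k ho hz hu hξ (hζ (.b1 k) rfl)
    have hv := measurable_innerLoop B k γ ho hz hdy (T + 1) fun s _ => hζ (.b1t k s) rfl
    have hw := measurable_innerLoop B k γ ho hz hdu (T + 1) fun s _ => hζ (.b1t k s) rfl
    simp only [R.state_succ, step_x, step_y, step_u]
    exact ⟨hx.sub (hdx.const_smul α), hy.sub hv, hu.sub hw⟩

/-- The random triple `(x, y, u)`. -/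
def point (B : BatchSizes) (α γ : ℝ) (T k : ℕ) (ω : Ω) : X × Y × Y :=
  ((R.state B α γ T k ω).x, (R.state B α γ T k ω).y, (R.state B α γ T k ω).u)

theorem measurable_point_sigma (ho : p.Oracles) (B : BatchSizes) (α γ : ℝ) (T k : ℕ) :
    Measurable[R.sigma {i | srcTime i ≤ k}] (R.point B α γ T k) :=
  let ⟨hx, hy, hu⟩ := R.measurable_state_sigma ho B α γ T k
  hx.prodMk (hy.prodMk hu)

theorem measurable_point (ho : p.Oracles) (B : BatchSizes) (α γ : ℝ) (T k : ℕ) :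
    Measurable (R.point B α γ T k) :=
  (R.measurable_point_sigma ho B α γ T k).mono (R.sigma_le _) le_rfl

theorem indepFun_point_noise (ho : p.Oracles) (B : BatchSizes) (α γ : ℝ) (T k : ℕ) :
    IndepFun (R.point B α γ T k) (R.noise k) P := by
  refine R.indepFun_of_disjoint ?_ (R.measurable_point_sigma ho B α γ T k)
    (R.measurable_noise_sigma k)
  rw [Set.disjoint_left]
  intro i (hi : srcTime i ≤ k) (hi' : srcTime i = k + 1)
  omega

/-! ### Moments of the update directions at a fixed point -/

section Fixed

variable [IsProbabilityMeasure P] {c : Constants} (ho : p.Oracles) (hv : p.BoundedVariance c)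
  (B : BatchSizes) (k : ℕ) (z : Pt X Y) (u : Y)

include ho hv

theorem dirY_variance (hb : 0 < B.b2 k) :
    Integrable (fun ω => ‖dirY p B k (R.zeta ω) z - grad2 p.g z‖ ^ 2) P ∧
      ∫ ω, ‖dirY p B k (R.zeta ω) z - grad2 p.g z‖ ^ 2 ∂P ≤ c.σg1 ^ 2 / B.b2 k := by
  have := p.prob_ζ
  have hm : Measurable fun ζ => gradient (fun z' => p.G z' ζ) z :=
    ho.measurable_gradient_G.comp (measurable_const.prodMk measurable_id)
  have hi := ho.integrable_gradient_G hv z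
  have hle : ∀ ζ, ‖grad2 (fun z' => p.G z' ζ) z - grad2 p.g z‖ ^ 2
      ≤ ‖gradient (fun z' => p.G z' ζ) z - gradient p.g z‖ ^ 2 := fun ζ =>
    pow_le_pow_left₀ (norm_nonneg _) (norm_snd_le (gradient (fun z' => p.G z' ζ) z
      - gradient p.g z)) 2
  have hm2 : Measurable fun ζ => grad2 (fun z' => p.G z' ζ) z :=
    continuous_snd_pt.measurable.comp hm
  have hsq : Integrable (fun ζ => ‖grad2 (fun z' => p.G z' ζ) z - grad2 p.g z‖ ^ 2) p.lawζ := by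
    refine (hv.int_grad_G z).mono' ?_ (Filter.Eventually.of_forall fun ζ => ?_)
    · exact ((hm2.sub_const _).norm.pow_const 2).aestronglyMeasurable
    · rw [Real.norm_of_nonneg (sq_nonneg _)]
      exact hle ζ
  have hmean : ∫ ζ, grad2 (fun z' => p.G z' ζ) z ∂p.lawζ = grad2 p.g z := by
    have := (WithLp.sndL 2 ℝ X Y).integral_comp_comm hi
    rw [ho.unbiased_grad_G] at this
    exact this
  exact (batchMean_variance (R.meas_ζ (.b2 k)) (R.law_ζ (.b2 k)) (R.pairwise_indepFun_ζ (.b2 k))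
    hm2 ((WithLp.sndL 2 ℝ X Y).integrable_comp hi) hmean hsq
    ((integral_mono hsq (hv.int_grad_G z) hle).trans (hv.var_grad_G z)) hb).2.2

theorem batchGradF_variance (hb : 0 < B.b3 k) :
    Integrable (fun ω => batchGradF p B k (R.xi k ω) z - gradient p.f z) P ∧
    ∫ ω, (batchGradF p B k (R.xi k ω) z - gradient p.f z) ∂P = 0 ∧
    Integrable (fun ω => ‖batchGradF p B k (R.xi k ω) z - gradient p.f z‖ ^ 2) P ∧
      ∫ ω, ‖batchGradF p B k (R.xi k ω) z - gradient p.f z‖ ^ 2 ∂P ≤ c.σf1 ^ 2 / B.b3 k :=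
  batchMean_variance (R.meas_ξ k) (R.law_ξ k) (R.pairwise_indepFun_ξ k)
    (ho.measurable_gradient_F.comp (measurable_const.prodMk measurable_id))
    (ho.integrable_gradient_F hv z) (ho.unbiased_grad_F z) (hv.int_grad_F z) (hv.var_grad_F z) hb

theorem batchHess_variance (hb : 0 < B.b1 k) :
    Integrable (fun ω => ‖batchHess p B k (R.zeta ω) z u - hess22 p.g z u‖ ^ 2) P ∧
      ∫ ω, ‖batchHess p B k (R.zeta ω) z u - hess22 p.g z u‖ ^ 2 ∂P
        ≤ c.σg2 ^ 2 * ‖u‖ ^ 2 / B.b1 k := by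
  have hO := ho.oracle_hess22 hv z
  have hm : Measurable fun ζ => hess22 (fun z' => p.G z' ζ) z u :=
    ho.measurable_hess22_G_comp measurable_const measurable_id measurable_const
  exact (batchMean_variance (R.meas_ζ (.b1 k)) (R.law_ζ (.b1 k)) (R.pairwise_indepFun_ζ (.b1 k))
    hm (hO.int u) (hO.mean u) (hO.int_sq u) (hO.var u) hb).2.2

theorem batchJac_variance (hb : 0 < B.b4 k) :
    Integrable (fun ω => batchJac p B k (R.zeta ω) z u - hess12 p.g z u) P ∧
    ∫ ω, (batchJac p B k (R.zeta ω) z u - hess12 p.g z u) ∂P = 0 ∧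
    Integrable (fun ω => ‖batchJac p B k (R.zeta ω) z u - hess12 p.g z u‖ ^ 2) P ∧
      ∫ ω, ‖batchJac p B k (R.zeta ω) z u - hess12 p.g z u‖ ^ 2 ∂P
        ≤ c.σg2 ^ 2 * ‖u‖ ^ 2 / B.b4 k := by
  have hO := ho.oracle_hess12 hv z
  have hm : Measurable fun ζ => hess12 (fun z' => p.G z' ζ) z u :=
    ho.measurable_hess12_G_comp measurable_const measurable_id measurable_const
  exact batchMean_variance (R.meas_ζ (.b4 k)) (R.law_ζ (.b4 k)) (R.pairwise_indepFun_ζ (.b4 k))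
    hm (hO.int u) (hO.mean u) (hO.int_sq u) (hO.var u) hb

omit hv in
theorem measurable_dirY_fixed {A : Set (Option (ℕ × ℕ ⊕ GBatch × ℕ))}
    (hA : ∀ i, some (.inr (.b2 k, i)) ∈ A) :
    Measurable[R.sigma A] fun ω => dirY p B k (R.zeta ω) z :=
  measurable_dirY B k ho measurable_const fun i => R.measurable_ζ (hA i)

omit hv in
theorem measurable_dirU_fixed {A : Set (Option (ℕ × ℕ ⊕ GBatch × ℕ))}
    (hA : ∀ i, some (.inr (.b1 k, i)) ∈ A) (hA' : ∀ i, some (.inl (k, i)) ∈ A) :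
    Measurable[R.sigma A] fun ω => dirU p B k (R.xi k ω) (R.zeta ω) z u :=
  measurable_dirU B k ho measurable_const measurable_const (fun i => R.measurable_ξ (hA' i))
    fun i => R.measurable_ζ (hA i)

/-- The inequality `‖a - b‖² ≤ 2‖a‖² + 2‖b‖²` separates Hessian noise from gradient noise, so no
independence between the two batches is invoked. -/
theorem dirU_variance (hb1 : 0 < B.b1 k) (hb3 : 0 < B.b3 k) :
    Integrable (fun ω => ‖dirU p B k (R.xi k ω) (R.zeta ω) z u
      - (hess22 p.g z u - grad2 p.f z)‖ ^ 2) P ∧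
    ∫ ω, ‖dirU p B k (R.xi k ω) (R.zeta ω) z u - (hess22 p.g z u - grad2 p.f z)‖ ^ 2 ∂P
      ≤ 2 * (c.σg2 ^ 2 * ‖u‖ ^ 2 / B.b1 k) + 2 * (c.σf1 ^ 2 / B.b3 k) := by
  obtain ⟨h1, h2⟩ := R.batchHess_variance ho hv B k z u hb1
  obtain ⟨-, -, h3, h4⟩ := R.batchGradF_variance ho hv B k z hb3
  have hle : ∀ ω, ‖dirU p B k (R.xi k ω) (R.zeta ω) z u - (hess22 p.g z u - grad2 p.f z)‖ ^ 2
      ≤ 2 * ‖batchHess p B k (R.zeta ω) z u - hess22 p.g z u‖ ^ 2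
        + 2 * ‖batchGradF p B k (R.xi k ω) z - gradient p.f z‖ ^ 2 := by
    intro ω
    have e : dirU p B k (R.xi k ω) (R.zeta ω) z u - (hess22 p.g z u - grad2 p.f z)
        = (batchHess p B k (R.zeta ω) z u - hess22 p.g z u)
          - (batchGradF p B k (R.xi k ω) z - gradient p.f z).snd := by
      have : (batchGradF p B k (R.xi k ω) z - gradient p.f z).snd
        = (batchGradF p B k (R.xi k ω) z).snd - grad2 p.f z := rfl
      rw [this, dirU]
      abel
    rw [e]
    have h5 := norm_sub_sq_le_two_mul (batchHess p B k (R.zeta ω) z u - hess22 p.g z u)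
      (batchGradF p B k (R.xi k ω) z - gradient p.f z).snd
    have h6 := pow_le_pow_left₀ (norm_nonneg _)
      (norm_snd_le (batchGradF p B k (R.xi k ω) z - gradient p.f z)) 2
    linarith
  have hi : Integrable (fun ω => 2 * ‖batchHess p B k (R.zeta ω) z u - hess22 p.g z u‖ ^ 2
        + 2 * ‖batchGradF p B k (R.xi k ω) z - gradient p.f z‖ ^ 2) P :=
    (h1.const_mul 2).add (h3.const_mul 2)
  have hm : Measurable fun ω => dirU p B k (R.xi k ω) (R.zeta ω) z u :=
    (R.measurable_dirU_fixed ho B k z u (A := Set.univ) (fun _ => trivial)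
      fun _ => trivial).mono (R.sigma_le _) le_rfl
  have hint : Integrable (fun ω => ‖dirU p B k (R.xi k ω) (R.zeta ω) z u
      - (hess22 p.g z u - grad2 p.f z)‖ ^ 2) P := by
    refine hi.mono' ((hm.sub_const _).norm.pow_const 2).aestronglyMeasurable
      (Filter.Eventually.of_forall fun ω => ?_)
    rw [Real.norm_of_nonneg (sq_nonneg _)]
    exact hle ω
  refine ⟨hint, (integral_mono hint hi hle).trans ?_⟩
  rw [integral_add (h1.const_mul 2) (h3.const_mul 2), integral_const_mul, integral_const_mul]
  linarith

theorem dirX_variance (hb3 : 0 < B.b3 k) (hb4 : 0 < B.b4 k) :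
    Integrable (fun ω => dirX p B k (R.xi k ω) (R.zeta ω) z u
      - (grad1 p.f z - hess12 p.g z u)) P ∧
    ∫ ω, (dirX p B k (R.xi k ω) (R.zeta ω) z u - (grad1 p.f z - hess12 p.g z u)) ∂P = 0 ∧
    Integrable (fun ω => ‖dirX p B k (R.xi k ω) (R.zeta ω) z u
      - (grad1 p.f z - hess12 p.g z u)‖ ^ 2) P ∧
    ∫ ω, ‖dirX p B k (R.xi k ω) (R.zeta ω) z u - (grad1 p.f z - hess12 p.g z u)‖ ^ 2 ∂P
      ≤ 2 * (c.σf1 ^ 2 / B.b3 k) + 2 * (c.σg2 ^ 2 * ‖u‖ ^ 2 / B.b4 k) := by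
  obtain ⟨h1, h1', h2, h2'⟩ := R.batchJac_variance ho hv B k z u hb4
  obtain ⟨h3, h3', h4, h4'⟩ := R.batchGradF_variance ho hv B k z hb3
  have e : ∀ ω, dirX p B k (R.xi k ω) (R.zeta ω) z u - (grad1 p.f z - hess12 p.g z u)
      = (batchGradF p B k (R.xi k ω) z - gradient p.f z).fst
        - (batchJac p B k (R.zeta ω) z u - hess12 p.g z u) := by
    intro ω
    have : (batchGradF p B k (R.xi k ω) z - gradient p.f z).fst
      = (batchGradF p B k (R.xi k ω) z).fst - grad1 p.f z := rfl
    rw [this, dirX]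
    abel
  have h5 : Integrable (fun ω => (batchGradF p B k (R.xi k ω) z - gradient p.f z).fst) P :=
    (WithLp.fstL 2 ℝ X Y).integrable_comp h3
  have h5' : ∫ ω, (batchGradF p B k (R.xi k ω) z - gradient p.f z).fst ∂P = 0 := by
    have := (WithLp.fstL 2 ℝ X Y).integral_comp_comm h3
    rw [h3', map_zero] at this
    exact this
  have hint : Integrable (fun ω => dirX p B k (R.xi k ω) (R.zeta ω) z u
      - (grad1 p.f z - hess12 p.g z u)) P := by
    simp only [e]
    exact h5.sub h1
  have hle : ∀ ω, ‖dirX p B k (R.xi k ω) (R.zeta ω) z u - (grad1 p.f z - hess12 p.g z u)‖ ^ 2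
      ≤ 2 * ‖batchGradF p B k (R.xi k ω) z - gradient p.f z‖ ^ 2
        + 2 * ‖batchJac p B k (R.zeta ω) z u - hess12 p.g z u‖ ^ 2 := by
    intro ω
    rw [e]
    have h6 := norm_sub_sq_le_two_mul (batchGradF p B k (R.xi k ω) z - gradient p.f z).fst
      (batchJac p B k (R.zeta ω) z u - hess12 p.g z u)
    have h7 := pow_le_pow_left₀ (norm_nonneg _)
      (norm_fst_le (batchGradF p B k (R.xi k ω) z - gradient p.f z)) 2
    linarith
  have hi : Integrable (fun ω => 2 * ‖batchGradF p B k (R.xi k ω) z - gradient p.f z‖ ^ 2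
        + 2 * ‖batchJac p B k (R.zeta ω) z u - hess12 p.g z u‖ ^ 2) P :=
    (h4.const_mul 2).add (h2.const_mul 2)
  have hsq : Integrable (fun ω => ‖dirX p B k (R.xi k ω) (R.zeta ω) z u
      - (grad1 p.f z - hess12 p.g z u)‖ ^ 2) P := by
    refine hi.mono' (hint.aestronglyMeasurable.norm.pow 2)
      (Filter.Eventually.of_forall fun ω => ?_)
    rw [Real.norm_of_nonneg (sq_nonneg _)]
    exact hle ω
  refine ⟨hint, ?_, hsq, (integral_mono hsq hi hle).trans ?_⟩
  · simp only [e]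
    rw [integral_sub h5 h1, h5', h1', sub_zero]
  · rw [integral_add (h4.const_mul 2) (h2.const_mul 2), integral_const_mul, integral_const_mul]
    linarith

/-- Mean square error of the inner loop of iteration `k` at a fixed point, for a random direction
independent of the batches of the inner loop. -/
theorem innerLoop_error {μ γ τ : ℝ} (hb : p.Base c μ) (hμ : 0 < μ) (hμL : μ ≤ c.Lg1) (hγ : 0 < γ)
    (hγL : γ * c.Lg1 ≤ 1) {T : ℕ} (hB : ∀ s < T, 0 < B.b1t k s)
    (hBτ : ∀ s < T, 2 * γ * c.σg2 ^ 2 ≤ τ * μ * B.b1t k s) (hτ0 : 0 ≤ τ) (hτ : τ ≤ 1 / 2)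
    {D : Ω → Y} (hD : ∀ t, Measurable[R.sigma {i | ∀ j, i ≠ some (.inr (.b1t k t, j))}] D)
    (w : Y) {s : ℝ} (hDi : Integrable (fun ω => ‖D ω - hess22 p.g z w‖ ^ 2) P)
    (hDs : ∫ ω, ‖D ω - hess22 p.g z w‖ ^ 2 ∂P ≤ s) :
    Integrable (fun ω => ‖innerLoop p B k γ (R.zeta ω) z (D ω) T - w‖ ^ 2) P ∧
    ∫ ω, ‖innerLoop p B k γ (R.zeta ω) z (D ω) T - w‖ ^ 2 ∂P
      ≤ ((1 - γ * μ / 2) ^ T + 2 * τ) * ‖w‖ ^ 2 + 2 * s / μ ^ 2 := by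
  -- Iterate `t` has consumed only the inner batches `s < t`, so it is measurable without batch `t`,
  -- and hence independent of it.
  have hV : ∀ t, Measurable[R.sigma {i | ∀ j, i ≠ some (.inr (.b1t k t, j))}]
      fun ω => innerLoop p B k γ (R.zeta ω) z (D ω) t := by
    intro t
    refine measurable_innerLoop B k γ ho measurable_const (hD t) t fun s hs i =>
      R.measurable_ζ fun j h => ?_
    simp at h
    omega
  refine sgdVec_error (A := fun ζ => hess22 (fun z' => p.G z' ζ) z)
    (ζ := fun t i => R.ζ (.b1t k t) i) (b := fun t => B.b1t k t)
    (ho.oracle_hess22 hv z) hγ hμ ?_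
    (fun v => hb.norm_sub_smul_hess22_le hγ.le hγL z v) (fun t i => R.meas_ζ _ i)
    (fun t i => R.law_ζ _ i) (fun t => R.pairwise_indepFun_ζ _) hB hBτ hτ0 hτ
    ((hD 0).mono (R.sigma_le _) le_rfl) (fun t => (hV t).mono (R.sigma_le _) le_rfl) ?_ w hDi hDs
    T le_rfl
  · exact (mul_le_mul_of_nonneg_left hμL hγ.le).trans hγL
  · intro t
    refine R.indepFun_of_disjoint (A' := {i | ∃ j, i = some (.inr (.b1t k t, j))}) ?_
      ((hV t).prodMk (hD t)) (measurable_of_coord fun i => R.measurable_ζ ⟨i, rfl⟩)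
    rw [Set.disjoint_left]
    rintro i hi ⟨j, hj⟩
    exact hi j hj

end Fixed

end Randomness

end Sources

/-! ### One outer iteration from a fixed point -/

theorem Constants.L1_pos (c : Constants) {μ : ℝ} (hμ : 0 < μ) : 0 < c.L1 μ := by
  have := c.Lf1_pos
  have := c.Lg2_pos
  have := c.Lf0_pos
  rw [Constants.L1]
  positivity

theorem sq_integral_le_integral_sq {Ω : Type*} [MeasurableSpace Ω] {P : Measure Ω}
    [IsProbabilityMeasure P] {h : Ω → ℝ} (hm : AEStronglyMeasurable h P)
    (h2 : Integrable (fun ω => h ω ^ 2) P) : (∫ ω, h ω ∂P) ^ 2 ≤ ∫ ω, h ω ^ 2 ∂P := by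
  have h1 : Integrable h P :=
    ((memLp_two_iff_integrable_sq hm).mpr h2).integrable one_le_two
  set m := ∫ ω, h ω ∂P with hm'
  have h0 : 0 ≤ ∫ ω, (h ω - m) ^ 2 ∂P := integral_nonneg fun ω => sq_nonneg _
  have e : ∀ ω, (h ω - m) ^ 2 = h ω ^ 2 - 2 * m * h ω + m ^ 2 := fun ω => by ring
  have hi : Integrable (fun ω => h ω ^ 2 - 2 * m * h ω) P := h2.sub (h1.const_mul _)
  simp only [e] at h0
  rw [integral_add hi (integrable_const _), integral_sub h2 (h1.const_mul _),
    integral_const_mul, ← hm', integral_const, probReal_univ, one_smul] at h0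
  nlinarith

theorem moments_of_centered {Ω V : Type*} [MeasurableSpace Ω] {P : Measure Ω}
    [IsProbabilityMeasure P] [NormedAddCommGroup V] [InnerProductSpace ℝ V]
    [FiniteDimensional ℝ V] [MeasurableSpace V] [BorelSpace V] {D : Ω → V} {d : V}
    (h1 : Integrable (fun ω => D ω - d) P) (h2 : ∫ ω, (D ω - d) ∂P = 0)
    (h3 : Integrable (fun ω => ‖D ω - d‖ ^ 2) P) :
    Integrable D P ∧ ∫ ω, D ω ∂P = d ∧ Integrable (fun ω => ‖D ω‖ ^ 2) P ∧
      ∫ ω, ‖D ω‖ ^ 2 ∂P = ‖d‖ ^ 2 + ∫ ω, ‖D ω - d‖ ^ 2 ∂P := by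
  have hD : Integrable D P := by
    have : Integrable (fun ω => D ω - d + d) P := h1.add (integrable_const d)
    simpa only [sub_add_cancel] using this
  have e : ∀ ω, ‖-d - (D ω - d)‖ ^ 2 = ‖D ω‖ ^ 2 := fun ω => by
    rw [show -d - (D ω - d) = -D ω by abel, norm_neg]
  have key := integral_norm_const_sub_sq (P := P) (-d) h1 h2 h3
  simp only [e, norm_neg] at key
  refine ⟨hD, ?_, key.1, key.2⟩
  rw [integral_sub hD (integrable_const _), integral_const, probReal_univ, one_smul,
    sub_eq_zero] at h2
  exact h2

theorem norm_add_sq_le_two_mul {V : Type*} [NormedAddCommGroup V] (a b : V) :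
    ‖a + b‖ ^ 2 ≤ 2 * ‖a‖ ^ 2 + 2 * ‖b‖ ^ 2 := by
  have := norm_sub_sq_le_two_mul a (-b)
  rwa [sub_neg_eq_add, norm_neg] at this

/-- The batches and the inner loop of iteration `k` are large enough for the inner loop to have
relative error `ρ`. -/
structure BatchSizes.Adequate (B : BatchSizes) (c : Constants) (μ γ ρ : ℝ) (T k : ℕ) : Prop where
  b1_pos : 0 < B.b1 k
  b2_pos : 0 < B.b2 k
  b3_pos : 0 < B.b3 k
  b4_pos : 0 < B.b4 k
  b1t_pos : ∀ s < T + 1, 0 < B.b1t k s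
  b1t_ge : ∀ s < T + 1, 2 * γ * c.σg2 ^ 2 ≤ ρ ^ 2 / 4 * μ * B.b1t k s
  pow_le : (1 - γ * μ / 2) ^ (T + 1) ≤ ρ ^ 2 / 2

section Step

variable {X Y : Type*} [NormedAddCommGroup X] [InnerProductSpace ℝ X] [FiniteDimensional ℝ X]
  [NormedAddCommGroup Y] [InnerProductSpace ℝ Y] [FiniteDimensional ℝ Y]
  [MeasurableSpace X] [MeasurableSpace Y] [BorelSpace X] [BorelSpace Y]
  {Ξ Z Ω : Type*} [MeasurableSpace Ξ] [MeasurableSpace Z] [MeasurableSpace Ω]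
  {p : Problem X Y Ξ Z} {P : Measure Ω} (R : Randomness p P)

namespace Randomness

variable [IsProbabilityMeasure P] {c : Constants} {μ γ ρ : ℝ} {B : BatchSizes} {k T : ℕ}
  (ho : p.Oracles) (hv : p.BoundedVariance c) (hb : p.Base c μ) (hμ : 0 < μ) (hμL : μ ≤ c.Lg1)
  (hγ : 0 < γ) (hγL : γ * c.Lg1 ≤ 1) (hρ : 0 ≤ ρ) (hρ1 : ρ ≤ 1)
  (hB : B.Adequate c μ γ ρ T k) (x : X) (y u : Y)

include ho hv hb hμ hμL hγ hγL hρ hρ1 hB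

/-- With `τ = ρ²/4` the matrix noise contributes `ρ²/2` and the forgotten initial error another
`ρ²/2`; the target is the Newton direction. -/
theorem innerLoop_dirY_error :
    Integrable (fun ω => ‖innerLoop p B k γ (R.zeta ω) (pt x y) (dirY p B k (R.zeta ω) (pt x y))
      (T + 1) - (hess22 p.g (pt x y)).inverse (grad2 p.g (pt x y))‖ ^ 2) P ∧
    ∫ ω, ‖innerLoop p B k γ (R.zeta ω) (pt x y) (dirY p B k (R.zeta ω) (pt x y))
      (T + 1) - (hess22 p.g (pt x y)).inverse (grad2 p.g (pt x y))‖ ^ 2 ∂P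
      ≤ ρ ^ 2 * ‖(hess22 p.g (pt x y)).inverse (grad2 p.g (pt x y))‖ ^ 2
        + 2 * (c.σg1 ^ 2 / B.b2 k) / μ ^ 2 := by
  have h1 := R.dirY_variance ho hv B k (pt x y) hB.b2_pos
  have h := R.innerLoop_error ho hv B k (pt x y) hb hμ hμL hγ hγL hB.b1t_pos hB.b1t_ge
    (by positivity) (by nlinarith) (D := fun ω => dirY p B k (R.zeta ω) (pt x y))
    (fun t => R.measurable_dirY_fixed ho B k (pt x y) (by simp))
    ((hess22 p.g (pt x y)).inverse (grad2 p.g (pt x y))) (s := c.σg1 ^ 2 / B.b2 k)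
    (by rw [hb.hess22_apply_inverse hμ]; exact h1.1)
    (by rw [hb.hess22_apply_inverse hμ]; exact h1.2)
  have := hB.pow_le
  exact ⟨h.1, h.2.trans (add_le_add (mul_le_mul_of_nonneg_right (by linarith) (sq_nonneg _))
    le_rfl)⟩

/-- The mean of `D_u` is `H (u - H⁻¹ ∇₂f)`, so subtracting the computed correction moves `u` to the
solution `H⁻¹ ∇₂f` up to the inner error. -/
theorem innerLoop_dirU_error :
    Integrable (fun ω => ‖innerLoop p B k γ (R.zeta ω) (pt x y)
      (dirU p B k (R.xi k ω) (R.zeta ω) (pt x y) u) (T + 1)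
        - (u - (hess22 p.g (pt x y)).inverse (grad2 p.f (pt x y)))‖ ^ 2) P ∧
    ∫ ω, ‖innerLoop p B k γ (R.zeta ω) (pt x y)
      (dirU p B k (R.xi k ω) (R.zeta ω) (pt x y) u) (T + 1)
        - (u - (hess22 p.g (pt x y)).inverse (grad2 p.f (pt x y)))‖ ^ 2 ∂P
      ≤ ρ ^ 2 * ‖u - (hess22 p.g (pt x y)).inverse (grad2 p.f (pt x y))‖ ^ 2
        + 2 * (2 * (c.σg2 ^ 2 * ‖u‖ ^ 2 / B.b1 k) + 2 * (c.σf1 ^ 2 / B.b3 k)) / μ ^ 2 := by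
  have h1 := R.dirU_variance ho hv B k (pt x y) u hB.b1_pos hB.b3_pos
  have e : hess22 p.g (pt x y) (u - (hess22 p.g (pt x y)).inverse (grad2 p.f (pt x y)))
      = hess22 p.g (pt x y) u - grad2 p.f (pt x y) := by
    rw [map_sub, hb.hess22_apply_inverse hμ]
  have h := R.innerLoop_error ho hv B k (pt x y) hb hμ hμL hγ hγL hB.b1t_pos hB.b1t_ge
    (by positivity) (by nlinarith)
    (D := fun ω => dirU p B k (R.xi k ω) (R.zeta ω) (pt x y) u)
    (fun t => R.measurable_dirU_fixed ho B k (pt x y) u (by simp) (by simp))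
    (u - (hess22 p.g (pt x y)).inverse (grad2 p.f (pt x y)))
    (s := 2 * (c.σg2 ^ 2 * ‖u‖ ^ 2 / B.b1 k) + 2 * (c.σf1 ^ 2 / B.b3 k))
    (by rw [e]; exact h1.1) (by rw [e]; exact h1.2)
  have := hB.pow_le
  exact ⟨h.1, h.2.trans (add_le_add (mul_le_mul_of_nonneg_right (by linarith) (sq_nonneg _))
    le_rfl)⟩

theorem aestronglyMeasurable_innerLoop_dirY :
    AEStronglyMeasurable (fun ω => innerLoop p B k γ (R.zeta ω) (pt x y)
      (dirY p B k (R.zeta ω) (pt x y)) (T + 1)) P := by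
  have hm : Measurable fun ω => dirY p B k (R.zeta ω) (pt x y) :=
    measurable_dirY B k ho measurable_const fun i => R.meas_ζ _ i
  exact (measurable_innerLoop B k γ ho measurable_const hm _
    fun s _ i => R.meas_ζ _ i).aestronglyMeasurable

theorem aestronglyMeasurable_innerLoop_dirU :
    AEStronglyMeasurable (fun ω => innerLoop p B k γ (R.zeta ω) (pt x y)
      (dirU p B k (R.xi k ω) (R.zeta ω) (pt x y) u) (T + 1)) P := by
  have hm : Measurable fun ω => dirU p B k (R.xi k ω) (R.zeta ω) (pt x y) u :=
    measurable_dirU B k ho measurable_const measurable_const (fun i => R.meas_ξ _ i)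
      fun i => R.meas_ζ _ i
  exact (measurable_innerLoop B k γ ho measurable_const hm _
    fun s _ i => R.meas_ζ _ i).aestronglyMeasurable

/-- Its role is qualitative: it provides square integrability of the next `y` error. The constants
of order `κ²` never enter the rate. -/
theorem fixed_y_sq :
    Integrable (fun ω => ‖y - innerLoop p B k γ (R.zeta ω) (pt x y)
      (dirY p B k (R.zeta ω) (pt x y)) (T + 1) - yStar p.g x‖ ^ 2) P ∧
    ∫ ω, ‖y - innerLoop p B k γ (R.zeta ω) (pt x y)
      (dirY p B k (R.zeta ω) (pt x y)) (T + 1) - yStar p.g x‖ ^ 2 ∂P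
      ≤ (2 * (1 + c.Lg1 / μ) ^ 2 + 2 * ρ ^ 2 * (c.Lg1 / μ) ^ 2) * ‖y - yStar p.g x‖ ^ 2
        + 4 * (c.σg1 ^ 2 / B.b2 k) / μ ^ 2 := by
  obtain ⟨h1, h2⟩ := R.innerLoop_dirY_error ho hv hb hμ hμL hγ hγL hρ hρ1 hB x y
  have hm := R.aestronglyMeasurable_innerLoop_dirY ho hv hb hμ hμL hγ hγL hρ hρ1 hB x y
  set V : Ω → Y := fun ω => innerLoop p B k γ (R.zeta ω) (pt x y)
    (dirY p B k (R.zeta ω) (pt x y)) (T + 1)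
  have hK := hb.norm_newton_direction_le' hμ x y
  set v := (hess22 p.g (pt x y)).inverse (grad2 p.g (pt x y))
  set δ := ‖y - yStar p.g x‖
  have hle : ∀ ω, ‖y - V ω - yStar p.g x‖ ^ 2
      ≤ 2 * ((1 + c.Lg1 / μ) * δ) ^ 2 + 2 * ‖V ω - v‖ ^ 2 := by
    intro ω
    have e : y - V ω - yStar p.g x = (y - yStar p.g x - v) - (V ω - v) := by abel
    rw [e]
    refine (norm_sub_sq_le_two_mul _ _).trans ?_
    have h3 : ‖y - yStar p.g x - v‖ ≤ (1 + c.Lg1 / μ) * δ := by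
      refine (norm_sub_le _ _).trans ?_
      linarith
    have := pow_le_pow_left₀ (norm_nonneg _) h3 2
    linarith
  have hi : Integrable (fun ω => 2 * ((1 + c.Lg1 / μ) * δ) ^ 2 + 2 * ‖V ω - v‖ ^ 2) P :=
    (integrable_const _).add (h1.const_mul 2)
  have hint : Integrable (fun ω => ‖y - V ω - yStar p.g x‖ ^ 2) P := by
    refine hi.mono' ((((aestronglyMeasurable_const.sub hm).sub
      aestronglyMeasurable_const).norm).pow 2) (Filter.Eventually.of_forall fun ω => ?_)
    rw [Real.norm_of_nonneg (sq_nonneg _)]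
    exact hle ω
  refine ⟨hint, (integral_mono hint hi hle).trans ?_⟩
  rw [integral_add (integrable_const _) (h1.const_mul 2), integral_const, integral_const_mul,
    probReal_univ, one_smul]
  have h4 : ‖v‖ ^ 2 ≤ (c.Lg1 / μ * δ) ^ 2 := pow_le_pow_left₀ (norm_nonneg _) hK 2
  have h5 := mul_le_mul_of_nonneg_left h4 (sq_nonneg ρ)
  calc _ ≤ 2 * ((1 + c.Lg1 / μ) * δ) ^ 2
        + 2 * (ρ ^ 2 * (c.Lg1 / μ * δ) ^ 2 + 2 * (c.σg1 ^ 2 / B.b2 k) / μ ^ 2) := by linarith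
    _ = _ := by ring

/-- Jensen's inequality bounds the mean inner error by `√(ρ²‖v‖² + η²) ≤ ρ‖v‖ + η`. Working with the
first moment keeps the quadratic Newton error at second order in `‖y - y*‖`. -/
theorem fixed_y {η : ℝ} (hη : 0 ≤ η) (hη2 : 2 * (c.σg1 ^ 2 / B.b2 k) / μ ^ 2 ≤ η ^ 2) :
    ∫ ω, ‖y - innerLoop p B k γ (R.zeta ω) (pt x y)
      (dirY p B k (R.zeta ω) (pt x y)) (T + 1) - yStar p.g x‖ ∂P
      ≤ (1 + ρ) * (c.Lg2 / μ) * ‖y - yStar p.g x‖ ^ 2 + ρ * ‖y - yStar p.g x‖ + η := by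
  obtain ⟨h1, h2⟩ := R.innerLoop_dirY_error ho hv hb hμ hμL hγ hγL hρ hρ1 hB x y
  have hm := R.aestronglyMeasurable_innerLoop_dirY ho hv hb hμ hμL hγ hγL hρ hρ1 hB x y
  have hn := hb.norm_newton_le hμ x y
  have hK := hb.norm_newton_direction_le hμ x y
  set V : Ω → Y := fun ω => innerLoop p B k γ (R.zeta ω) (pt x y)
    (dirY p B k (R.zeta ω) (pt x y)) (T + 1)
  set v := (hess22 p.g (pt x y)).inverse (grad2 p.g (pt x y))
  set δ := ‖y - yStar p.g x‖
  have hms : AEStronglyMeasurable (fun ω => V ω - v) P := hm.sub aestronglyMeasurable_const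
  have hi1 : Integrable (fun ω => ‖V ω - v‖) P := (integrable_of_norm_sq hms h1).norm
  have hle : ∀ ω, ‖y - V ω - yStar p.g x‖ ≤ c.Lg2 / μ * δ ^ 2 + ‖V ω - v‖ := by
    intro ω
    have e : y - V ω - yStar p.g x = (y - v - yStar p.g x) - (V ω - v) := by abel
    rw [e]
    exact (norm_sub_le _ _).trans (add_le_add hn le_rfl)
  have hE : ∫ ω, ‖V ω - v‖ ∂P ≤ ρ * ‖v‖ + η := by
    have h3 := sq_integral_le_integral_sq hms.norm h1
    refine (pow_le_pow_iff_left₀ (integral_nonneg fun ω => norm_nonneg _) (by positivity)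
      two_ne_zero).mp (h3.trans (h2.trans ?_))
    have : 0 ≤ ρ * ‖v‖ * η := by positivity
    nlinarith
  have hi : Integrable (fun ω => c.Lg2 / μ * δ ^ 2 + ‖V ω - v‖) P :=
    (integrable_const _).add hi1
  refine (integral_mono_of_nonneg (Filter.Eventually.of_forall fun ω => norm_nonneg _) hi
    (Filter.Eventually.of_forall hle)).trans ?_
  rw [integral_add (integrable_const _) hi1, integral_const, probReal_univ, one_smul]
  have := mul_le_mul_of_nonneg_left hK hρ
  calc _ ≤ c.Lg2 / μ * δ ^ 2 + (ρ * (δ + c.Lg2 / μ * δ ^ 2) + η) := by linarith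
    _ = _ := by ring

/-- The old error of `u` enters only through the relative error of the inner loop, hence with the
small factor `4ρ²`. -/
theorem fixed_u_sq :
    Integrable (fun ω => ‖u - innerLoop p B k γ (R.zeta ω) (pt x y)
      (dirU p B k (R.xi k ω) (R.zeta ω) (pt x y) u) (T + 1) - uStar p.f p.g x‖ ^ 2) P ∧
    ∫ ω, ‖u - innerLoop p B k γ (R.zeta ω) (pt x y)
      (dirU p B k (R.xi k ω) (R.zeta ω) (pt x y) u) (T + 1) - uStar p.f p.g x‖ ^ 2 ∂P
      ≤ (2 + 4 * ρ ^ 2) * (c.L1 μ / μ) ^ 2 * ‖y - yStar p.g x‖ ^ 2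
        + 4 * ρ ^ 2 * ‖u - uStar p.f p.g x‖ ^ 2
        + 8 * (c.σg2 ^ 2 * ‖u‖ ^ 2 / B.b1 k + c.σf1 ^ 2 / B.b3 k) / μ ^ 2 := by
  obtain ⟨h1, h2⟩ := R.innerLoop_dirU_error ho hv hb hμ hμL hγ hγL hρ hρ1 hB x y u
  have hm := R.aestronglyMeasurable_innerLoop_dirU ho hv hb hμ hμL hγ hγL hρ hρ1 hB x y u
  have hN := hb.norm_inverse_grad2_sub_uStar_le hμ (pt x y) x
  rw [hb.norm_sub_zStar] at hN
  set W : Ω → Y := fun ω => innerLoop p B k γ (R.zeta ω) (pt x y)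
    (dirU p B k (R.xi k ω) (R.zeta ω) (pt x y) u) (T + 1)
  set v := (hess22 p.g (pt x y)).inverse (grad2 p.f (pt x y))
  set us := uStar p.f p.g x
  set δ := ‖y - yStar p.g x‖
  have hN2 := pow_le_pow_left₀ (norm_nonneg _) hN 2
  have hle : ∀ ω, ‖u - W ω - us‖ ^ 2
      ≤ 2 * (c.L1 μ / μ * δ) ^ 2 + 2 * ‖W ω - (u - v)‖ ^ 2 := by
    intro ω
    have e : u - W ω - us = (v - us) - (W ω - (u - v)) := by abel
    rw [e]
    refine (norm_sub_sq_le_two_mul _ _).trans ?_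
    linarith
  have hi : Integrable (fun ω => 2 * (c.L1 μ / μ * δ) ^ 2 + 2 * ‖W ω - (u - v)‖ ^ 2) P :=
    (integrable_const _).add (h1.const_mul 2)
  have hint : Integrable (fun ω => ‖u - W ω - us‖ ^ 2) P := by
    refine hi.mono' ((((aestronglyMeasurable_const.sub hm).sub
      aestronglyMeasurable_const).norm).pow 2) (Filter.Eventually.of_forall fun ω => ?_)
    rw [Real.norm_of_nonneg (sq_nonneg _)]
    exact hle ω
  refine ⟨hint, (integral_mono hint hi hle).trans ?_⟩
  rw [integral_add (integrable_const _) (h1.const_mul 2), integral_const, integral_const_mul,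
    probReal_univ, one_smul]
  have h4 : ‖u - v‖ ^ 2 ≤ 2 * ‖u - us‖ ^ 2 + 2 * (c.L1 μ / μ * δ) ^ 2 := by
    have e : u - v = (u - us) - (v - us) := by abel
    rw [e]
    refine (norm_sub_sq_le_two_mul _ _).trans ?_
    linarith
  have h5 := mul_le_mul_of_nonneg_left h4 (sq_nonneg ρ)
  calc _ ≤ 2 * (c.L1 μ / μ * δ) ^ 2
        + 2 * (ρ ^ 2 * (2 * ‖u - us‖ ^ 2 + 2 * (c.L1 μ / μ * δ) ^ 2)
          + 2 * (2 * (c.σg2 ^ 2 * ‖u‖ ^ 2 / B.b1 k) + 2 * (c.σf1 ^ 2 / B.b3 k)) / μ ^ 2) := by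
        linarith
    _ = _ := by ring

omit hb hμ hμL hγ hγL hρ hρ1 in
theorem fixed_x_sq :
    Integrable (fun ω => dirX p B k (R.xi k ω) (R.zeta ω) (pt x y) u) P ∧
    ∫ ω, dirX p B k (R.xi k ω) (R.zeta ω) (pt x y) u ∂P
      = grad1 p.f (pt x y) - hess12 p.g (pt x y) u ∧
    Integrable (fun ω => ‖dirX p B k (R.xi k ω) (R.zeta ω) (pt x y) u‖ ^ 2) P ∧
    ∫ ω, ‖dirX p B k (R.xi k ω) (R.zeta ω) (pt x y) u‖ ^ 2 ∂P
      ≤ ‖grad1 p.f (pt x y) - hess12 p.g (pt x y) u‖ ^ 2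
        + (2 * (c.σf1 ^ 2 / B.b3 k) + 2 * (c.σg2 ^ 2 * ‖u‖ ^ 2 / B.b4 k)) := by
  obtain ⟨h1, h2, h3, h4⟩ := R.dirX_variance ho hv B k (pt x y) u hB.b3_pos hB.b4_pos
  obtain ⟨k1, k2, k3, k4⟩ := moments_of_centered h1 h2 h3
  refine ⟨k1, k2, k3, ?_⟩
  rw [k4]
  linarith

omit hμL hγ hγL hρ hρ1 in
-- With `d` the mean direction and `G = ∇Φ(x)`, polarization gives `-⟨G, d⟩ = (‖d - G‖² - ‖d‖² -
-- ‖G‖²)/2`. The bias bound controls `‖d - G‖²`.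
theorem fixed_Phi {α : ℝ} (hα : 0 ≤ α) (hαL : α * (c.L1 μ * (1 + c.Lg1 / μ) ^ 2) ≤ 1 / 4) :
    ∫ ω, Phi p.f p.g (x - α • dirX p B k (R.xi k ω) (R.zeta ω) (pt x y) u) ∂P
      ≤ Phi p.f p.g x - α / 2 * ‖gradient (Phi p.f p.g) x‖ ^ 2
        - α / 4 * ‖grad1 p.f (pt x y) - hess12 p.g (pt x y) u‖ ^ 2
        + α * (c.L1 μ ^ 2 * ‖y - yStar p.g x‖ ^ 2 + c.Lg1 ^ 2 * ‖u - uStar p.f p.g x‖ ^ 2)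
        + α / 4 * (2 * (c.σf1 ^ 2 / B.b3 k) + 2 * (c.σg2 ^ 2 * ‖u‖ ^ 2 / B.b4 k)) := by
  obtain ⟨h1, h2, h3, h4⟩ := R.fixed_x_sq ho hv hB x y u
  have hbias := hb.norm_direction_sub_gradient_le hμ x (pt x y) u
  rw [hb.norm_sub_zStar] at hbias
  set DX : Ω → X := fun ω => dirX p B k (R.xi k ω) (R.zeta ω) (pt x y) u
  set d := grad1 p.f (pt x y) - hess12 p.g (pt x y) u
  set G := gradient (Phi p.f p.g) x
  set L := c.L1 μ * (1 + c.Lg1 / μ) ^ 2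
  have hle : ∀ ω, Phi p.f p.g (x - α • DX ω)
      ≤ Phi p.f p.g x - α * inner ℝ G (DX ω) + L * α ^ 2 * ‖DX ω‖ ^ 2 := by
    intro ω
    have h := hb.Phi_descent hμ x (x - α • DX ω)
    have e : x - α • DX ω - x = -(α • DX ω) := by abel
    rw [e, inner_neg_right, inner_smul_right, norm_neg, norm_smul, mul_pow,
      Real.norm_of_nonneg hα] at h
    linarith
  have hin : Integrable (fun ω => inner ℝ G (DX ω)) P := h1.const_inner G
  have hi1 : Integrable (fun ω => Phi p.f p.g x - α * inner ℝ G (DX ω)) P :=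
    (integrable_const _).sub (hin.const_mul α)
  have hi : Integrable (fun ω => Phi p.f p.g x - α * inner ℝ G (DX ω)
      + L * α ^ 2 * ‖DX ω‖ ^ 2) P := hi1.add (h3.const_mul _)
  have hint : Integrable (fun ω => Phi p.f p.g (x - α • DX ω)) P := by
    have hc : Continuous (Phi p.f p.g) := (hb.differentiable_Phi hμ).continuous
    have hms : AEStronglyMeasurable (fun ω => Phi p.f p.g (x - α • DX ω)) P :=
      hc.comp_aestronglyMeasurable (aestronglyMeasurable_const.sub
        (h1.aestronglyMeasurable.const_smul α))
    have hdiff : Integrable (fun ω => Phi p.f p.g (x - α • DX ω) - Phi p.f p.g x) P := by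
      refine ((h1.norm.const_mul α).const_mul (c.Cf0 + c.Lg1 * (c.Lf0 / μ))).mono'
        (hms.sub aestronglyMeasurable_const) (Filter.Eventually.of_forall fun ω => ?_)
      have h := hb.abs_Phi_sub_le hμ x (x - α • DX ω)
      have e : x - α • DX ω - x = -(α • DX ω) := by abel
      rwa [e, norm_neg, norm_smul, Real.norm_of_nonneg hα] at h
    have : Integrable (fun ω => Phi p.f p.g (x - α • DX ω) - Phi p.f p.g x + Phi p.f p.g x) P :=
      hdiff.add (integrable_const _)
    simpa only [sub_add_cancel] using this
  refine (integral_mono hint hi hle).trans ?_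
  rw [integral_add hi1 (h3.const_mul _), integral_sub (integrable_const _) (hin.const_mul α),
    integral_const_mul, integral_const_mul, integral_inner h1, h2, integral_const, probReal_univ,
    one_smul]
  have e1 : ‖d - G‖ ^ 2 = ‖d‖ ^ 2 - 2 * inner ℝ G d + ‖G‖ ^ 2 := by
    rw [norm_sub_sq_real, real_inner_comm]
  have h5 : ‖d - G‖ ^ 2 ≤ 2 * (c.L1 μ ^ 2 * ‖y - yStar p.g x‖ ^ 2)
      + 2 * (c.Lg1 ^ 2 * ‖u - uStar p.f p.g x‖ ^ 2) := by
    have := pow_le_pow_left₀ (norm_nonneg _) hbias 2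
    nlinarith [sq_nonneg (c.L1 μ * ‖y - yStar p.g x‖ - c.Lg1 * ‖u - uStar p.f p.g x‖)]
  -- The second-order term consumes half of `-(α/2)‖d‖²`; the other half is kept to pay for the
  -- drift of `y*` and `u*`.
  have h6 : L * α ^ 2 * ∫ ω, ‖DX ω‖ ^ 2 ∂P ≤ α / 4 * ∫ ω, ‖DX ω‖ ^ 2 ∂P := by
    refine mul_le_mul_of_nonneg_right ?_ (integral_nonneg fun ω => sq_nonneg _)
    nlinarith
  have h7 := mul_le_mul_of_nonneg_left h4 (show 0 ≤ α / 4 by linarith)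
  have h8 := mul_le_mul_of_nonneg_left h5 (show 0 ≤ α / 2 by linarith)
  rw [e1] at h8
  linarith

end Randomness

end Step

/-! ### One outer iteration in expectation -/

theorem integrable_integral_le_of_decouple {Ω 𝒮 𝒩 : Type*} [MeasurableSpace Ω]
    [MeasurableSpace 𝒮] [MeasurableSpace 𝒩] {P : Measure Ω} [IsProbabilityMeasure P]
    {S : Ω → 𝒮} {N : Ω → 𝒩} (hS : Measurable S) (hN : Measurable N) (hind : IndepFun S N P)
    {h : 𝒮 × 𝒩 → ℝ} (hh : Measurable h) (h0 : ∀ q, 0 ≤ h q) {B : 𝒮 → ℝ} (hB : Measurable B)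
    (hint : ∀ s, Integrable (fun ω => h (s, N ω)) P ∧ ∫ ω, h (s, N ω) ∂P ≤ B s)
    (hBi : Integrable (fun ω => B (S ω)) P) :
    Integrable (fun ω => h (S ω, N ω)) P ∧ ∫ ω, h (S ω, N ω) ∂P ≤ ∫ ω, B (S ω) ∂P := by
  have hi := integrable_of_decouple hS hN hind hh h0 hB (fun s => (hint s).1)
    (fun s => (hint s).2) hBi
  exact ⟨hi, integral_le_of_decouple hS hN hind hh hB hi (fun s => (hint s).2) hBi⟩

/-! ### Error functionals on triples of iterates. -/

section Deviations

variable {X Y : Type*} [NormedAddCommGroup X] [InnerProductSpace ℝ X] [FiniteDimensional ℝ X]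
  [NormedAddCommGroup Y] [InnerProductSpace ℝ Y] [FiniteDimensional ℝ Y]
  [MeasurableSpace X] [MeasurableSpace Y]
  {Ξ Z : Type*} [MeasurableSpace Ξ] [MeasurableSpace Z]
  (p : Problem X Y Ξ Z)

/-- The distance `‖y - y*(x)‖`. -/
def devY (q : X × Y × Y) : ℝ := ‖q.2.1 - yStar p.g q.1‖

/-- The distance `‖u - u*(x)‖`. -/
def devU (q : X × Y × Y) : ℝ := ‖q.2.2 - uStar p.f p.g q.1‖

/-- The norm of the expected direction `D̄ₓ`. -/
def meanDir (q : X × Y × Y) : ℝ :=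
  ‖grad1 p.f (pt q.1 q.2.1) - hess12 p.g (pt q.1 q.2.1) q.2.2‖

variable {p} {c : Constants} {μ : ℝ}

theorem devY_nonneg (q : X × Y × Y) : 0 ≤ devY p q := norm_nonneg _

theorem continuous_devY (hb : p.Base c μ) (hμ : 0 < μ) : Continuous (devY p) := by
  have := hb.continuous_yStar hμ
  unfold devY
  fun_prop

theorem continuous_devU (hb : p.Base c μ) (hμ : 0 < μ) : Continuous (devU p) := by
  have := hb.continuous_uStar hμ
  unfold devU
  fun_prop

theorem continuous_hess12_g (hb : p.Base c μ) : Continuous (hess12 p.g) := by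
  have : LipschitzWith (Real.toNNReal c.Lg2) (hess12 p.g) :=
    LipschitzWith.of_dist_le' fun z z' => by
      rw [dist_eq_norm, dist_eq_norm]
      exact (norm_le_frobenius _).trans (hb.lip_hess12_g z z')
  exact this.continuous

theorem continuous_grad1_f (hb : p.Base c μ) : Continuous (grad1 p.f) := by
  have : LipschitzWith (Real.toNNReal c.Lf1) (grad1 p.f) :=
    LipschitzWith.of_dist_le' fun z z' => by
      rw [dist_eq_norm, dist_eq_norm]
      exact hb.norm_grad1_f_sub_le z z'
  exact this.continuous

theorem continuous_meanDir (hb : p.Base c μ) : Continuous (meanDir p) := by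
  have hz : Continuous fun q : X × Y × Y => pt q.1 q.2.1 :=
    continuous_pt.comp (continuous_fst.prodMk (continuous_fst.comp continuous_snd))
  exact (((continuous_grad1_f hb).comp hz).sub (((continuous_hess12_g hb).comp hz).clm_apply
    (continuous_snd.comp continuous_snd))).norm

theorem meanDir_sq_le (hb : p.Base c μ) (q : X × Y × Y) :
    meanDir p q ^ 2 ≤ 2 * c.Cf0 ^ 2 + 2 * c.Lg1 ^ 2 * ‖q.2.2‖ ^ 2 := by
  refine (norm_sub_sq_le_two_mul _ _).trans ?_
  have h1 := pow_le_pow_left₀ (norm_nonneg _) (hb.bound_grad1_f (pt q.1 q.2.1)) 2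
  have h2 := pow_le_pow_left₀ (norm_nonneg _)
    (hb.norm_hess12_apply_le (pt q.1 q.2.1) q.2.2) 2
  rw [mul_pow] at h2
  linarith

theorem norm_u_sq_le (hb : p.Base c μ) (hμ : 0 < μ) (q : X × Y × Y) :
    ‖q.2.2‖ ^ 2 ≤ 2 * devU p q ^ 2 + 2 * (c.Lf0 / μ) ^ 2 := by
  have h := norm_add_sq_le_two_mul (q.2.2 - uStar p.f p.g q.1) (uStar p.f p.g q.1)
  rw [sub_add_cancel] at h
  have h1 := pow_le_pow_left₀ (norm_nonneg _) (hb.norm_uStar_le hμ q.1) 2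
  unfold devU
  linarith

end Deviations

theorem measurable_pt_fst {X Y N : Type*} [NormedAddCommGroup X] [InnerProductSpace ℝ X]
    [FiniteDimensional ℝ X] [NormedAddCommGroup Y] [InnerProductSpace ℝ Y]
    [FiniteDimensional ℝ Y] [MeasurableSpace X] [MeasurableSpace Y] [BorelSpace X]
    [BorelSpace Y] [MeasurableSpace N] :
    Measurable fun q : (X × Y × Y) × N => pt q.1.1 q.1.2.1 := by
  have hq : Measurable fun q : (X × Y × Y) × N => (q.1.1, q.1.2.1) := by fun_prop
  exact continuous_pt.measurable.comp hq

/-! ### Recursions for the expected errors. -/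

section Step

variable {X Y : Type*} [NormedAddCommGroup X] [InnerProductSpace ℝ X] [FiniteDimensional ℝ X]
  [NormedAddCommGroup Y] [InnerProductSpace ℝ Y] [FiniteDimensional ℝ Y]
  [MeasurableSpace X] [MeasurableSpace Y] [BorelSpace X] [BorelSpace Y]
  {Ξ Z Ω : Type*} [MeasurableSpace Ξ] [MeasurableSpace Z] [MeasurableSpace Ω]
  {p : Problem X Y Ξ Z} {P : Measure Ω} (R : Randomness p P)

namespace Randomness

section

variable (ho : p.Oracles) (B : BatchSizes) (k : ℕ)

include ho

theorem measurable_dirX_noise : Measurable fun q : (X × Y × Y) × ((ℕ → Ξ) × (GBatch → ℕ → Z)) =>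
    dirX p B k q.2.1 q.2.2 (pt q.1.1 q.1.2.1) q.1.2.2 := by
  have h := measurable_dirX B k (ξ := fun i (q : (X × Y × Y) × ((ℕ → Ξ) × (GBatch → ℕ → Z))) => q.2.1 i)
    (ζ := fun g i q => q.2.2 g i) (u := fun q => q.1.2.2) ho measurable_pt_fst (by fun_prop)
    (fun i => by fun_prop) (fun i => by fun_prop)
  exact h

theorem measurable_dirY_noise : Measurable fun q : (X × Y × Y) × ((ℕ → Ξ) × (GBatch → ℕ → Z)) =>
    dirY p B k q.2.2 (pt q.1.1 q.1.2.1) := by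
  have h := measurable_dirY B k (ζ := fun g i (q : (X × Y × Y) × ((ℕ → Ξ) × (GBatch → ℕ → Z))) => q.2.2 g i) ho measurable_pt_fst
    (fun i => by fun_prop)
  exact h

theorem measurable_dirU_noise : Measurable fun q : (X × Y × Y) × ((ℕ → Ξ) × (GBatch → ℕ → Z)) =>
    dirU p B k q.2.1 q.2.2 (pt q.1.1 q.1.2.1) q.1.2.2 := by
  have h := measurable_dirU B k (ξ := fun i (q : (X × Y × Y) × ((ℕ → Ξ) × (GBatch → ℕ → Z))) => q.2.1 i)
    (ζ := fun g i q => q.2.2 g i) (u := fun q => q.1.2.2) ho measurable_pt_fst (by fun_prop)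
    (fun i => by fun_prop) (fun i => by fun_prop)
  exact h

theorem measurable_innerLoop_noise (γ : ℝ) {D : (X × Y × Y) × ((ℕ → Ξ) × (GBatch → ℕ → Z)) → Y} (hD : Measurable D) (t : ℕ) :
    Measurable fun q : (X × Y × Y) × ((ℕ → Ξ) × (GBatch → ℕ → Z)) => innerLoop p B k γ q.2.2 (pt q.1.1 q.1.2.1) (D q) t := by
  have h := measurable_innerLoop B k (ζ := fun g i (q : (X × Y × Y) × ((ℕ → Ξ) × (GBatch → ℕ → Z))) => q.2.2 g i) (D := D) γ ho
    measurable_pt_fst hD t (fun s _ i => by fun_prop)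
  exact h

end

variable [IsProbabilityMeasure P] {c : Constants} {μ α γ ρ : ℝ} {B : BatchSizes} {k T : ℕ}
  (ho : p.Oracles) (hv : p.BoundedVariance c) (hb : p.Base c μ) (hμ : 0 < μ) (hμL : μ ≤ c.Lg1)
  (hγ : 0 < γ) (hγL : γ * c.Lg1 ≤ 1) (hρ : 0 ≤ ρ) (hρ1 : ρ ≤ 1)
  (hB : B.Adequate c μ γ ρ T k)
  (hY : Integrable (fun ω => devY p (R.point B α γ T k ω) ^ 2) P)
  (hU : Integrable (fun ω => devU p (R.point B α γ T k ω) ^ 2) P)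

include ho hb hμ hU

theorem integrable_u_sq : Integrable (fun ω => ‖(R.point B α γ T k ω).2.2‖ ^ 2) P ∧
    ∫ ω, ‖(R.point B α γ T k ω).2.2‖ ^ 2 ∂P
      ≤ 2 * ∫ ω, devU p (R.point B α γ T k ω) ^ 2 ∂P + 2 * (c.Lf0 / μ) ^ 2 := by
  have hi : Integrable (fun ω => 2 * devU p (R.point B α γ T k ω) ^ 2
      + 2 * (c.Lf0 / μ) ^ 2) P := (hU.const_mul 2).add (integrable_const _)
  have hm : Measurable fun ω => (R.point B α γ T k ω).2.2 :=
    measurable_snd.comp (measurable_snd.comp (R.measurable_point ho B α γ T k))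
  have hint : Integrable (fun ω => ‖(R.point B α γ T k ω).2.2‖ ^ 2) P := by
    refine hi.mono' (hm.norm.pow_const 2).aestronglyMeasurable
      (Filter.Eventually.of_forall fun ω => ?_)
    rw [Real.norm_of_nonneg (sq_nonneg _)]
    exact norm_u_sq_le hb hμ _
  refine ⟨hint, (integral_mono hint hi fun ω => norm_u_sq_le hb hμ _).trans (le_of_eq ?_)⟩
  rw [integral_add (hU.const_mul 2) (integrable_const _), integral_const_mul, integral_const,
    probReal_univ, one_smul]

theorem integrable_meanDir_sq : Integrable (fun ω => meanDir p (R.point B α γ T k ω) ^ 2) P ∧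
    ∫ ω, meanDir p (R.point B α γ T k ω) ^ 2 ∂P
      ≤ 2 * c.Cf0 ^ 2 + 2 * c.Lg1 ^ 2 * ∫ ω, ‖(R.point B α γ T k ω).2.2‖ ^ 2 ∂P := by
  have hu := (R.integrable_u_sq ho hb hμ hU).1
  have hi : Integrable (fun ω => 2 * c.Cf0 ^ 2
      + 2 * c.Lg1 ^ 2 * ‖(R.point B α γ T k ω).2.2‖ ^ 2) P :=
    (integrable_const _).add (hu.const_mul _)
  have hm : Measurable fun ω => meanDir p (R.point B α γ T k ω) :=
    (continuous_meanDir hb).measurable.comp (R.measurable_point ho B α γ T k)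
  have hint : Integrable (fun ω => meanDir p (R.point B α γ T k ω) ^ 2) P := by
    refine hi.mono' (hm.pow_const 2).aestronglyMeasurable
      (Filter.Eventually.of_forall fun ω => ?_)
    rw [Real.norm_of_nonneg (sq_nonneg _)]
    exact meanDir_sq_le hb _
  refine ⟨hint, (integral_mono hint hi fun ω => meanDir_sq_le hb _).trans (le_of_eq ?_)⟩
  rw [integral_add (integrable_const _) (hu.const_mul _), integral_const, probReal_univ, one_smul,
    integral_const_mul]

include hv hB

theorem dirX_sq :
    Integrable (fun ω => ‖dirX p B k (R.noise k ω).1 (R.noise k ω).2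
      (pt (R.point B α γ T k ω).1 (R.point B α γ T k ω).2.1) (R.point B α γ T k ω).2.2‖ ^ 2) P ∧
    ∫ ω, ‖dirX p B k (R.noise k ω).1 (R.noise k ω).2
      (pt (R.point B α γ T k ω).1 (R.point B α γ T k ω).2.1) (R.point B α γ T k ω).2.2‖ ^ 2 ∂P
      ≤ ∫ ω, meanDir p (R.point B α γ T k ω) ^ 2 ∂P + (2 * (c.σf1 ^ 2 / B.b3 k)
        + 2 * (c.σg2 ^ 2 * (∫ ω, ‖(R.point B α γ T k ω).2.2‖ ^ 2 ∂P) / B.b4 k)) := by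
  have hu := (R.integrable_u_sq ho hb hμ hU).1
  have hd := (R.integrable_meanDir_sq ho hb hμ hU).1
  have hh : Measurable fun q : (X × Y × Y) × ((ℕ → Ξ) × (GBatch → ℕ → Z)) =>
      dirX p B k q.2.1 q.2.2 (pt q.1.1 q.1.2.1) q.1.2.2 :=
    measurable_dirX_noise ho B k
  have hd2 : Measurable (meanDir p) := (continuous_meanDir hb).measurable
  have key := integrable_integral_le_of_decouple (R.measurable_point ho B α γ T k)
    (R.measurable_noise k) (R.indepFun_point_noise ho B α γ T k) (hh.norm.pow_const 2)
    (fun q => sq_nonneg _) (B := fun q => meanDir p q ^ 2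
      + (2 * (c.σf1 ^ 2 / B.b3 k) + 2 * (c.σg2 ^ 2 * ‖q.2.2‖ ^ 2 / B.b4 k))) (by fun_prop)
    (fun q => (R.fixed_x_sq ho hv hB q.1 q.2.1 q.2.2).2.2) ?_
  · refine ⟨key.1, key.2.trans (le_of_eq ?_)⟩
    have h1 : Integrable (fun ω => 2 * (c.σg2 ^ 2 * ‖(R.point B α γ T k ω).2.2‖ ^ 2
        / B.b4 k)) P := ((hu.const_mul _).div_const _).const_mul 2
    have h2 : Integrable (fun ω => 2 * (c.σf1 ^ 2 / B.b3 k)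
        + 2 * (c.σg2 ^ 2 * ‖(R.point B α γ T k ω).2.2‖ ^ 2 / B.b4 k)) P :=
      (integrable_const _).add h1
    rw [integral_add hd h2, integral_add (integrable_const _) h1, integral_const, probReal_univ,
      one_smul, integral_const_mul, integral_div, integral_const_mul]
  · exact hd.add ((integrable_const _).add (((hu.const_mul _).div_const _).const_mul 2))

omit hv hB hU in
theorem point_succ_x (ω : Ω) : (R.point B α γ T (k + 1) ω).1 = (R.point B α γ T k ω).1
    - α • dirX p B k (R.noise k ω).1 (R.noise k ω).2
      (pt (R.point B α γ T k ω).1 (R.point B α γ T k ω).2.1) (R.point B α γ T k ω).2.2 := rfl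

omit hv hB hU in
theorem point_succ_y (ω : Ω) : (R.point B α γ T (k + 1) ω).2.1 = (R.point B α γ T k ω).2.1
    - innerLoop p B k γ (R.noise k ω).2
      (pt (R.point B α γ T k ω).1 (R.point B α γ T k ω).2.1)
      (dirY p B k (R.noise k ω).2 (pt (R.point B α γ T k ω).1 (R.point B α γ T k ω).2.1))
      (T + 1) := by
  change (R.state B α γ T (k + 1) ω).y = _
  rw [R.state_succ, step_y]
  rfl

omit hv hB hU in
theorem point_succ_u (ω : Ω) : (R.point B α γ T (k + 1) ω).2.2 = (R.point B α γ T k ω).2.2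
    - innerLoop p B k γ (R.noise k ω).2
      (pt (R.point B α γ T k ω).1 (R.point B α γ T k ω).2.1)
      (dirU p B k (R.noise k ω).1 (R.noise k ω).2
        (pt (R.point B α γ T k ω).1 (R.point B α γ T k ω).2.1) (R.point B α γ T k ω).2.2)
      (T + 1) := by
  change (R.state B α γ T (k + 1) ω).u = _
  rw [R.state_succ, step_u]
  rfl

theorem displacement_sq :
    Integrable (fun ω => ‖(R.point B α γ T (k + 1) ω).1 - (R.point B α γ T k ω).1‖ ^ 2) P ∧
    ∫ ω, ‖(R.point B α γ T (k + 1) ω).1 - (R.point B α γ T k ω).1‖ ^ 2 ∂P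
      ≤ α ^ 2 * (∫ ω, meanDir p (R.point B α γ T k ω) ^ 2 ∂P + (2 * (c.σf1 ^ 2 / B.b3 k)
        + 2 * (c.σg2 ^ 2 * (∫ ω, ‖(R.point B α γ T k ω).2.2‖ ^ 2 ∂P) / B.b4 k))) := by
  obtain ⟨h1, h2⟩ := R.dirX_sq ho hv hb hμ hB hU
  have e : ∀ ω, ‖(R.point B α γ T (k + 1) ω).1 - (R.point B α γ T k ω).1‖ ^ 2
      = α ^ 2 * ‖dirX p B k (R.noise k ω).1 (R.noise k ω).2
        (pt (R.point B α γ T k ω).1 (R.point B α γ T k ω).2.1)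
        (R.point B α γ T k ω).2.2‖ ^ 2 := by
    intro ω
    rw [R.point_succ_x ho hb hμ, sub_sub_cancel_left, norm_neg, norm_smul, mul_pow,
      Real.norm_eq_abs, sq_abs]
  simp only [e]
  refine ⟨h1.const_mul _, ?_⟩
  rw [integral_const_mul]
  exact mul_le_mul_of_nonneg_left h2 (sq_nonneg α)

theorem integrable_displacement :
    Integrable (fun ω => ‖(R.point B α γ T (k + 1) ω).1 - (R.point B α γ T k ω).1‖) P := by
  have h1 := (R.displacement_sq ho hv hb hμ hB hU).1
  have hm : Measurable fun ω => (R.point B α γ T (k + 1) ω).1 - (R.point B α γ T k ω).1 :=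
    (measurable_fst.comp (R.measurable_point ho B α γ T (k + 1))).sub
      (measurable_fst.comp (R.measurable_point ho B α γ T k))
  exact (integrable_of_norm_sq hm.aestronglyMeasurable h1).norm

/-- Integrability of `Φ` at the new point follows from the Lipschitz bound and the integrable
displacement; the pointwise descent estimate is then integrated by decoupling. -/
theorem Phi_succ (hα : 0 ≤ α) (hαL : α * (c.L1 μ * (1 + c.Lg1 / μ) ^ 2) ≤ 1 / 4)
    (hY : Integrable (fun ω => devY p (R.point B α γ T k ω) ^ 2) P)
    (hΦ : Integrable (fun ω => Phi p.f p.g (R.point B α γ T k ω).1) P) :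
    Integrable (fun ω => Phi p.f p.g (R.point B α γ T (k + 1) ω).1) P ∧
    Integrable (fun ω => ‖gradient (Phi p.f p.g) (R.point B α γ T k ω).1‖ ^ 2) P ∧
    ∫ ω, Phi p.f p.g (R.point B α γ T (k + 1) ω).1 ∂P
      ≤ ∫ ω, Phi p.f p.g (R.point B α γ T k ω).1 ∂P
        - α / 2 * ∫ ω, ‖gradient (Phi p.f p.g) (R.point B α γ T k ω).1‖ ^ 2 ∂P
        - α / 4 * ∫ ω, meanDir p (R.point B α γ T k ω) ^ 2 ∂P
        + α * (c.L1 μ ^ 2 * ∫ ω, devY p (R.point B α γ T k ω) ^ 2 ∂P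
          + c.Lg1 ^ 2 * ∫ ω, devU p (R.point B α γ T k ω) ^ 2 ∂P)
        + α / 4 * (2 * (c.σf1 ^ 2 / B.b3 k)
          + 2 * (c.σg2 ^ 2 * (∫ ω, ‖(R.point B α γ T k ω).2.2‖ ^ 2 ∂P) / B.b4 k)) := by
  have hu := (R.integrable_u_sq ho hb hμ hU).1
  have hd := (R.integrable_meanDir_sq ho hb hμ hU).1
  have hcΦ : Continuous (Phi p.f p.g) := (hb.differentiable_Phi hμ).continuous
  have hcG := hb.continuous_gradient_Phi hμ
  have hmx : ∀ k, Measurable fun ω => (R.point B α γ T k ω).1 := fun k =>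
    measurable_fst.comp (R.measurable_point ho B α γ T k)
  have hG : Integrable (fun ω => ‖gradient (Phi p.f p.g) (R.point B α γ T k ω).1‖ ^ 2) P := by
    refine (integrable_const ((c.Cf0 + c.Lg1 * (c.Lf0 / μ)) ^ 2)).mono'
      (((hcG.measurable.comp (hmx k)).norm).pow_const 2).aestronglyMeasurable
      (Filter.Eventually.of_forall fun ω => ?_)
    rw [Real.norm_of_nonneg (sq_nonneg _)]
    exact pow_le_pow_left₀ (norm_nonneg _) (hb.norm_gradient_Phi_le hμ _) 2
  have hΦ' : Integrable (fun ω => Phi p.f p.g (R.point B α γ T (k + 1) ω).1) P := by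
    have hdiff : Integrable (fun ω => Phi p.f p.g (R.point B α γ T (k + 1) ω).1
        - Phi p.f p.g (R.point B α γ T k ω).1) P := by
      refine ((R.integrable_displacement ho hv hb hμ hB hU).const_mul
        (c.Cf0 + c.Lg1 * (c.Lf0 / μ))).mono'
        ((hcΦ.measurable.comp (hmx (k + 1))).sub
          (hcΦ.measurable.comp (hmx k))).aestronglyMeasurable
        (Filter.Eventually.of_forall fun ω => hb.abs_Phi_sub_le hμ _ _)
    have : Integrable (fun ω => Phi p.f p.g (R.point B α γ T (k + 1) ω).1
        - Phi p.f p.g (R.point B α γ T k ω).1 + Phi p.f p.g (R.point B α γ T k ω).1) P :=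
      hdiff.add hΦ
    simpa only [sub_add_cancel] using this
  refine ⟨hΦ', hG, ?_⟩
  have hh : Measurable fun q : (X × Y × Y) × ((ℕ → Ξ) × (GBatch → ℕ → Z)) =>
      dirX p B k q.2.1 q.2.2 (pt q.1.1 q.1.2.1) q.1.2.2 :=
    measurable_dirX_noise ho B k
  have hh2 : Measurable fun q : (X × Y × Y) × ((ℕ → Ξ) × (GBatch → ℕ → Z)) =>
      Phi p.f p.g (q.1.1 - α • dirX p B k q.2.1 q.2.2 (pt q.1.1 q.1.2.1) q.1.2.2) :=
    hcΦ.measurable.comp ((measurable_fst.comp measurable_fst).sub (hh.const_smul α))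
  have hd2 : Measurable (meanDir p) := (continuous_meanDir hb).measurable
  have hy2 : Measurable (devY p) := (continuous_devY hb hμ).measurable
  have hu2 : Measurable (devU p) := (continuous_devU hb hμ).measurable
  have hm1 : Measurable (Phi p.f p.g) := hcΦ.measurable
  have hm2 : Measurable (gradient (Phi p.f p.g)) := hcG.measurable
  have i1 : Integrable (fun ω => Phi p.f p.g (R.point B α γ T k ω).1
      - α / 2 * ‖gradient (Phi p.f p.g) (R.point B α γ T k ω).1‖ ^ 2) P :=
    hΦ.sub (hG.const_mul _)
  have i2 : Integrable (fun ω => Phi p.f p.g (R.point B α γ T k ω).1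
      - α / 2 * ‖gradient (Phi p.f p.g) (R.point B α γ T k ω).1‖ ^ 2
      - α / 4 * meanDir p (R.point B α γ T k ω) ^ 2) P := i1.sub (hd.const_mul _)
  have i3 : Integrable (fun ω => c.L1 μ ^ 2 * devY p (R.point B α γ T k ω) ^ 2
      + c.Lg1 ^ 2 * devU p (R.point B α γ T k ω) ^ 2) P := (hY.const_mul _).add (hU.const_mul _)
  have i4 : Integrable (fun ω => Phi p.f p.g (R.point B α γ T k ω).1
      - α / 2 * ‖gradient (Phi p.f p.g) (R.point B α γ T k ω).1‖ ^ 2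
      - α / 4 * meanDir p (R.point B α γ T k ω) ^ 2
      + α * (c.L1 μ ^ 2 * devY p (R.point B α γ T k ω) ^ 2
      + c.Lg1 ^ 2 * devU p (R.point B α γ T k ω) ^ 2)) P := i2.add (i3.const_mul _)
  have i5 : Integrable (fun ω => 2 * (c.σg2 ^ 2 * ‖(R.point B α γ T k ω).2.2‖ ^ 2
        / B.b4 k)) P := ((hu.const_mul _).div_const _).const_mul 2
  have i6 : Integrable (fun ω => 2 * (c.σf1 ^ 2 / B.b3 k)
        + 2 * (c.σg2 ^ 2 * ‖(R.point B α γ T k ω).2.2‖ ^ 2 / B.b4 k)) P :=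
      (integrable_const _).add i5
  have key := integral_le_of_decouple (R.measurable_point ho B α γ T k)
    (R.measurable_noise k) (R.indepFun_point_noise ho B α γ T k) hh2
    (B := fun q => Phi p.f p.g q.1 - α / 2 * ‖gradient (Phi p.f p.g) q.1‖ ^ 2
        - α / 4 * meanDir p q ^ 2
        + α * (c.L1 μ ^ 2 * devY p q ^ 2 + c.Lg1 ^ 2 * devU p q ^ 2)
        + α / 4 * (2 * (c.σf1 ^ 2 / B.b3 k) + 2 * (c.σg2 ^ 2 * ‖q.2.2‖ ^ 2 / B.b4 k)))
    (by fun_prop) hΦ' (fun q => R.fixed_Phi ho hv hb hμ hB q.1 q.2.1 q.2.2 hα hαL)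
    (i4.add (i6.const_mul _))
  refine key.trans (le_of_eq ?_)
  rw [integral_add i4 (i6.const_mul _), integral_add i2 (i3.const_mul _),
    integral_sub i1 (hd.const_mul _), integral_sub hΦ (hG.const_mul _), integral_const_mul,
    integral_const_mul, integral_const_mul, integral_const_mul,
    integral_add (hY.const_mul _) (hU.const_mul _), integral_const_mul, integral_const_mul,
    integral_add (integrable_const _) i5, integral_const, probReal_univ, one_smul,
    integral_const_mul, integral_div, integral_const_mul]

include hμL hγ hγL hρ hρ1 hY

/-- The reference is still `y*` at the old `x`; its displacement is added in `devY_succ`. -/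
theorem y_succ {η : ℝ} (hη : 0 ≤ η) (hη2 : 2 * (c.σg1 ^ 2 / B.b2 k) / μ ^ 2 ≤ η ^ 2) :
    Integrable (fun ω => ‖(R.point B α γ T (k + 1) ω).2.1
      - yStar p.g (R.point B α γ T k ω).1‖ ^ 2) P ∧
    ∫ ω, ‖(R.point B α γ T (k + 1) ω).2.1 - yStar p.g (R.point B α γ T k ω).1‖ ∂P
      ≤ (1 + ρ) * (c.Lg2 / μ) * ∫ ω, devY p (R.point B α γ T k ω) ^ 2 ∂P
        + ρ * ∫ ω, devY p (R.point B α γ T k ω) ∂P + η := by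
  have hdy : Measurable fun q : (X × Y × Y) × ((ℕ → Ξ) × (GBatch → ℕ → Z)) =>
      dirY p B k q.2.2 (pt q.1.1 q.1.2.1) :=
    measurable_dirY_noise ho B k
  have hin : Measurable fun q : (X × Y × Y) × ((ℕ → Ξ) × (GBatch → ℕ → Z)) =>
      innerLoop p B k γ q.2.2 (pt q.1.1 q.1.2.1) (dirY p B k q.2.2 (pt q.1.1 q.1.2.1)) (T + 1) :=
    measurable_innerLoop_noise ho B k γ hdy (T + 1)
  have hys : Measurable (yStar p.g) := (hb.continuous_yStar hμ).measurable
  have hdiff : Measurable fun q : (X × Y × Y) × ((ℕ → Ξ) × (GBatch → ℕ → Z)) =>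
      q.1.2.1 - innerLoop p B k γ q.2.2 (pt q.1.1 q.1.2.1)
        (dirY p B k q.2.2 (pt q.1.1 q.1.2.1)) (T + 1) - yStar p.g q.1.1 := by
    refine (Measurable.sub (by fun_prop) hin).sub (by fun_prop)
  have hdm : Measurable (devY p) := (continuous_devY hb hμ).measurable
  have hY1 : Integrable (fun ω => devY p (R.point B α γ T k ω)) P :=
    ((memLp_two_iff_integrable_sq
      (hdm.comp (R.measurable_point ho B α γ T k)).aestronglyMeasurable).mpr hY).integrable
      one_le_two
  have key1 := integrable_integral_le_of_decouple (R.measurable_point ho B α γ T k)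
    (R.measurable_noise k) (R.indepFun_point_noise ho B α γ T k) (hdiff.norm.pow_const 2)
    (fun q => sq_nonneg _)
    (B := fun q => (2 * (1 + c.Lg1 / μ) ^ 2 + 2 * ρ ^ 2 * (c.Lg1 / μ) ^ 2) * devY p q ^ 2
        + 4 * (c.σg1 ^ 2 / B.b2 k) / μ ^ 2) (by fun_prop)
    (fun q => R.fixed_y_sq ho hv hb hμ hμL hγ hγL hρ hρ1 hB q.1 q.2.1)
    ((hY.const_mul _).add (integrable_const _))
  have hsq : Integrable (fun ω => ‖(R.point B α γ T (k + 1) ω).2.1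
      - yStar p.g (R.point B α γ T k ω).1‖ ^ 2) P := by
    simp only [R.point_succ_y ho hb hμ]
    exact key1.1
  refine ⟨hsq, ?_⟩
  have hms : Measurable fun ω => (R.point B α γ T (k + 1) ω).2.1
      - yStar p.g (R.point B α γ T k ω).1 :=
    (measurable_fst.comp (measurable_snd.comp (R.measurable_point ho B α γ T (k + 1)))).sub
      (hys.comp (measurable_fst.comp (R.measurable_point ho B α γ T k)))
  have h1 := (integrable_of_norm_sq hms.aestronglyMeasurable hsq).norm
  have i1 : Integrable (fun ω => (1 + ρ) * (c.Lg2 / μ) * devY p (R.point B α γ T k ω) ^ 2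
      + ρ * devY p (R.point B α γ T k ω)) P := (hY.const_mul _).add (hY1.const_mul _)
  have key2 := integral_le_of_decouple (R.measurable_point ho B α γ T k)
    (R.measurable_noise k) (R.indepFun_point_noise ho B α γ T k) hdiff.norm
    (B := fun q => (1 + ρ) * (c.Lg2 / μ) * devY p q ^ 2 + ρ * devY p q + η) (by fun_prop)
    (by simp only [R.point_succ_y ho hb hμ] at h1; exact h1)
    (fun q => R.fixed_y ho hv hb hμ hμL hγ hγL hρ hρ1 hB q.1 q.2.1 hη hη2)
    (i1.add (integrable_const _))
  rw [integral_add i1 (integrable_const _), integral_add (hY.const_mul _) (hY1.const_mul _),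
    integral_const, probReal_univ, one_smul, integral_const_mul, integral_const_mul] at key2
  simp only [R.point_succ_y ho hb hμ]
  exact key2

theorem u_succ :
    Integrable (fun ω => ‖(R.point B α γ T (k + 1) ω).2.2
      - uStar p.f p.g (R.point B α γ T k ω).1‖ ^ 2) P ∧
    ∫ ω, ‖(R.point B α γ T (k + 1) ω).2.2 - uStar p.f p.g (R.point B α γ T k ω).1‖ ^ 2 ∂P
      ≤ (2 + 4 * ρ ^ 2) * (c.L1 μ / μ) ^ 2 * ∫ ω, devY p (R.point B α γ T k ω) ^ 2 ∂P
        + 4 * ρ ^ 2 * ∫ ω, devU p (R.point B α γ T k ω) ^ 2 ∂P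
        + 8 * (c.σg2 ^ 2 * (∫ ω, ‖(R.point B α γ T k ω).2.2‖ ^ 2 ∂P) / B.b1 k
          + c.σf1 ^ 2 / B.b3 k) / μ ^ 2 := by
  have hu := (R.integrable_u_sq ho hb hμ hU).1
  have hdu : Measurable fun q : (X × Y × Y) × ((ℕ → Ξ) × (GBatch → ℕ → Z)) =>
      dirU p B k q.2.1 q.2.2 (pt q.1.1 q.1.2.1) q.1.2.2 :=
    measurable_dirU_noise ho B k
  have hin : Measurable fun q : (X × Y × Y) × ((ℕ → Ξ) × (GBatch → ℕ → Z)) =>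
      innerLoop p B k γ q.2.2 (pt q.1.1 q.1.2.1)
        (dirU p B k q.2.1 q.2.2 (pt q.1.1 q.1.2.1) q.1.2.2) (T + 1) :=
    measurable_innerLoop_noise ho B k γ hdu (T + 1)
  have hus : Measurable (uStar p.f p.g) := (hb.continuous_uStar hμ).measurable
  have hdiff : Measurable fun q : (X × Y × Y) × ((ℕ → Ξ) × (GBatch → ℕ → Z)) =>
      q.1.2.2 - innerLoop p B k γ q.2.2 (pt q.1.1 q.1.2.1)
        (dirU p B k q.2.1 q.2.2 (pt q.1.1 q.1.2.1) q.1.2.2) (T + 1) - uStar p.f p.g q.1.1 := by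
    refine (Measurable.sub (by fun_prop) hin).sub (by fun_prop)
  have hdm : Measurable (devY p) := (continuous_devY hb hμ).measurable
  have hdm' : Measurable (devU p) := (continuous_devU hb hμ).measurable
  have i1 : Integrable (fun ω => (2 + 4 * ρ ^ 2) * (c.L1 μ / μ) ^ 2
      * devY p (R.point B α γ T k ω) ^ 2 + 4 * ρ ^ 2 * devU p (R.point B α γ T k ω) ^ 2) P :=
    (hY.const_mul _).add (hU.const_mul _)
  have i2 : Integrable (fun ω => c.σg2 ^ 2 * ‖(R.point B α γ T k ω).2.2‖ ^ 2 / B.b1 k) P :=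
    (hu.const_mul _).div_const _
  have i3 : Integrable (fun ω => 8 * (c.σg2 ^ 2 * ‖(R.point B α γ T k ω).2.2‖ ^ 2 / B.b1 k
      + c.σf1 ^ 2 / B.b3 k) / μ ^ 2) P :=
    ((i2.add (integrable_const _)).const_mul 8).div_const _
  have key1 := integrable_integral_le_of_decouple (R.measurable_point ho B α γ T k)
    (R.measurable_noise k) (R.indepFun_point_noise ho B α γ T k) (hdiff.norm.pow_const 2)
    (fun q => sq_nonneg _)
    (B := fun q => (2 + 4 * ρ ^ 2) * (c.L1 μ / μ) ^ 2 * devY p q ^ 2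
        + 4 * ρ ^ 2 * devU p q ^ 2
        + 8 * (c.σg2 ^ 2 * ‖q.2.2‖ ^ 2 / B.b1 k + c.σf1 ^ 2 / B.b3 k) / μ ^ 2) (by fun_prop)
    (fun q => R.fixed_u_sq ho hv hb hμ hμL hγ hγL hρ hρ1 hB q.1 q.2.1 q.2.2)
    (i1.add i3)
  rw [integral_add i1 i3, integral_add (hY.const_mul _) (hU.const_mul _),
    integral_const_mul, integral_const_mul, integral_div, integral_const_mul,
    integral_add i2 (integrable_const _), integral_const, probReal_univ, one_smul, integral_div,
    integral_const_mul] at key1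
  simp only [R.point_succ_u ho hb hμ]
  exact key1

/-- First moment bound for the lower-level error after one outer iteration. -/
theorem devY_succ {η S : ℝ} (hη : 0 ≤ η) (hη2 : 2 * (c.σg1 ^ 2 / B.b2 k) / μ ^ 2 ≤ η ^ 2)
    (hS : 0 ≤ S)
    (hS2 : ∫ ω, ‖(R.point B α γ T (k + 1) ω).1 - (R.point B α γ T k ω).1‖ ^ 2 ∂P ≤ S ^ 2) :
    Integrable (fun ω => devY p (R.point B α γ T (k + 1) ω) ^ 2) P ∧
    ∫ ω, devY p (R.point B α γ T (k + 1) ω) ∂P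
      ≤ (1 + ρ) * (c.Lg2 / μ) * ∫ ω, devY p (R.point B α γ T k ω) ^ 2 ∂P
        + ρ * ∫ ω, devY p (R.point B α γ T k ω) ∂P + η + c.Lg1 / μ * S := by
  obtain ⟨h1, h2⟩ := R.y_succ ho hv hb hμ hμL hγ hγL hρ hρ1 hB hY hU hη hη2
  have hK : 0 ≤ c.Lg1 / μ := by have := c.Lg1_pos; positivity
  have h3 := (R.displacement_sq ho hv hb hμ hB hU).1
  have h3' := R.integrable_displacement ho hv hb hμ hB hU
  have hm := R.measurable_point ho B α γ T
  have hys : Measurable (yStar p.g) := (hb.continuous_yStar hμ).measurable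
  have hdm : Measurable (devY p) := (continuous_devY hb hμ).measurable
  have hms : Measurable fun ω => (R.point B α γ T (k + 1) ω).2.1
      - yStar p.g (R.point B α γ T k ω).1 :=
    (measurable_fst.comp (measurable_snd.comp (hm (k + 1)))).sub
      (hys.comp (measurable_fst.comp (hm k)))
  have h1' := (integrable_of_norm_sq hms.aestronglyMeasurable h1).norm
  have hle : ∀ ω, devY p (R.point B α γ T (k + 1) ω)
      ≤ ‖(R.point B α γ T (k + 1) ω).2.1 - yStar p.g (R.point B α γ T k ω).1‖
        + c.Lg1 / μ * ‖(R.point B α γ T (k + 1) ω).1 - (R.point B α γ T k ω).1‖ := by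
    intro ω
    have e : (R.point B α γ T (k + 1) ω).2.1 - yStar p.g (R.point B α γ T (k + 1) ω).1
        = ((R.point B α γ T (k + 1) ω).2.1 - yStar p.g (R.point B α γ T k ω).1)
          - (yStar p.g (R.point B α γ T (k + 1) ω).1 - yStar p.g (R.point B α γ T k ω).1) := by
      abel
    rw [devY, e]
    exact (norm_sub_le _ _).trans (add_le_add le_rfl (hb.norm_yStar_sub_le hμ _ _))
  have hm1 : Measurable fun ω => devY p (R.point B α γ T (k + 1) ω) := hdm.comp (hm _)
  have hsq : Integrable (fun ω => devY p (R.point B α γ T (k + 1) ω) ^ 2) P := by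
    refine ((h1.const_mul 2).add (h3.const_mul (2 * (c.Lg1 / μ) ^ 2))).mono'
      (hm1.pow_const 2).aestronglyMeasurable (Filter.Eventually.of_forall fun ω => ?_)
    rw [Real.norm_of_nonneg (sq_nonneg _)]
    have h4 := pow_le_pow_left₀ (devY_nonneg _) (hle ω) 2
    simp only [Pi.add_apply]
    refine h4.trans ?_
    nlinarith [sq_nonneg (‖(R.point B α γ T (k + 1) ω).2.1 - yStar p.g (R.point B α γ T k ω).1‖
      - c.Lg1 / μ * ‖(R.point B α γ T (k + 1) ω).1 - (R.point B α γ T k ω).1‖)]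
  refine ⟨hsq, ?_⟩
  have hi : Integrable (fun ω =>
      ‖(R.point B α γ T (k + 1) ω).2.1 - yStar p.g (R.point B α γ T k ω).1‖
        + c.Lg1 / μ * ‖(R.point B α γ T (k + 1) ω).1 - (R.point B α γ T k ω).1‖) P :=
    h1'.add (h3'.const_mul _)
  have h5 := integral_mono_of_nonneg (Filter.Eventually.of_forall fun ω => devY_nonneg _) hi
    (Filter.Eventually.of_forall hle)
  rw [integral_add h1' (h3'.const_mul _), integral_const_mul] at h5
  have h6 : ∫ ω, ‖(R.point B α γ T (k + 1) ω).1 - (R.point B α γ T k ω).1‖ ∂P ≤ S := by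
    refine (pow_le_pow_iff_left₀ (integral_nonneg fun ω => norm_nonneg _) hS
      two_ne_zero).mp ?_
    exact (sq_integral_le_integral_sq h3'.aestronglyMeasurable h3).trans hS2
  have h7 := mul_le_mul_of_nonneg_left h6 hK
  linarith

/-- The error of `u` passes through a linear system, so squares can be split directly, without the
moment-ratio bound. The coefficient of the old error becomes `8ρ²`. -/
theorem devU_succ :
    Integrable (fun ω => devU p (R.point B α γ T (k + 1) ω) ^ 2) P ∧
    ∫ ω, devU p (R.point B α γ T (k + 1) ω) ^ 2 ∂P
      ≤ 2 * ((2 + 4 * ρ ^ 2) * (c.L1 μ / μ) ^ 2 * ∫ ω, devY p (R.point B α γ T k ω) ^ 2 ∂P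
        + 4 * ρ ^ 2 * ∫ ω, devU p (R.point B α γ T k ω) ^ 2 ∂P
        + 8 * (c.σg2 ^ 2 * (∫ ω, ‖(R.point B α γ T k ω).2.2‖ ^ 2 ∂P) / B.b1 k
          + c.σf1 ^ 2 / B.b3 k) / μ ^ 2)
        + 2 * (c.L1 μ / μ * (1 + c.Lg1 / μ)) ^ 2
          * ∫ ω, ‖(R.point B α γ T (k + 1) ω).1 - (R.point B α γ T k ω).1‖ ^ 2 ∂P := by
  obtain ⟨h1, h2⟩ := R.u_succ ho hv hb hμ hμL hγ hγL hρ hρ1 hB hY hU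
  have h3 := (R.displacement_sq ho hv hb hμ hB hU).1
  have hm := R.measurable_point ho B α γ T
  have hdm : Measurable (devU p) := (continuous_devU hb hμ).measurable
  have hle : ∀ ω, devU p (R.point B α γ T (k + 1) ω) ^ 2
      ≤ 2 * ‖(R.point B α γ T (k + 1) ω).2.2 - uStar p.f p.g (R.point B α γ T k ω).1‖ ^ 2
        + 2 * (c.L1 μ / μ * (1 + c.Lg1 / μ)) ^ 2
          * ‖(R.point B α γ T (k + 1) ω).1 - (R.point B α γ T k ω).1‖ ^ 2 := by
    intro ω
    have e : (R.point B α γ T (k + 1) ω).2.2 - uStar p.f p.g (R.point B α γ T (k + 1) ω).1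
        = ((R.point B α γ T (k + 1) ω).2.2 - uStar p.f p.g (R.point B α γ T k ω).1)
          - (uStar p.f p.g (R.point B α γ T (k + 1) ω).1
            - uStar p.f p.g (R.point B α γ T k ω).1) := by
      abel
    have h4 := pow_le_pow_left₀ (norm_nonneg _) (hb.norm_uStar_sub_le hμ
      (R.point B α γ T (k + 1) ω).1 (R.point B α γ T k ω).1) 2
    rw [devU, e]
    refine (norm_sub_sq_le_two_mul _ _).trans ?_
    rw [← mul_assoc, mul_pow] at h4
    linarith
  have hi : Integrable (fun ω =>
      2 * ‖(R.point B α γ T (k + 1) ω).2.2 - uStar p.f p.g (R.point B α γ T k ω).1‖ ^ 2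
        + 2 * (c.L1 μ / μ * (1 + c.Lg1 / μ)) ^ 2
          * ‖(R.point B α γ T (k + 1) ω).1 - (R.point B α γ T k ω).1‖ ^ 2) P :=
    (h1.const_mul 2).add (h3.const_mul _)
  have hsq : Integrable (fun ω => devU p (R.point B α γ T (k + 1) ω) ^ 2) P := by
    refine hi.mono' ((hdm.comp (hm _)).pow_const 2).aestronglyMeasurable
      (Filter.Eventually.of_forall fun ω => ?_)
    rw [Real.norm_of_nonneg (sq_nonneg _)]
    exact hle ω
  refine ⟨hsq, (integral_mono hsq hi hle).trans ?_⟩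
  rw [integral_add (h1.const_mul 2) (h3.const_mul _), integral_const_mul, integral_const_mul]
  linarith

end Randomness

end Step

/-! ### Constants -/

namespace Constants

variable (c : Constants)

/-- The numerator `max {L_{g,1}, L_{f,1}}` of the condition number. -/
def M : ℝ := max c.Lg1 c.Lf1

/-- A constant with `L₁ ≤ ℓ κ`. -/
def ell : ℝ := c.Lf1 + c.Lg2 * c.Lf0 / c.M

/-- The constant in the bound `κ⁴ E‖y - y*‖² ≤ c κ²` that defines the box. -/
def boxY : ℝ := c.M ^ 2 / (20 * c.r * c.Lg2 ^ 2)

/-- The constant in the bound of `E‖u‖²` by `κ²`, given the constant `Cb` for `E‖u - u*‖²`. -/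
def boundU (Cb : ℝ) : ℝ := 2 * Cb + 2 * (c.Lf0 / c.M) ^ 2

/-- The constant in the bound of `E‖Dₓ‖²` by `κ²`, given the constant `Cb` for `E‖u - u*‖²`. -/
def boundD (Cb : ℝ) : ℝ :=
  2 * c.Cf0 ^ 2 + 2 * c.Lg1 ^ 2 * c.boundU Cb + (2 * c.σf1 ^ 2 + 2 * c.σg2 ^ 2 * c.boundU Cb)

/-- The weight of `E‖u - u*‖²` in the potential. -/
def weightU : ℝ := 2 * (c.ell ^ 2 + c.Lg1 ^ 2)

/-- The weight of `κ⁴ E‖y - y*‖²` in the potential. -/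
def weightY : ℝ := c.weightU * (1 + 10 * (c.ell / c.M) ^ 2)

/-- The step size and batch size constants are compatible with the problem constants. -/
structure Tuned (γ cα cT cB Cb : ℝ) : Prop where
  cα_pos : 0 < cα
  cα_le_one : cα ≤ 1
  cT_pos : 0 < cT
  cB_pos : 0 < cB
  le_cT : 1600 * c.r ≤ γ * c.M * cT
  le_cB_inner : 3200 * c.r * (γ * c.σg2 ^ 2) ≤ c.M * cB
  le_cB_y : 32 * c.r * c.σg1 ^ 2 ≤ c.M ^ 2 * cB * c.boxY
  le_cB_u : 16 * c.σg2 ^ 2 * c.boundU Cb ≤ c.M ^ 2 * cB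
  cα_descent : cα * (16 * c.ell) ≤ 1
  cα_y : cα * (16 * c.r * c.boundD Cb) ≤ c.boxY
  cα_u : cα * (8 * (c.ell / c.M) ^ 2 * c.boundD Cb) ≤ 1
  cα_potential : cα * (c.weightY * (4 * c.r) + c.weightU * (8 * (c.ell / c.M) ^ 2)) ≤ 1 / 4
  le_Cb : 4 * (5 * (c.ell / c.M) ^ 2 * c.boxY + 16 * c.σf1 ^ 2 / c.M ^ 2 + 2) ≤ Cb
  box_le_Cb : 4 * c.ell ^ 2 / (5 * c.r * c.Lg2 ^ 2) ≤ Cb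

theorem M_pos : 0 < c.M := lt_max_of_lt_left c.Lg1_pos

theorem ell_pos : 0 < c.ell := by
  have := c.Lf1_pos
  have := c.Lg2_pos
  have := c.Lf0_pos
  have := c.M_pos
  rw [ell]
  positivity

theorem r_pos : 0 < c.r := one_pos.trans_le c.one_le_r

theorem boxY_pos : 0 < c.boxY := by
  have := c.r_pos
  have := c.Lg2_pos
  have := c.M_pos
  rw [boxY]
  positivity

theorem boundU_nonneg {Cb : ℝ} (h : 0 ≤ Cb) : 0 ≤ c.boundU Cb := by
  rw [boundU]
  positivity

theorem boundD_nonneg {Cb : ℝ} (h : 0 ≤ Cb) : 0 ≤ c.boundD Cb := by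
  have := c.boundU_nonneg h
  rw [boundD]
  positivity

theorem weightU_pos : 0 < c.weightU := by
  have := c.ell_pos
  rw [weightU]
  positivity

theorem weightY_pos : 0 < c.weightY := by
  have := c.weightU_pos
  rw [weightY]
  positivity

/-- There is no circularity: `Cb` is fixed by the problem constants alone, and only then are `cα`
and `cB` chosen in terms of `boundU` and `boundD` at that value. -/
theorem exists_tuned {γ : ℝ} (hγ : 0 < γ) :
    ∃ cα cT cB Cb : ℝ, c.Tuned γ cα cT cB Cb := by
  have hr := c.r_pos
  have hM := c.M_pos
  have hl := c.ell_pos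
  have hY := c.boxY_pos
  have hwU := c.weightU_pos
  have hwY := c.weightY_pos
  have hL := c.Lg2_pos
  set C1 := 4 * (5 * (c.ell / c.M) ^ 2 * c.boxY + 16 * c.σf1 ^ 2 / c.M ^ 2 + 2)
  set C2 := 4 * c.ell ^ 2 / (5 * c.r * c.Lg2 ^ 2)
  have h1 : 0 ≤ C1 := by positivity
  have h2 : 0 ≤ C2 := by positivity
  have hU := c.boundU_nonneg (add_nonneg h1 h2)
  have hD := c.boundD_nonneg (add_nonneg h1 h2)
  set z1 := 16 * c.ell
  set z2 := 16 * c.r * c.boundD (C1 + C2) / c.boxY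
  set z3 := 8 * (c.ell / c.M) ^ 2 * c.boundD (C1 + C2)
  set z4 := 4 * (c.weightY * (4 * c.r) + c.weightU * (8 * (c.ell / c.M) ^ 2))
  have hz1 : 0 ≤ z1 := by positivity
  have hz2 : 0 ≤ z2 := by positivity
  have hz3 : 0 ≤ z3 := by positivity
  have hz4 : 0 ≤ z4 := by positivity
  -- Every condition on `cα` has the form `cα z ≤ 1`, and the reciprocal of the sum meets all of
  -- them at once.
  have key : ∀ z, z ≤ 1 + z1 + z2 + z3 + z4 → 1 / (1 + z1 + z2 + z3 + z4) * z ≤ 1 := by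
    intro z hz
    rw [one_div, inv_mul_le_one₀ (by positivity)]
    exact hz
  set w1 := 3200 * c.r * (γ * c.σg2 ^ 2) / c.M
  set w2 := 32 * c.r * c.σg1 ^ 2 / (c.M ^ 2 * c.boxY)
  set w3 := 16 * c.σg2 ^ 2 * c.boundU (C1 + C2) / c.M ^ 2
  have hw1 : 0 ≤ w1 := by positivity
  have hw2 : 0 ≤ w2 := by positivity
  have hw3 : 0 ≤ w3 := by positivity
  refine ⟨1 / (1 + z1 + z2 + z3 + z4), 1600 * c.r / (γ * c.M), 1 + w1 + w2 + w3, C1 + C2,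
    by positivity, ?_, by positivity, by positivity, ?_, ?_, ?_, ?_, key _ (by linarith), ?_,
    key _ (by linarith), ?_, by linarith, by linarith⟩
  · simpa using key 1 (by linarith)
  · rw [mul_div_cancel₀ _ (by positivity)]
  · rw [← div_le_iff₀' hM]
    linarith
  · rw [mul_right_comm (c.M ^ 2), ← div_le_iff₀' (by positivity)]
    linarith
  · rw [← div_le_iff₀' (by positivity)]
    linarith
  · rw [← div_le_one hY, mul_div_assoc]
    exact key _ (by linarith)
  · have := key z4 (by linarith)
    linarith

/-! ### Bounds by powers of the condition number. -/

section CondNumber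

variable {c} {μ : ℝ} (hμ : 0 < μ) (hμL : μ ≤ c.Lg1)

include hμ

theorem inv_eq : 1 / μ = c.κ μ / c.M := by
  have := c.M_pos
  rw [κ, ← M]
  field_simp

include hμL in
theorem one_le_κ : 1 ≤ c.κ μ := by
  rw [κ, le_div_iff₀ hμ, one_mul]
  exact hμL.trans (le_max_left _ _)

theorem Lg1_div_le : c.Lg1 / μ ≤ c.κ μ := by
  rw [κ]
  gcongr
  exact le_max_left _ _

include hμL in
theorem L1_le : c.L1 μ ≤ c.ell * c.κ μ := by
  have h := one_le_κ hμ hμL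
  have := c.Lf1_pos
  rw [L1, ell, add_mul, div_eq_mul_one_div _ μ, inv_eq hμ]
  have e : c.Lg2 * c.Lf0 * (c.κ μ / c.M) = c.Lg2 * c.Lf0 / c.M * c.κ μ := by ring
  rw [e]
  nlinarith

include hμL in
theorem L1_div_le : c.L1 μ / μ ≤ c.ell / c.M * c.κ μ ^ 2 := by
  have h := L1_le hμ hμL
  have h1 := one_le_κ hμ hμL
  have := c.M_pos
  rw [div_eq_mul_one_div, inv_eq hμ]
  calc _ ≤ c.ell * c.κ μ * (c.κ μ / c.M) := by gcongr
    _ = _ := by ring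

include hμL in
theorem lip_uStar_le : c.L1 μ / μ * (1 + c.Lg1 / μ) ≤ 2 * (c.ell / c.M) * c.κ μ ^ 3 := by
  have h := L1_div_le hμ hμL
  have h1 := one_le_κ hμ hμL
  have h2 := Lg1_div_le (c := c) hμ
  have := c.M_pos
  have := c.ell_pos
  have := c.Lg1_pos
  calc _ ≤ c.ell / c.M * c.κ μ ^ 2 * (2 * c.κ μ) := by
        gcongr
        linarith
    _ = _ := by ring

include hμL in
theorem lip_gradient_Phi_le : c.L1 μ * (1 + c.Lg1 / μ) ^ 2 ≤ 4 * c.ell * c.κ μ ^ 3 := by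
  have h := L1_le hμ hμL
  have h1 := one_le_κ hμ hμL
  have h2 := Lg1_div_le (c := c) hμ
  have := c.ell_pos
  have := c.Lg1_pos
  calc _ ≤ c.ell * c.κ μ * (2 * c.κ μ) ^ 2 := by
        gcongr
        linarith
    _ = _ := by ring

end CondNumber

end Constants

/-! ### Recursions in real numbers -/

/-- After multiplication by `√r`, the quadratic and linear terms are at most `21/80 √a` and `1/20
√a`, in total `5/16 √a`. Squaring against the noise costs a factor `2`, and `2 (5/16)² < 1/4`. -/
theorem sq_moment_step {a A A' a' l ρ η x r : ℝ} (ha : 0 ≤ a) (hr : 1 ≤ r) (hl : 0 ≤ l)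
    (hρ : 0 ≤ ρ) (hρr : 400 * r * ρ ^ 2 = 1) (hA2 : A ^ 2 ≤ a)
    (hla : l ^ 2 * a * (20 * r) ≤ 1)
    (hA'0 : 0 ≤ A') (hA' : A' ≤ (1 + ρ) * l * a + ρ * A + η + x) (ha' : a' ≤ r * A' ^ 2) :
    a' ≤ a / 4 + 4 * r * η ^ 2 + 4 * r * x ^ 2 := by
  have hr0 : 0 < r := by linarith
  set q := √r
  have hq : q ^ 2 = r := Real.sq_sqrt hr0.le
  have hq0 : 0 ≤ q := Real.sqrt_nonneg _
  set s := √a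
  have hs : s ^ 2 = a := Real.sq_sqrt ha
  have hs0 : 0 ≤ s := Real.sqrt_nonneg _
  have hρq : q * ρ = 1 / 20 := by
    refine (pow_left_inj₀ (by positivity) (by norm_num) two_ne_zero).mp ?_
    rw [mul_pow, hq]
    linarith
  have hρ1 : ρ ≤ 1 / 20 := by nlinarith
  have hlq : q * (l * s) ≤ 1 / 4 := by
    refine (pow_le_pow_iff_left₀ (by positivity) (by norm_num) two_ne_zero).mp ?_
    have : (q * (l * s)) ^ 2 * 20 ≤ 1 := by
      calc (q * (l * s)) ^ 2 * 20 = l ^ 2 * s ^ 2 * (20 * q ^ 2) := by ring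
        _ ≤ 1 := by rw [hs, hq]; exact hla
    linarith
  have hAs : A ≤ s := Real.le_sqrt_of_sq_le hA2
  have h1 : q * A' ≤ 5 / 16 * s + q * (η + x) := by
    have h2 := mul_le_mul_of_nonneg_left hA' hq0
    have h3 : q * ((1 + ρ) * l * a) ≤ 21 / 20 * (1 / 4) * s := by
      calc q * ((1 + ρ) * l * a) = (1 + ρ) * (q * (l * s)) * s := by rw [← hs]; ring
        _ ≤ _ := by gcongr; linarith
    have h4 : q * (ρ * A) ≤ 1 / 20 * s := by
      rw [← mul_assoc, hρq]; gcongr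
    linarith
  have h5 : r * A' ^ 2 = (q * A') ^ 2 := by rw [mul_pow, hq]
  have h6 := pow_le_pow_left₀ (by positivity) h1 2
  have h7 : (5 / 16 * s + q * (η + x)) ^ 2 ≤ 2 * (5 / 16) ^ 2 * a + 4 * r * η ^ 2
      + 4 * r * x ^ 2 := by
    rw [← hs, ← hq]
    nlinarith [sq_nonneg (5 / 16 * s - q * (η + x)), sq_nonneg (q * (η - x))]
  linarith

/-- The potential is `φ + α (lY a + lU b)`. The contraction by `1/4` leaves `3/4` of each weight to
absorb the losses, and `-(α/4) d` absorbs the drift. If every `G k` exceeded the bound, the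
potential would fall below what `Φ₀` allows. -/
theorem exists_le_of_potential {K : ℕ} (hK : 1 ≤ K) {φ a b d G : ℕ → ℝ}
    {α W₁ W₂ R P S N Q Q' lY lU e Φ₀ Δ A₀ : ℝ} (hα : 0 < α) (ha : ∀ k, 0 ≤ a k)
    (hb : ∀ k, 0 ≤ b k) (hd : ∀ k, 0 ≤ d k) (hlY : 0 ≤ lY) (hlU : 0 ≤ lU)
    (h1 : ∀ k < K, a (k + 1) ≤ a k / 4 + P * e + Q * d k)
    (h2 : ∀ k < K, b (k + 1) ≤ b k / 4 + R * a k + S * e + Q' * d k)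
    (h3 : ∀ k < K, φ (k + 1) ≤ φ k - α / 2 * G k - α / 4 * d k + α * (W₁ * a k + W₂ * b k)
      + α * (N * e))
    (hY : W₁ + lU * R ≤ 3 / 4 * lY) (hU : W₂ ≤ 3 / 4 * lU) (hQ : lY * Q + lU * Q' ≤ 1 / 4)
    (h0 : φ 0 - Φ₀ ≤ Δ) (hφ : Φ₀ ≤ φ K) (hA : lY * a 0 + lU * b 0 ≤ A₀) :
    ∃ k < K, G k ≤ (2 * Δ / α + 2 * A₀) / K + 2 * (N + lY * P + lU * S) * e := by
  by_contra! hcon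
  set t := (2 * Δ / α + 2 * A₀) / K + 2 * (N + lY * P + lU * S) * e
  have hK0 : (0 : ℝ) < K := by exact_mod_cast hK
  have step : ∀ k < K, φ (k + 1) + α * (lY * a (k + 1) + lU * b (k + 1))
      ≤ φ k + α * (lY * a k + lU * b k) - α / 2 * G k + α * ((N + lY * P + lU * S) * e) := by
    intro k hk
    have e1 := mul_le_mul_of_nonneg_left (h1 k hk) hlY
    have e2 := mul_le_mul_of_nonneg_left (h2 k hk) hlU
    have e3 := mul_le_mul_of_nonneg_right hY (ha k)
    have e4 := mul_le_mul_of_nonneg_right hU (hb k)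
    have e5 := mul_le_mul_of_nonneg_right hQ (hd k)
    have e6 := h3 k hk
    have e7 : lY * a (k + 1) + lU * b (k + 1) + (W₁ * a k + W₂ * b k) ≤ lY * a k + lU * b k
        + (lY * P + lU * S) * e + 1 / 4 * d k := by linarith
    have e8 := mul_le_mul_of_nonneg_left e7 hα.le
    linarith
  -- The inequality is strict only after at least one step, so the induction effectively starts at
  -- `k = 1`.
  have tel : ∀ k ≤ K, 0 < k → φ k + α * (lY * a k + lU * b k) < φ 0 + α * (lY * a 0 + lU * b 0)
      + k * (-(α / 2 * t) + α * ((N + lY * P + lU * S) * e)) := by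
    intro k
    induction k with
    | zero => intro _ h; exact absurd h (lt_irrefl 0)
    | succ k ih =>
      intro hk _
      have s1 := step k hk
      have s2 := mul_lt_mul_of_pos_left (hcon k hk) (half_pos hα)
      push_cast
      rcases Nat.eq_zero_or_pos k with rfl | hpos
      · norm_num at s1 ⊢
        linarith
      · have := ih (by omega) hpos
        linarith
  have fin := tel K le_rfl hK
  have hA' := mul_le_mul_of_nonneg_left hA hα.le
  have hn : 0 ≤ α * (lY * a K + lU * b K) := by
    have := ha K
    have := hb K
    positivity
  have ht : K * (-(α / 2 * t) + α * ((N + lY * P + lU * S) * e)) = -(Δ + α * A₀) := by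
    simp only [t]
    field_simp
    ring
  linarith

/-! ### One outer iteration with tuned constants -/

theorem div_le_div_div {x b s y : ℝ} (hx : 0 ≤ x) (hs : 0 < s) (hy : 0 < y) (h : s * y ≤ b) :
    x / b ≤ x / s / y := by
  rw [div_div]
  exact div_le_div_of_nonneg_left hx (mul_pos hs hy) h

namespace Constants

/-- The constants in the recursions for the errors that come from the batches. -/
def noiseX (c : Constants) (cB Cb : ℝ) : ℝ :=
  (2 * c.σf1 ^ 2 + 2 * c.σg2 ^ 2 * c.boundU Cb) / cB

section

variable {c : Constants} {γ cα cT cB Cb μ : ℝ} (ht : c.Tuned γ cα cT cB Cb) (hμ : 0 < μ)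
  (hμL : μ ≤ c.Lg1)

include ht

theorem Tuned.Cb_nonneg : 0 ≤ Cb := by
  refine le_trans ?_ ht.box_le_Cb
  have := c.r_pos
  positivity

include hμ

theorem Tuned.u_le {b U : ℝ} (hb : b ≤ Cb * c.κ μ ^ 2) (hU : U ≤ 2 * b + 2 * (c.Lf0 / μ) ^ 2) :
    U ≤ c.boundU Cb * c.κ μ ^ 2 := by
  have e : c.Lf0 / μ = c.Lf0 / c.M * c.κ μ := by
    rw [div_eq_mul_one_div, inv_eq hμ]
    ring
  rw [e, mul_pow] at hU
  rw [boundU]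
  linarith

include hμL

/-- This crude bound uses only nonempty batches and is used for the invariants; it keeps `boundD`
independent of `cB`. The sharp bound of order `κ³/K` is reserved for the rate. -/
theorem Tuned.noise_le_sq {U b3 b4 : ℝ} (hU0 : 0 ≤ U) (hU : U ≤ c.boundU Cb * c.κ μ ^ 2)
    (h3 : 1 ≤ b3) (h4 : 1 ≤ b4) :
    2 * (c.σf1 ^ 2 / b3) + 2 * (c.σg2 ^ 2 * U / b4)
      ≤ (2 * c.σf1 ^ 2 + 2 * c.σg2 ^ 2 * c.boundU Cb) * c.κ μ ^ 2 := by
  have hκ := one_le_κ hμ hμL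
  have e1 : c.σf1 ^ 2 / b3 ≤ c.σf1 ^ 2 := div_le_self (sq_nonneg _) h3
  have e2 : c.σg2 ^ 2 * U / b4 ≤ c.σg2 ^ 2 * U := div_le_self (by positivity) h4
  have e3 := mul_le_mul_of_nonneg_left hU (sq_nonneg c.σg2)
  have e4 : c.σf1 ^ 2 * 1 ≤ c.σf1 ^ 2 * c.κ μ ^ 2 := by
    gcongr
    exact one_le_pow₀ hκ
  linarith

theorem Tuned.noise_le {U b3 b4 K : ℝ} (hK : 0 < K) (hU0 : 0 ≤ U)
    (hU : U ≤ c.boundU Cb * c.κ μ ^ 2) (h3 : cB * (K / c.κ μ) ≤ b3)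
    (h4 : cB * (K / c.κ μ) ≤ b4) :
    2 * (c.σf1 ^ 2 / b3) + 2 * (c.σg2 ^ 2 * U / b4) ≤ c.noiseX cB Cb * (c.κ μ ^ 3 / K) := by
  have hκ := one_le_κ hμ hμL
  have hcB := ht.cB_pos
  have hy : 0 < K / c.κ μ := by positivity
  have e1 := div_le_div_div (sq_nonneg c.σf1) hcB hy h3
  have e2 := div_le_div_div (by positivity : 0 ≤ c.σg2 ^ 2 * U) hcB hy h4
  have e3 : c.σg2 ^ 2 * U / cB / (K / c.κ μ)
      ≤ c.σg2 ^ 2 * (c.boundU Cb * c.κ μ ^ 2) / cB / (K / c.κ μ) := by gcongr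
  have e4 : c.σf1 ^ 2 * 1 / cB / (K / c.κ μ)
      ≤ c.σf1 ^ 2 * c.κ μ ^ 2 / cB / (K / c.κ μ) := by
    gcongr
    exact one_le_pow₀ hκ
  rw [mul_one] at e4
  have e : c.noiseX cB Cb * (c.κ μ ^ 3 / K) = 2 * (c.σf1 ^ 2 * c.κ μ ^ 2 / cB / (K / c.κ μ))
      + 2 * (c.σg2 ^ 2 * (c.boundU Cb * c.κ μ ^ 2) / cB / (K / c.κ μ)) := by
    rw [noiseX]
    field_simp
  linarith

theorem Tuned.dir_le {U d V : ℝ} (hU : U ≤ c.boundU Cb * c.κ μ ^ 2)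
    (hd : d ≤ 2 * c.Cf0 ^ 2 + 2 * c.Lg1 ^ 2 * U)
    (hV : V ≤ (2 * c.σf1 ^ 2 + 2 * c.σg2 ^ 2 * c.boundU Cb) * c.κ μ ^ 2) :
    d + V ≤ c.boundD Cb * c.κ μ ^ 2 := by
  have e1 := mul_le_mul_of_nonneg_left hU (by positivity : 0 ≤ 2 * c.Lg1 ^ 2)
  have e4 : 2 * c.Cf0 ^ 2 * 1 ≤ 2 * c.Cf0 ^ 2 * c.κ μ ^ 2 := by
    gcongr
    exact one_le_pow₀ (one_le_κ hμ hμL)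
  rw [boundD]
  linarith

omit ht hμL in
theorem div_sq_eq (z : ℝ) : z / μ ^ 2 = z * (c.κ μ ^ 2 / c.M ^ 2) := by
  rw [div_eq_mul_one_div, ← div_pow, ← inv_eq hμ, one_div_pow]

omit ht in
theorem κ_pow_four_mul_box :
    c.κ μ ^ 4 * (μ ^ 2 / (20 * c.r * c.Lg2 ^ 2)) = c.boxY * c.κ μ ^ 2 := by
  have hκ0 : 0 < c.κ μ := one_pos.trans_le (one_le_κ hμ hμL)
  have hM := c.M_pos
  have hr := c.r_pos
  have hL := c.Lg2_pos
  rw [boxY, div_eq_mul_one_div (μ ^ 2), div_eq_mul_one_div (c.M ^ 2)]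
  have e : c.M = μ * c.κ μ := by
    rw [κ, ← M]
    field_simp
  rw [e]
  ring

/-- The lower-level error stays in the box and contracts up to the noise. -/
theorem Tuned.y_step {a a' d V K b2 : ℝ} (hK : 0 < K) (ha : a ≤ μ ^ 2 / (20 * c.r * c.Lg2 ^ 2))
    (hD0 : 0 ≤ d + V) (hD : d + V ≤ c.boundD Cb * c.κ μ ^ 2)
    (hV : V ≤ c.noiseX cB Cb * (c.κ μ ^ 3 / K))
    (hb2 : cB * (c.κ μ ^ 3 * K + c.κ μ ^ 4) ≤ b2)
    (h : a' ≤ a / 4 + 4 * c.r * (2 * (c.σg1 ^ 2 / b2) / μ ^ 2)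
      + 4 * c.r * ((c.Lg1 / μ) ^ 2 * ((cα / c.κ μ ^ 3) ^ 2 * (d + V)))) :
    a' ≤ μ ^ 2 / (20 * c.r * c.Lg2 ^ 2) ∧
    c.κ μ ^ 4 * a' ≤ c.κ μ ^ 4 * a / 4
      + (8 * c.r * c.σg1 ^ 2 / (c.M ^ 2 * cB) + 4 * c.r * cα * c.noiseX cB Cb)
        * (c.κ μ ^ 3 / K) + 4 * c.r * cα * d := by
  have hκ := one_le_κ hμ hμL
  have hκ0 : 0 < c.κ μ := by linarith
  have hcB := ht.cB_pos
  have hM := c.M_pos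
  have hr := c.r_pos
  have hL := c.Lg2_pos
  have hμ2 := div_sq_eq (c := c) hμ
  have hbox := κ_pow_four_mul_box (c := c) hμ hμL
  have hcα2 : cα ^ 2 ≤ cα := by
    have := mul_le_mul_of_nonneg_left ht.cα_le_one ht.cα_pos.le
    linarith
  -- The powers cancel: the weight `κ⁴`, the squared Lipschitz constant `κ²` of `y*` and `α² = cα²
  -- κ⁻⁶` leave `cα²`, at most `cα`.
  have hx : c.κ μ ^ 4 * ((c.Lg1 / μ) ^ 2 * ((cα / c.κ μ ^ 3) ^ 2 * (d + V)))
      ≤ cα * (d + V) := by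
    have h1 : (c.Lg1 / μ) ^ 2 ≤ c.κ μ ^ 2 := by
      have := c.Lg1_pos
      exact pow_le_pow_left₀ (by positivity) (Lg1_div_le hμ) 2
    calc _ ≤ c.κ μ ^ 4 * (c.κ μ ^ 2 * ((cα / c.κ μ ^ 3) ^ 2 * (d + V))) := by gcongr
      _ = cα ^ 2 * (d + V) := by field_simp
      _ ≤ _ := by gcongr
  -- One estimate serves both goals: `y = κ⁴` gives noise `κ²` for the box, and `y = κ³ K` gives
  -- `κ³/K` for the rate.
  have hs : ∀ y, 0 < y → y ≤ c.κ μ ^ 3 * K + c.κ μ ^ 4 →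
      c.κ μ ^ 4 * (2 * (c.σg1 ^ 2 / b2) / μ ^ 2)
        ≤ 2 * c.σg1 ^ 2 / (c.M ^ 2 * cB) * (c.κ μ ^ 6 / y) := by
    intro y hy hyle
    have h1 := div_le_div_div (sq_nonneg c.σg1) hcB hy
      ((mul_le_mul_of_nonneg_left hyle hcB.le).trans hb2)
    rw [hμ2]
    calc _ ≤ c.κ μ ^ 4 * (2 * (c.σg1 ^ 2 / cB / y) * (c.κ μ ^ 2 / c.M ^ 2)) := by gcongr
      _ = _ := by field_simp
  have hmain : c.κ μ ^ 4 * a' ≤ c.κ μ ^ 4 * a / 4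
      + 4 * c.r * (c.κ μ ^ 4 * (2 * (c.σg1 ^ 2 / b2) / μ ^ 2)) + 4 * c.r * (cα * (d + V)) := by
    have h1 := mul_le_mul_of_nonneg_left h (by positivity : 0 ≤ c.κ μ ^ 4)
    have h2 := mul_le_mul_of_nonneg_left hx (by positivity : 0 ≤ 4 * c.r)
    linarith
  -- For the box, the contracted error, the sampling noise and the drift each take at most a quarter
  -- of `boxY κ²`.
  constructor
  · have h1 := mul_le_mul_of_nonneg_left (hs (c.κ μ ^ 4) (by positivity)
      (le_add_of_nonneg_left (by positivity))) (by positivity : 0 ≤ 4 * c.r)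
    have e1 : c.κ μ ^ 6 / c.κ μ ^ 4 = c.κ μ ^ 2 := by field_simp
    have e2 : 4 * c.r * (2 * c.σg1 ^ 2 / (c.M ^ 2 * cB) * c.κ μ ^ 2)
        ≤ c.boxY / 4 * c.κ μ ^ 2 := by
      have : 4 * c.r * (2 * c.σg1 ^ 2 / (c.M ^ 2 * cB)) ≤ c.boxY / 4 := by
        rw [← mul_div_assoc, div_le_iff₀ (by positivity)]
        linarith [ht.le_cB_y]
      calc _ = 4 * c.r * (2 * c.σg1 ^ 2 / (c.M ^ 2 * cB)) * c.κ μ ^ 2 := by ring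
        _ ≤ _ := by gcongr
    rw [e1] at h1
    have e3 : 4 * c.r * (cα * (d + V)) ≤ c.boxY / 4 * c.κ μ ^ 2 := by
      have h2 := mul_le_mul_of_nonneg_left hD
        (mul_nonneg (by positivity : 0 ≤ 4 * c.r) ht.cα_pos.le)
      have h3 := mul_le_mul_of_nonneg_right ht.cα_y (by positivity : 0 ≤ c.κ μ ^ 2)
      linarith
    have e4 := mul_le_mul_of_nonneg_left ha (by positivity : 0 ≤ c.κ μ ^ 4)
    have h0 : 0 ≤ c.boxY * c.κ μ ^ 2 := by
      have := c.boxY_pos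
      positivity
    refine le_of_mul_le_mul_left ?_ (by positivity : 0 < c.κ μ ^ 4)
    rw [hbox] at e4 ⊢
    linarith
  · have h1 := mul_le_mul_of_nonneg_left (hs (c.κ μ ^ 3 * K) (by positivity)
      (le_add_of_nonneg_right (by positivity))) (by positivity : 0 ≤ 4 * c.r)
    have e1 : c.κ μ ^ 6 / (c.κ μ ^ 3 * K) = c.κ μ ^ 3 / K := by field_simp
    rw [e1] at h1
    have h2 := mul_le_mul_of_nonneg_left hV
        (mul_nonneg (by positivity : 0 ≤ 4 * c.r) ht.cα_pos.le)
    have e5 : 8 * c.r * c.σg1 ^ 2 / (c.M ^ 2 * cB) = 4 * c.r * (2 * c.σg1 ^ 2 / (c.M ^ 2 * cB)) := by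
      ring
    rw [e5]
    linarith

/-- The error of the linear system stays bounded and contracts up to the noise. -/
theorem Tuned.u_step {a b b' d U V D K b1 b3 ρ : ℝ} (hK : 0 < K) (ha0 : 0 ≤ a) (hb0 : 0 ≤ b)
    (ha : a ≤ μ ^ 2 / (20 * c.r * c.Lg2 ^ 2)) (hb : b ≤ Cb * c.κ μ ^ 2)
    (hU0 : 0 ≤ U) (hU : U ≤ c.boundU Cb * c.κ μ ^ 2)
    (hD0 : 0 ≤ d + V) (hD : d + V ≤ c.boundD Cb * c.κ μ ^ 2)
    (hV : V ≤ c.noiseX cB Cb * (c.κ μ ^ 3 / K)) (hρ : 400 * c.r * ρ ^ 2 = 1)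
    (hb1 : cB * (c.κ μ * K + c.κ μ ^ 2) ≤ b1) (hb3 : cB * (K / c.κ μ) ≤ b3) (hb3' : 1 ≤ b3)
    (hD' : 0 ≤ D) (hDle : D ≤ (cα / c.κ μ ^ 3) ^ 2 * (d + V))
    (h : b' ≤ 2 * ((2 + 4 * ρ ^ 2) * (c.L1 μ / μ) ^ 2 * a + 4 * ρ ^ 2 * b
        + 8 * (c.σg2 ^ 2 * U / b1 + c.σf1 ^ 2 / b3) / μ ^ 2)
        + 2 * (c.L1 μ / μ * (1 + c.Lg1 / μ)) ^ 2 * D) :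
    b' ≤ Cb * c.κ μ ^ 2 ∧
    b' ≤ b / 4 + 5 * (c.ell / c.M) ^ 2 * (c.κ μ ^ 4 * a)
      + (16 * (c.σg2 ^ 2 * c.boundU Cb + c.σf1 ^ 2) / (c.M ^ 2 * cB)
        + 8 * (c.ell / c.M) ^ 2 * cα * c.noiseX cB Cb) * (c.κ μ ^ 3 / K)
      + 8 * (c.ell / c.M) ^ 2 * cα * d := by
  have hκ := one_le_κ hμ hμL
  have hκ0 : 0 < c.κ μ := by linarith
  have hcB := ht.cB_pos
  have hM := c.M_pos
  have hr := c.r_pos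
  have hL := c.Lg2_pos
  have hL1 := c.L1_pos hμ
  have hG := c.Lg1_pos
  have hμ2 := div_sq_eq (c := c) hμ
  have hbox := κ_pow_four_mul_box (c := c) hμ hμL
  have hcα2 : cα ^ 2 ≤ cα := by
    have := mul_le_mul_of_nonneg_left ht.cα_le_one ht.cα_pos.le
    linarith
  have hρ1 : ρ ^ 2 ≤ 1 / 400 := by nlinarith [c.one_le_r, sq_nonneg ρ]
  have t1 : (2 + 4 * ρ ^ 2) * (c.L1 μ / μ) ^ 2 * a
      ≤ 5 / 2 * ((c.ell / c.M) ^ 2 * (c.κ μ ^ 4 * a)) := by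
    have h1 := pow_le_pow_left₀ (by positivity) (L1_div_le hμ hμL) 2
    calc _ ≤ 5 / 2 * (c.ell / c.M * c.κ μ ^ 2) ^ 2 * a := by
          gcongr
          linarith
      _ = _ := by ring
  have t2 : 4 * ρ ^ 2 * b ≤ 1 / 8 * b := by
    gcongr
    linarith
  -- The Lipschitz constant of `u*` is of order `κ³`, exactly what `α = cα κ⁻³` cancels.
  have t3 : (c.L1 μ / μ * (1 + c.Lg1 / μ)) ^ 2 * D ≤ 4 * (c.ell / c.M) ^ 2 * (cα * (d + V)) := by
    have h1 := pow_le_pow_left₀ (by positivity) (lip_uStar_le hμ hμL) 2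
    calc _ ≤ (2 * (c.ell / c.M) * c.κ μ ^ 3) ^ 2 * ((cα / c.κ μ ^ 3) ^ 2 * (d + V)) := by gcongr
      _ = 4 * (c.ell / c.M) ^ 2 * (cα ^ 2 * (d + V)) := by field_simp; ring
      _ ≤ _ := by gcongr
  have hs : ∀ y, 0 < y → y ≤ c.κ μ * K + c.κ μ ^ 2 →
      c.σg2 ^ 2 * U / b1 / μ ^ 2
        ≤ c.σg2 ^ 2 * c.boundU Cb / (c.M ^ 2 * cB) * (c.κ μ ^ 4 / y) := by
    intro y hy hyle
    have h1 := div_le_div_div (by positivity : 0 ≤ c.σg2 ^ 2 * U) hcB hy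
      ((mul_le_mul_of_nonneg_left hyle hcB.le).trans hb1)
    rw [hμ2]
    calc _ ≤ c.σg2 ^ 2 * U / cB / y * (c.κ μ ^ 2 / c.M ^ 2) := by gcongr
      _ ≤ c.σg2 ^ 2 * (c.boundU Cb * c.κ μ ^ 2) / cB / y * (c.κ μ ^ 2 / c.M ^ 2) := by gcongr
      _ = _ := by field_simp
  have hmain : b' ≤ b / 4 + 5 * (c.ell / c.M) ^ 2 * (c.κ μ ^ 4 * a)
      + 16 * (c.σg2 ^ 2 * U / b1 / μ ^ 2) + 16 * (c.σf1 ^ 2 / b3 / μ ^ 2)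
      + 8 * (c.ell / c.M) ^ 2 * (cα * (d + V)) := by
    have e : 8 * (c.σg2 ^ 2 * U / b1 + c.σf1 ^ 2 / b3) / μ ^ 2
        = 8 * (c.σg2 ^ 2 * U / b1 / μ ^ 2) + 8 * (c.σf1 ^ 2 / b3 / μ ^ 2) := by ring
    rw [e] at h
    linarith
  have hCU := c.boundU_nonneg ht.Cb_nonneg
  -- For the invariant, `Cb κ²/4` comes from the old error and another quarter from `le_Cb`; the `2`
  -- in that condition pays for the Hessian noise and the drift.
  constructor
  · have h1 := hs (c.κ μ ^ 2) (by positivity) (le_add_of_nonneg_left (by positivity))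
    have e1 : c.κ μ ^ 4 / c.κ μ ^ 2 = c.κ μ ^ 2 := by field_simp
    have e2 : 16 * (c.σg2 ^ 2 * c.boundU Cb / (c.M ^ 2 * cB)) ≤ 1 := by
      rw [← mul_div_assoc, div_le_one (by positivity)]
      linarith [ht.le_cB_u]
    have e2' := mul_le_mul_of_nonneg_right e2 (by positivity : 0 ≤ c.κ μ ^ 2)
    rw [e1] at h1
    have e3 : 8 * (c.ell / c.M) ^ 2 * (cα * (d + V)) ≤ c.κ μ ^ 2 := by
      have h2 := mul_le_mul_of_nonneg_left hD
        (mul_nonneg (by positivity : 0 ≤ 8 * (c.ell / c.M) ^ 2) ht.cα_pos.le)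
      have h3 := mul_le_mul_of_nonneg_right ht.cα_u (by positivity : 0 ≤ c.κ μ ^ 2)
      linarith
    have e4 := mul_le_mul_of_nonneg_left ha (by positivity : 0 ≤ c.κ μ ^ 4)
    rw [hbox] at e4
    have e5 := mul_le_mul_of_nonneg_left e4 (by positivity : 0 ≤ 5 * (c.ell / c.M) ^ 2)
    have e6 : c.σf1 ^ 2 / b3 / μ ^ 2 ≤ c.σf1 ^ 2 / c.M ^ 2 * c.κ μ ^ 2 := by
      rw [hμ2]
      calc _ ≤ c.σf1 ^ 2 * (c.κ μ ^ 2 / c.M ^ 2) := by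
            gcongr
            exact div_le_self (sq_nonneg _) hb3'
        _ = _ := by ring
    have e7 := mul_le_mul_of_nonneg_right ht.le_Cb (by positivity : 0 ≤ c.κ μ ^ 2)
    have e8 : 16 * c.σf1 ^ 2 / c.M ^ 2 = 16 * (c.σf1 ^ 2 / c.M ^ 2) := by ring
    rw [e8] at e7
    have e9 : 0 ≤ Cb * c.κ μ ^ 2 := mul_nonneg ht.Cb_nonneg (by positivity)
    linarith
  · have h1 := hs (c.κ μ * K) (by positivity) (le_add_of_nonneg_right (by positivity))
    have e1 : c.κ μ ^ 4 / (c.κ μ * K) = c.κ μ ^ 3 / K := by field_simp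
    rw [e1] at h1
    have h2 := mul_le_mul_of_nonneg_left hV
        (mul_nonneg (by positivity : 0 ≤ 8 * (c.ell / c.M) ^ 2) ht.cα_pos.le)
    have h3 : c.σf1 ^ 2 / b3 / μ ^ 2 ≤ c.σf1 ^ 2 / (c.M ^ 2 * cB) * (c.κ μ ^ 3 / K) := by
      have h4 := div_le_div_div (sq_nonneg c.σf1) hcB (by positivity : 0 < K / c.κ μ) hb3
      rw [hμ2]
      calc _ ≤ c.σf1 ^ 2 / cB / (K / c.κ μ) * (c.κ μ ^ 2 / c.M ^ 2) := by gcongr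
        _ = _ := by field_simp
    have e5 : 16 * (c.σg2 ^ 2 * c.boundU Cb + c.σf1 ^ 2) / (c.M ^ 2 * cB)
        = 16 * (c.σg2 ^ 2 * c.boundU Cb / (c.M ^ 2 * cB))
          + 16 * (c.σf1 ^ 2 / (c.M ^ 2 * cB)) := by ring
    rw [e5]
    linarith

/-- The batches and the inner loop are long enough for relative error `ρ = 1 / (20 √r)`. -/
theorem Tuned.adequate (hγ : 0 < γ) (hγL : γ * c.Lg1 ≤ 1) {K T k : ℕ} (hK : 1 ≤ K) (hk : k < K)
    (hT : cT * c.κ μ ≤ (T : ℝ)) {B : BatchSizes} (hB : B.AtLeast cB (c.κ μ) K T) {ρ : ℝ}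
    (hρ : 400 * c.r * ρ ^ 2 = 1) : B.Adequate c μ γ ρ T k := by
  have hκ := one_le_κ hμ hμL
  have hκ0 : 0 < c.κ μ := by linarith
  have hcB := ht.cB_pos
  have hM := c.M_pos
  have hr := c.r_pos
  have hK0 : (0 : ℝ) < K := by exact_mod_cast hK
  have pos : ∀ {n : ℕ} {z : ℝ}, 0 < z → z ≤ n → 0 < n := fun h1 h2 => by
    exact_mod_cast h1.trans_le h2
  refine ⟨pos (by positivity) (hB.b1_ge k hk), pos (by positivity) (hB.b2_ge k hk),
    pos (by positivity) (hB.b3_ge k hk), pos (by positivity) (hB.b4_ge k hk),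
    fun s hs => pos (by positivity) (hB.b1t_ge k hk s (by omega)), fun s hs => ?_, ?_⟩
  · have h1 := hB.b1t_ge k hk s (by omega)
    -- One factor `κ` of the batch size cancels `μ`, since `μ κ = M`; the other is discarded by `1 ≤
    -- κ`.
    have h2 : c.M * cB ≤ μ * B.b1t k s := by
      calc c.M * cB ≤ c.M * cB * c.κ μ := by
            refine le_mul_of_one_le_right (by positivity) hκ
        _ = μ * (cB * c.κ μ ^ 2) := by
            have e : c.M = μ * c.κ μ := by
              rw [κ, ← M]
              field_simp
            rw [e]
            ring
        _ ≤ _ := by gcongr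
    have h3 := ht.le_cB_inner
    have e : ρ ^ 2 = 1 / (400 * c.r) := by
      field_simp
      linarith
    rw [e, show 1 / (400 * c.r) / 4 * μ * B.b1t k s = μ * B.b1t k s / (1600 * c.r) by
      field_simp; ring, le_div_iff₀ (by positivity)]
    linarith
  · set x := γ * μ / 2 with hx
    have hx0 : 0 < x := by positivity
    have hx1 : x ≤ 1 := by
      have := mul_le_mul_of_nonneg_left hμL hγ.le
      linarith
    have hTx : 800 * c.r ≤ (T : ℝ) * x := by
      have h1 : cT * c.κ μ * (γ * μ) ≤ T * (γ * μ) := by gcongr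
      have e : cT * c.κ μ * (γ * μ) = γ * c.M * cT := by
        rw [κ, ← M]
        field_simp
      have := ht.le_cT
      rw [hx]
      linarith
    have e : ρ ^ 2 / 2 = 1 / (800 * c.r) := by
      field_simp
      linarith
    -- Since `(1 - x)(1 + x) ≤ 1`, Bernoulli's inequality turns `T x ≥ 800 r` into the required
    -- smallness without exponentials.
    have hy : (1 - x) ^ (T + 1) ≤ 1 / (1 + x) ^ (T + 1) := by
      rw [le_div_iff₀ (by positivity), ← mul_pow]
      refine pow_le_one₀ (mul_nonneg (by linarith) (by linarith)) ?_
      nlinarith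
    have hbern := one_add_mul_le_pow (by linarith : -2 ≤ x) (T + 1)
    rw [e]
    refine hy.trans (one_div_le_one_div_of_le (by positivity) ?_)
    refine le_trans ?_ hbern
    push_cast
    linarith

end

end Constants

/-! ### Convergence rate -/

namespace Constants

/-- The constant of the noise in the recursion for `κ⁴ E‖y - y*‖²`. -/
def noiseY (c : Constants) (cα cB Cb : ℝ) : ℝ :=
  8 * c.r * c.σg1 ^ 2 / (c.M ^ 2 * cB) + 4 * c.r * cα * c.noiseX cB Cb

/-- The constant of the noise in the recursion for `E‖u - u*‖²`. -/
def noiseU (c : Constants) (cα cB Cb : ℝ) : ℝ :=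
  16 * (c.σg2 ^ 2 * c.boundU Cb + c.σf1 ^ 2) / (c.M ^ 2 * cB)
    + 8 * (c.ell / c.M) ^ 2 * cα * c.noiseX cB Cb

/-- The constant of the convergence rate. -/
def rate (c : Constants) (cα cB Cb Δ : ℝ) : ℝ :=
  2 * Δ / cα + 2 * (c.weightY * c.boxY + c.weightU * Cb)
    + 2 * (c.noiseX cB Cb / 4 + c.weightY * c.noiseY cα cB Cb + c.weightU * c.noiseU cα cB Cb)

theorem Tuned.rate_nonneg {c : Constants} {γ cα cT cB Cb Δ : ℝ} (ht : c.Tuned γ cα cT cB Cb)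
    (hΔ : 0 ≤ Δ) : 0 ≤ c.rate cα cB Cb Δ := by
  have := ht.cα_pos
  have := ht.cB_pos
  have hCb := ht.Cb_nonneg
  have := c.boundU_nonneg hCb
  have := c.boxY_pos
  have := c.weightY_pos
  have := c.weightU_pos
  have := c.r_pos
  have h1 : 0 ≤ c.noiseX cB Cb := by rw [noiseX]; positivity
  have h2 : 0 ≤ c.noiseY cα cB Cb := by rw [noiseY]; positivity
  have h3 : 0 ≤ c.noiseU cα cB Cb := by rw [noiseU]; positivity
  rw [rate]
  positivity

end Constants

section Run

variable {X Y : Type*} [NormedAddCommGroup X] [InnerProductSpace ℝ X] [FiniteDimensional ℝ X]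
  [NormedAddCommGroup Y] [InnerProductSpace ℝ Y] [FiniteDimensional ℝ Y]
  [MeasurableSpace X] [MeasurableSpace Y] [BorelSpace X] [BorelSpace Y]
  {Ξ Z Ω : Type*} [MeasurableSpace Ξ] [MeasurableSpace Z] [MeasurableSpace Ω]
  {p : Problem X Y Ξ Z} {P : Measure Ω} (R : Randomness p P)

namespace Randomness

/-- The errors after `k` iterations are square integrable and within the invariant bounds. -/
structure Controlled (c : Constants) (μ Cb : ℝ) (B : BatchSizes) (α γ : ℝ) (T k : ℕ) :
    Prop where
  int_Y : Integrable (fun ω => devY p (R.point B α γ T k ω) ^ 2) P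
  int_U : Integrable (fun ω => devU p (R.point B α γ T k ω) ^ 2) P
  int_Phi : Integrable (fun ω => Phi p.f p.g (R.point B α γ T k ω).1) P
  le_Y : ∫ ω, devY p (R.point B α γ T k ω) ^ 2 ∂P ≤ μ ^ 2 / (20 * c.r * c.Lg2 ^ 2)
  le_U : ∫ ω, devU p (R.point B α γ T k ω) ^ 2 ∂P ≤ Cb * c.κ μ ^ 2

variable [IsProbabilityMeasure P] {c : Constants} {μ Δ γ cα cT cB Cb : ℝ} {B : BatchSizes}
  {K T : ℕ} (ht : c.Tuned γ cα cT cB Cb) (hμ : 0 < μ) (hμL : μ ≤ c.Lg1) (hγ : 0 < γ)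
  (hγL : γ * c.Lg1 ≤ 1) (hK : 1 ≤ K) (hT : cT * c.κ μ ≤ (T : ℝ))
  (hB : B.AtLeast cB (c.κ μ) K T) (hS : Setting c μ Δ p P R B (cα / c.κ μ ^ 3) γ T K)

include ht hμ hμL hS

theorem controlled_zero : R.Controlled c μ Cb B (cα / c.κ μ ^ 3) γ T 0 := by
  refine ⟨hS.box.int_y, hS.box.int_u, hS.gap.int_Phi, hS.box.box_y.trans (min_le_left _ _),
    (hS.box.box_u.trans (min_le_left _ _)).trans ?_⟩
  have hr := c.r_pos
  have hL := c.Lg2_pos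
  have h1 := pow_le_pow_left₀ (c.L1_pos hμ).le (Constants.L1_le hμ hμL) 2
  calc 4 * c.L1 μ ^ 2 / (5 * c.r * c.Lg2 ^ 2)
      ≤ 4 * (c.ell * c.κ μ) ^ 2 / (5 * c.r * c.Lg2 ^ 2) := by gcongr
    _ = 4 * c.ell ^ 2 / (5 * c.r * c.Lg2 ^ 2) * c.κ μ ^ 2 := by ring
    _ ≤ _ := by
      gcongr
      exact ht.box_le_Cb

include hγ hγL hK hT hB

/-- Invariants and recursions have to be proved together: the box makes the Newton term a
contraction, and the contraction preserves the box. -/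
theorem controlled_succ {k : ℕ} (hk : k < K)
    (hC : R.Controlled c μ Cb B (cα / c.κ μ ^ 3) γ T k) :
    R.Controlled c μ Cb B (cα / c.κ μ ^ 3) γ T (k + 1) ∧
    Integrable (fun ω =>
      ‖gradient (Phi p.f p.g) (R.point B (cα / c.κ μ ^ 3) γ T k ω).1‖ ^ 2) P ∧
    c.κ μ ^ 4 * ∫ ω, devY p (R.point B (cα / c.κ μ ^ 3) γ T (k + 1) ω) ^ 2 ∂P
      ≤ c.κ μ ^ 4 * (∫ ω, devY p (R.point B (cα / c.κ μ ^ 3) γ T k ω) ^ 2 ∂P) / 4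
        + c.noiseY cα cB Cb * (c.κ μ ^ 3 / K)
        + 4 * c.r * cα * ∫ ω, meanDir p (R.point B (cα / c.κ μ ^ 3) γ T k ω) ^ 2 ∂P ∧
    ∫ ω, devU p (R.point B (cα / c.κ μ ^ 3) γ T (k + 1) ω) ^ 2 ∂P
      ≤ (∫ ω, devU p (R.point B (cα / c.κ μ ^ 3) γ T k ω) ^ 2 ∂P) / 4
        + 5 * (c.ell / c.M) ^ 2
          * (c.κ μ ^ 4 * ∫ ω, devY p (R.point B (cα / c.κ μ ^ 3) γ T k ω) ^ 2 ∂P)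
        + c.noiseU cα cB Cb * (c.κ μ ^ 3 / K)
        + 8 * (c.ell / c.M) ^ 2 * cα
          * ∫ ω, meanDir p (R.point B (cα / c.κ μ ^ 3) γ T k ω) ^ 2 ∂P ∧
    ∫ ω, Phi p.f p.g (R.point B (cα / c.κ μ ^ 3) γ T (k + 1) ω).1 ∂P
      ≤ ∫ ω, Phi p.f p.g (R.point B (cα / c.κ μ ^ 3) γ T k ω).1 ∂P
        - cα / c.κ μ ^ 3 / 2
          * ∫ ω, ‖gradient (Phi p.f p.g) (R.point B (cα / c.κ μ ^ 3) γ T k ω).1‖ ^ 2 ∂P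
        - cα / c.κ μ ^ 3 / 4 * ∫ ω, meanDir p (R.point B (cα / c.κ μ ^ 3) γ T k ω) ^ 2 ∂P
        + cα / c.κ μ ^ 3 * (c.ell ^ 2
            * (c.κ μ ^ 4 * ∫ ω, devY p (R.point B (cα / c.κ μ ^ 3) γ T k ω) ^ 2 ∂P)
          + c.Lg1 ^ 2 * ∫ ω, devU p (R.point B (cα / c.κ μ ^ 3) γ T k ω) ^ 2 ∂P)
        + cα / c.κ μ ^ 3 * (c.noiseX cB Cb / 4 * (c.κ μ ^ 3 / K)) := by
  have ho := hS.oracles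
  have hv := hS.variance
  have hb := hS.base
  have hκ := Constants.one_le_κ hμ hμL
  have hκ0 : 0 < c.κ μ := by linarith
  have hr := c.r_pos
  have hK0 : (0 : ℝ) < K := by exact_mod_cast hK
  have hcα := ht.cα_pos
  -- The relative inner error depends on `r` alone, so a number of inner steps linear in `κ` is
  -- enough.
  set ρ := 1 / (20 * √c.r) with hρdef
  have hρr : 400 * c.r * ρ ^ 2 = 1 := by
    rw [hρdef, div_pow, mul_pow, Real.sq_sqrt hr.le]
    field_simp
    norm_num
  have hρ : 0 ≤ ρ := by positivity
  have hρ1 : ρ ≤ 1 := by nlinarith [c.one_le_r]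
  have hA := ht.adequate hμ hμL hγ hγL hK hk hT hB hρr
  have hαL : cα / c.κ μ ^ 3 * (c.L1 μ * (1 + c.Lg1 / μ) ^ 2) ≤ 1 / 4 := by
    calc _ ≤ cα / c.κ μ ^ 3 * (4 * c.ell * c.κ μ ^ 3) := by
          exact mul_le_mul_of_nonneg_left (Constants.lip_gradient_Phi_le hμ hμL) (by positivity)
      _ = cα * (16 * c.ell) / 4 := by field_simp; ring
      _ ≤ _ := by linarith [ht.cα_descent]
  have hα0 : 0 ≤ cα / c.κ μ ^ 3 := by positivity
  have hα : 0 < cα / c.κ μ ^ 3 := by positivity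
  have sU := (R.integrable_u_sq ho hb hμ hC.int_U).2
  have sd := (R.integrable_meanDir_sq ho hb hμ hC.int_U).2
  have sD := (R.displacement_sq ho hv hb hμ hA hC.int_U).2
  obtain ⟨pΦ, pG, sΦ⟩ := R.Phi_succ ho hv hb hμ hA hC.int_U hα0 hαL hC.int_Y hC.int_Phi
  have sY := fun η S h1 h2 h3 h4 => R.devY_succ ho hv hb hμ hμL hγ hγL hρ hρ1 hA hC.int_Y hC.int_U
    (η := η) (S := S) h1 h2 h3 h4
  obtain ⟨pU, sU'⟩ := R.devU_succ ho hv hb hμ hμL hγ hγL hρ hρ1 hA hC.int_Y hC.int_U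
  -- The moment ratio is needed at the new iterate, where it turns the first-moment bound into a
  -- second-moment one.
  have hmom := hS.moment (k + 1) (by omega)
  change ∫ ω, devY p (R.point B (cα / c.κ μ ^ 3) γ T (k + 1) ω) ^ 2 ∂P
    ≤ c.r * (∫ ω, devY p (R.point B (cα / c.κ μ ^ 3) γ T (k + 1) ω) ∂P) ^ 2 at hmom
  have hA'0 : 0 ≤ ∫ ω, devY p (R.point B (cα / c.κ μ ^ 3) γ T (k + 1) ω) ∂P :=
    integral_nonneg fun ω => devY_nonneg _
  have hA2 : (∫ ω, devY p (R.point B (cα / c.κ μ ^ 3) γ T k ω) ∂P) ^ 2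
      ≤ ∫ ω, devY p (R.point B (cα / c.κ μ ^ 3) γ T k ω) ^ 2 ∂P :=
    sq_integral_le_integral_sq ((continuous_devY hb hμ).measurable.comp
      (R.measurable_point ho B _ γ T k)).aestronglyMeasurable hC.int_Y
  have ha0 : 0 ≤ ∫ ω, devY p (R.point B (cα / c.κ μ ^ 3) γ T k ω) ^ 2 ∂P :=
    integral_nonneg fun ω => sq_nonneg _
  have hb0 : 0 ≤ ∫ ω, devU p (R.point B (cα / c.κ μ ^ 3) γ T k ω) ^ 2 ∂P :=
    integral_nonneg fun ω => sq_nonneg _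
  have hd0 : 0 ≤ ∫ ω, meanDir p (R.point B (cα / c.κ μ ^ 3) γ T k ω) ^ 2 ∂P :=
    integral_nonneg fun ω => sq_nonneg _
  have hU0 : 0 ≤ ∫ ω, ‖(R.point B (cα / c.κ μ ^ 3) γ T k ω).2.2‖ ^ 2 ∂P :=
    integral_nonneg fun ω => sq_nonneg _
  have hDx0 : 0 ≤ ∫ ω, ‖(R.point B (cα / c.κ μ ^ 3) γ T (k + 1) ω).1
      - (R.point B (cα / c.κ μ ^ 3) γ T k ω).1‖ ^ 2 ∂P := integral_nonneg fun ω => sq_nonneg _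
  have hY := hC.le_Y
  have hUb := hC.le_U
  have hb3 : (1 : ℝ) ≤ B.b3 k := by exact_mod_cast hA.b3_pos
  have hb4 : (1 : ℝ) ≤ B.b4 k := by exact_mod_cast hA.b4_pos
  have hU' := ht.u_le hμ hUb sU
  have hVsq := ht.noise_le_sq hμ hμL hU0 hU' hb3 hb4
  have hV := ht.noise_le hμ hμL hK0 hU0 hU' (hB.b3_ge k hk) (hB.b4_ge k hk)
  have hD := ht.dir_le hμ hμL hU' sd hVsq
  have hV0 : 0 ≤ 2 * (c.σf1 ^ 2 / B.b3 k)
      + 2 * (c.σg2 ^ 2 * (∫ ω, ‖(R.point B (cα / c.κ μ ^ 3) γ T k ω).2.2‖ ^ 2 ∂P) / B.b4 k) := by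
    positivity
  have hD0 := add_nonneg hd0 hV0
  have hη : 0 ≤ 2 * (c.σg1 ^ 2 / B.b2 k) / μ ^ 2 := by positivity
  -- Here `η` and `S` are the square roots of the noise and of the displacement bound, so that
  -- squaring in `sq_moment_step` recovers these quantities.
  obtain ⟨pY, sA⟩ := sY _ _ (Real.sqrt_nonneg _) (Real.sq_sqrt hη).ge (Real.sqrt_nonneg _)
    (sD.trans (Real.sq_sqrt (mul_nonneg (sq_nonneg _) hD0)).ge)
  have hla : (c.Lg2 / μ) ^ 2 * (∫ ω, devY p (R.point B (cα / c.κ μ ^ 3) γ T k ω) ^ 2 ∂P)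
      * (20 * c.r) ≤ 1 := by
    have hL := c.Lg2_pos
    calc _ ≤ (c.Lg2 / μ) ^ 2 * (μ ^ 2 / (20 * c.r * c.Lg2 ^ 2)) * (20 * c.r) := by gcongr
      _ = 1 := by field_simp
  have hG := c.Lg1_pos
  have sM := sq_moment_step ha0 c.one_le_r (div_nonneg c.Lg2_pos.le hμ.le) hρ hρr hA2 hla hA'0
    sA hmom
  rw [Real.sq_sqrt hη, mul_pow, Real.sq_sqrt (mul_nonneg (sq_nonneg _) hD0)] at sM
  obtain ⟨yBox, yRec⟩ := ht.y_step hμ hμL hK0 hY hD0 hD hV (hB.b2_ge k hk) sM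
  obtain ⟨uBox, uRec⟩ := ht.u_step hμ hμL hK0 ha0 hb0 hY hUb hU0 hU' hD0 hD hV hρr
    (hB.b1_ge k hk) (hB.b3_ge k hk) hb3 hDx0 sD sU'
  refine ⟨⟨pY, pU, pΦ, yBox, uBox⟩, pG, yRec, uRec, sΦ.trans ?_⟩
  have e1 : c.L1 μ ^ 2 * ∫ ω, devY p (R.point B (cα / c.κ μ ^ 3) γ T k ω) ^ 2 ∂P
      ≤ c.ell ^ 2 * (c.κ μ ^ 4 * ∫ ω, devY p (R.point B (cα / c.κ μ ^ 3) γ T k ω) ^ 2 ∂P) := by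
    have h1 := pow_le_pow_left₀ (c.L1_pos hμ).le (Constants.L1_le hμ hμL) 2
    rw [← mul_assoc]
    refine mul_le_mul_of_nonneg_right (h1.trans ?_) ha0
    rw [mul_pow]
    exact mul_le_mul_of_nonneg_left (pow_le_pow_right₀ hκ (by norm_num)) (sq_nonneg _)
  have e2 := mul_le_mul_of_nonneg_left e1 hα0
  have e3 := mul_le_mul_of_nonneg_left hV (by positivity : 0 ≤ cα / c.κ μ ^ 3 / 4)
  linarith

/-- The potential argument runs on the scaled errors. The initial box gives a starting potential of
order `κ²`, besides the gap term `Δ/α` of order `κ³`. -/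
theorem reaches_rate : R.Reaches B (cα / c.κ μ ^ 3) γ T K
    (c.rate cα cB Cb Δ * c.κ μ ^ 3 / K) := by
  have hb := hS.base
  have hκ := Constants.one_le_κ hμ hμL
  have hκ0 : 0 < c.κ μ := by linarith
  have hK0 : (0 : ℝ) < K := by exact_mod_cast hK
  have hcα := ht.cα_pos
  have hC : ∀ k ≤ K, R.Controlled c μ Cb B (cα / c.κ μ ^ 3) γ T k := by
    intro k
    induction k with
    | zero => exact fun _ => R.controlled_zero ht hμ hμL hS
    | succ k ih =>
      exact fun hk => (R.controlled_succ ht hμ hμL hγ hγL hK hT hB hS hk (ih (by omega))).1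
  have hstep := fun k (hk : k < K) =>
    (R.controlled_succ ht hμ hμL hγ hγL hK hT hB hS hk (hC k hk.le)).2
  have hwY := c.weightY_pos
  have hwU := c.weightU_pos
  -- The summand `10 (ell/M)²` in `weightY` pays for the leak `5 (ell/M)²` of the `y` error into
  -- `u`, and its summand `1` for the `y` error in the descent step.
  have w_le_Y : c.ell ^ 2 + c.weightU * (5 * (c.ell / c.M) ^ 2) ≤ 3 / 4 * c.weightY := by
    rw [Constants.weightY, Constants.weightU]
    nlinarith [mul_nonneg (sq_nonneg (c.ell / c.M)) (add_nonneg (sq_nonneg c.ell) (sq_nonneg c.Lg1)),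
      sq_nonneg c.ell, sq_nonneg c.Lg1]
  have w_le_U : c.Lg1 ^ 2 ≤ 3 / 4 * c.weightU := by
    rw [Constants.weightU]
    nlinarith [sq_nonneg c.ell, sq_nonneg c.Lg1]
  have hQ : c.weightY * (4 * c.r * cα) + c.weightU * (8 * (c.ell / c.M) ^ 2 * cα) ≤ 1 / 4 := by
    linarith [ht.cα_potential]
  have hinf : ⨅ x, Phi p.f p.g x ≤ ∫ ω, Phi p.f p.g (R.point B (cα / c.κ μ ^ 3) γ T K ω).1 ∂P := by
    have h1 : ∫ _, (⨅ x, Phi p.f p.g x) ∂P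
        ≤ ∫ ω, Phi p.f p.g (R.point B (cα / c.κ μ ^ 3) γ T K ω).1 ∂P :=
      integral_mono (integrable_const _) (hC K le_rfl).int_Phi fun ω => ciInf_le hS.gap.bddBelow _
    rwa [integral_const, probReal_univ, one_smul] at h1
  have hinit : c.weightY * (c.κ μ ^ 4 * ∫ ω, devY p (R.point B (cα / c.κ μ ^ 3) γ T 0 ω) ^ 2 ∂P)
      + c.weightU * ∫ ω, devU p (R.point B (cα / c.κ μ ^ 3) γ T 0 ω) ^ 2 ∂P
      ≤ (c.weightY * c.boxY + c.weightU * Cb) * c.κ μ ^ 2 := by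
    have h0 := R.controlled_zero ht hμ hμL hS
    have h1 := mul_le_mul_of_nonneg_left h0.le_Y (by positivity : 0 ≤ c.κ μ ^ 4)
    rw [Constants.κ_pow_four_mul_box hμ hμL] at h1
    have h2 := mul_le_mul_of_nonneg_left h1 hwY.le
    have h3 := mul_le_mul_of_nonneg_left h0.le_U hwU.le
    linarith
  obtain ⟨k, hk, hle⟩ := exists_le_of_potential hK
    (φ := fun k => ∫ ω, Phi p.f p.g (R.point B (cα / c.κ μ ^ 3) γ T k ω).1 ∂P)
    (a := fun k => c.κ μ ^ 4 * ∫ ω, devY p (R.point B (cα / c.κ μ ^ 3) γ T k ω) ^ 2 ∂P)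
    (b := fun k => ∫ ω, devU p (R.point B (cα / c.κ μ ^ 3) γ T k ω) ^ 2 ∂P)
    (d := fun k => ∫ ω, meanDir p (R.point B (cα / c.κ μ ^ 3) γ T k ω) ^ 2 ∂P)
    (G := fun k => ∫ ω, ‖gradient (Phi p.f p.g) (R.point B (cα / c.κ μ ^ 3) γ T k ω).1‖ ^ 2 ∂P)
    (e := c.κ μ ^ 3 / K) (Φ₀ := ⨅ x, Phi p.f p.g x) (Δ := Δ)
    (A₀ := (c.weightY * c.boxY + c.weightU * Cb) * c.κ μ ^ 2)
    (by positivity : 0 < cα / c.κ μ ^ 3)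
    (fun k => mul_nonneg (by positivity) (integral_nonneg fun ω => sq_nonneg _))
    (fun k => integral_nonneg fun ω => sq_nonneg _)
    (fun k => integral_nonneg fun ω => sq_nonneg _) hwY.le hwU.le
    (fun k hk => (hstep k hk).2.1) (fun k hk => (hstep k hk).2.2.1)
    (fun k hk => (hstep k hk).2.2.2) w_le_Y w_le_U hQ hS.gap.gap_le hinf hinit
  refine ⟨hb.differentiable_Phi hμ, k, hk, (hstep k hk).1, hle.trans ?_⟩
  have e1 : c.κ μ ^ 2 ≤ c.κ μ ^ 3 := pow_le_pow_right₀ hκ (by norm_num)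
  have h0 : 0 ≤ c.weightY * c.boxY + c.weightU * Cb := by
    have := c.boxY_pos
    have := ht.Cb_nonneg
    positivity
  have e2 := mul_le_mul_of_nonneg_left e1 h0
  have e3 : (2 * Δ / (cα / c.κ μ ^ 3)
        + 2 * ((c.weightY * c.boxY + c.weightU * Cb) * c.κ μ ^ 2)) / (K : ℝ)
      ≤ (2 * Δ / (cα / c.κ μ ^ 3)
        + 2 * ((c.weightY * c.boxY + c.weightU * Cb) * c.κ μ ^ 3)) / K := by gcongr
  refine (add_le_add e3 le_rfl).trans (le_of_eq ?_)
  rw [Constants.rate]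
  field_simp

end Randomness

end Run

/-! ### Oracle complexity -/

/-- Batch sizes that are the same in all iterations. -/
def BatchSizes.uniform (n n1 n2 n3 n4 : ℕ) : BatchSizes :=
  ⟨fun _ _ => n, fun _ => n1, fun _ => n2, fun _ => n3, fun _ => n4⟩

section Count

variable {X Y : Type*} [NormedAddCommGroup X] [InnerProductSpace ℝ X] [FiniteDimensional ℝ X]
  [NormedAddCommGroup Y] [InnerProductSpace ℝ Y] [FiniteDimensional ℝ Y]
  [MeasurableSpace X] [MeasurableSpace Y] [BorelSpace X] [BorelSpace Y]
  {Ξ Z Ω : Type*} [MeasurableSpace Ξ] [MeasurableSpace Z] [MeasurableSpace Ω]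
  {p : Problem X Y Ξ Z} {P : Measure Ω} (R : Randomness p P)

theorem Randomness.Reaches.mono {R : Randomness p P} {B : BatchSizes} {α γ : ℝ} {T K : ℕ}
    {ε ε' : ℝ} (h : R.Reaches B α γ T K ε) (hε : ε ≤ ε') : R.Reaches B α γ T K ε' := by
  obtain ⟨hd, k, hk, hi, hle⟩ := h
  exact ⟨hd, k, hk, hi, hle.trans hε⟩

/-- The counters depend on the batch sizes alone, so the complexity bounds hold for every outcome
and not just on average. -/
theorem Randomness.count_state (B : BatchSizes) (α γ : ℝ) (T k : ℕ) (ω : Ω) :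
    (R.state B α γ T k ω).count
      = ⟨∑ j ∈ Finset.range k, B.b3 j, ∑ j ∈ Finset.range k, B.b2 j,
        ∑ j ∈ Finset.range k, B.b4 j,
        ∑ j ∈ Finset.range k, (B.b1 j + ∑ s ∈ Finset.range (T + 1), 2 * B.b1t j s)⟩ := by
  induction k with
  | zero => simp [Randomness.state, iterate]
  | succ k ih =>
    rw [R.state_succ, step]
    simp only [ih, sgd_hvp, Finset.sum_range_succ _ k, add_assoc]

theorem Randomness.count_uniform (n n1 n2 n3 n4 : ℕ) (α γ : ℝ) (T k : ℕ) (ω : Ω) :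
    (R.state (.uniform n n1 n2 n3 n4) α γ T k ω).count
      = ⟨k * n3, k * n2, k * n4, k * (n1 + (T + 1) * (2 * n))⟩ := by
  simp [R.count_state, BatchSizes.uniform]

end Count

theorem BatchSizes.atLeast_uniform (cB κ : ℝ) (K T : ℕ) :
    (BatchSizes.uniform ⌈cB * κ ^ 2⌉₊ ⌈cB * (κ * K + κ ^ 2)⌉₊ ⌈cB * (κ ^ 3 * K + κ ^ 4)⌉₊
      ⌈cB * (K / κ)⌉₊ ⌈cB * (K / κ)⌉₊).AtLeast cB κ K T :=
  ⟨fun _ _ _ _ => Nat.le_ceil _, fun _ _ => Nat.le_ceil _, fun _ _ => Nat.le_ceil _,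
    fun _ _ => Nat.le_ceil _, fun _ _ => Nat.le_ceil _⟩

theorem natCeil_le_mul {x a z : ℝ} (hx : 0 ≤ x) (hz : 1 ≤ z) (h : x ≤ a * z) :
    (⌈x⌉₊ : ℝ) ≤ (a + 1) * z := by
  have := (Nat.ceil_lt_add_one hx).le
  linarith

/-- Oracle calls of a run with the smallest uniform batches. -/
theorem count_bounds {cB cT κ ε H : ℝ} {K T : ℕ} (hcB : 0 < cB) (hcT : 0 < cT) (hκ : 1 ≤ κ)
    (hε : 0 < ε) (hε1 : ε ≤ 1) (hH : 0 ≤ H) (hK : (K : ℝ) ≤ H * κ ^ 3 / ε)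
    (hT : (T : ℝ) ≤ (cT + 1) * κ) :
    (K : ℝ) * ⌈cB * (K / κ)⌉₊ ≤ H * (cB * (H + 1) + 1) * κ ^ 5 / ε ^ 2 ∧
    (K : ℝ) * ⌈cB * (κ ^ 3 * K + κ ^ 4)⌉₊ ≤ H * (cB * (H + 1) + 1) * κ ^ 9 / ε ^ 2 ∧
    (K : ℝ) * (⌈cB * (κ * K + κ ^ 2)⌉₊ + (T + 1) * (2 * ⌈cB * κ ^ 2⌉₊))
      ≤ H * (cB * (H + 1) + 1 + 2 * (cT + 2) * (cB + 1)) * κ ^ 7 / ε ^ 2 := by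
  have hκ0 : 0 < κ := by linarith
  have hinv : 1 ≤ 1 / ε := by rwa [le_div_iff₀ hε, one_mul]
  have hz : ∀ n : ℕ, 1 ≤ κ ^ n / ε := fun n => by
    rw [div_eq_mul_one_div]
    exact one_le_mul_of_one_le_of_one_le (one_le_pow₀ hκ) hinv
  -- Lower-order terms are absorbed using `κ ≥ 1` and `ε ≤ 1`.
  have hpow : ∀ {i j : ℕ}, i ≤ j → κ ^ i ≤ κ ^ j / ε := fun {i j} h => by
    rw [div_eq_mul_one_div]
    calc κ ^ i ≤ κ ^ j := pow_le_pow_right₀ hκ h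
      _ ≤ _ := le_mul_of_one_le_right (by positivity) hinv
  have b3 : (⌈cB * (K / κ)⌉₊ : ℝ) ≤ (cB * (H + 1) + 1) * (κ ^ 2 / ε) := by
    refine natCeil_le_mul (by positivity) (hz 2) ?_
    rw [mul_assoc]
    refine mul_le_mul_of_nonneg_left ?_ hcB.le
    calc K / κ ≤ H * κ ^ 3 / ε / κ := by gcongr
      _ = H * (κ ^ 2 / ε) := by field_simp
      _ ≤ _ := by
        refine mul_le_mul_of_nonneg_right (by linarith) (by positivity)
  have b2 : (⌈cB * (κ ^ 3 * K + κ ^ 4)⌉₊ : ℝ) ≤ (cB * (H + 1) + 1) * (κ ^ 6 / ε) := by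
    refine natCeil_le_mul (by positivity) (hz 6) ?_
    rw [mul_assoc]
    refine mul_le_mul_of_nonneg_left ?_ hcB.le
    calc κ ^ 3 * K + κ ^ 4 ≤ κ ^ 3 * (H * κ ^ 3 / ε) + κ ^ 6 / ε :=
          add_le_add (by gcongr) (hpow (by norm_num))
      _ = _ := by ring
  have b1 : (⌈cB * (κ * K + κ ^ 2)⌉₊ : ℝ) ≤ (cB * (H + 1) + 1) * (κ ^ 4 / ε) := by
    refine natCeil_le_mul (by positivity) (hz 4) ?_
    rw [mul_assoc]
    refine mul_le_mul_of_nonneg_left ?_ hcB.le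
    calc κ * K + κ ^ 2 ≤ κ * (H * κ ^ 3 / ε) + κ ^ 4 / ε :=
          add_le_add (by gcongr) (hpow (by norm_num))
      _ = _ := by ring
  have b1t : (⌈cB * κ ^ 2⌉₊ : ℝ) ≤ (cB + 1) * κ ^ 2 :=
    natCeil_le_mul (by positivity) (one_le_pow₀ hκ) le_rfl
  refine ⟨?_, ?_, ?_⟩
  · calc _ ≤ H * κ ^ 3 / ε * ((cB * (H + 1) + 1) * (κ ^ 2 / ε)) := by gcongr
      _ = _ := by field_simp
  · calc _ ≤ H * κ ^ 3 / ε * ((cB * (H + 1) + 1) * (κ ^ 6 / ε)) := by gcongr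
      _ = _ := by field_simp
  -- The inner loop costs order `κ · κ² = κ³` products per iteration, dominated by the bound `κ⁴/ε`
  -- for the batch `B₁`.
  · have hT1 : (T : ℝ) + 1 ≤ (cT + 2) * κ := by linarith
    have h2 : ((T : ℝ) + 1) * (2 * ⌈cB * κ ^ 2⌉₊)
        ≤ 2 * (cT + 2) * (cB + 1) * (κ ^ 4 / ε) := by
      calc _ ≤ (cT + 2) * κ * (2 * ((cB + 1) * κ ^ 2)) := by gcongr
        _ = 2 * (cT + 2) * (cB + 1) * κ ^ 3 := by ring
        _ ≤ _ := mul_le_mul_of_nonneg_left (hpow (by norm_num)) (by positivity)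
    calc _ ≤ H * κ ^ 3 / ε * ((cB * (H + 1) + 1) * (κ ^ 4 / ε)
          + 2 * (cT + 2) * (cB + 1) * (κ ^ 4 / ε)) := by
          refine mul_le_mul hK (add_le_add b1 h2) (by positivity) (by positivity)
      _ = _ := by field_simp

end NSBO

end

/-! ### The main theorem. -/

theorem theorem2 (c : NSBO.Constants) (γ : ℝ) (hγ : 0 < γ) (hγ_le : γ ≤ 1 / c.Lg1) :
    ∃ cα > 0, ∃ cT > 0, ∃ cB > 0, ∀ Δ : ℝ, 0 ≤ Δ → ∃ C : ℝ, 0 < C ∧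
      ∀ μ : ℝ, 0 < μ → μ ≤ c.Lg1 →
        -- convergence rate
        (∀ K : ℕ, 1 ≤ K → ∀ T : ℕ, cT * c.κ μ ≤ (T : ℝ) →
          ∀ B : NSBO.BatchSizes, B.AtLeast cB (c.κ μ) K T →
          ∀ (m n : ℕ) (Ξ Z Ω : Type*) [MeasurableSpace Ξ] [MeasurableSpace Z] [MeasurableSpace Ω]
            (p : NSBO.Problem (NSBO.Eu m) (NSBO.Eu n) Ξ Z) (P : Measure Ω) [IsProbabilityMeasure P]
            (R : NSBO.Randomness p P),
            NSBO.Setting c μ Δ p P R B (cα / c.κ μ ^ 3) γ T K →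
            R.Reaches B (cα / c.κ μ ^ 3) γ T K (C * c.κ μ ^ 3 / K)) ∧
        -- complexity of reaching accuracy ε
        (∀ ε : ℝ, 0 < ε → ε ≤ 1 →
          ∃ (K T : ℕ) (B : NSBO.BatchSizes), 1 ≤ K ∧ (K : ℝ) ≤ C * c.κ μ ^ 3 / ε ∧
            cT * c.κ μ ≤ (T : ℝ) ∧ (T : ℝ) ≤ C * c.κ μ ∧ B.AtLeast cB (c.κ μ) K T ∧
            ∀ (m n : ℕ) (Ξ Z Ω : Type*) [MeasurableSpace Ξ] [MeasurableSpace Z]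
              [MeasurableSpace Ω] (p : NSBO.Problem (NSBO.Eu m) (NSBO.Eu n) Ξ Z) (P : Measure Ω)
              [IsProbabilityMeasure P] (R : NSBO.Randomness p P),
              NSBO.Setting c μ Δ p P R B (cα / c.κ μ ^ 3) γ T K →
              R.Reaches B (cα / c.κ μ ^ 3) γ T K ε ∧
              ∀ ω : Ω,
                ((R.state B (cα / c.κ μ ^ 3) γ T K ω).count.gradF : ℝ)
                  ≤ C * c.κ μ ^ 5 / ε ^ 2 ∧
                ((R.state B (cα / c.κ μ ^ 3) γ T K ω).count.gradG : ℝ)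
                  ≤ C * c.κ μ ^ 9 / ε ^ 2 ∧
                ((R.state B (cα / c.κ μ ^ 3) γ T K ω).count.jvp : ℝ)
                  ≤ C * c.κ μ ^ 5 / ε ^ 2 ∧
                ((R.state B (cα / c.κ μ ^ 3) γ T K ω).count.hvp : ℝ)
                  ≤ C * c.κ μ ^ 7 / ε ^ 2) := by
  obtain ⟨cα, cT, cB, Cb, ht⟩ := c.exists_tuned hγ
  have hγL : γ * c.Lg1 ≤ 1 := (le_div_iff₀ c.Lg1_pos).mp hγ_le
  have hcT := ht.cT_pos
  have hcB := ht.cB_pos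
  refine ⟨cα, ht.cα_pos, cT, hcT, cB, hcB, fun Δ hΔ => ?_⟩
  have hrate := ht.rate_nonneg hΔ
  -- The factor `2` covers the rounding up of the number of iterations.
  set H := 2 * (c.rate cα cB Cb Δ + 1) with hH
  have hH0 : 0 < H := by positivity
  set E := cB * (H + 1) + 1 + 2 * (cT + 2) * (cB + 1) with hE
  have hE0 : 0 < E := by positivity
  -- The summands of `C` pay for the oracle counts, for `K` and the rate, and for `T`.
  refine ⟨H * E + H + (cT + 1), by positivity, fun μ hμ hμL => ?_⟩
  have hκ := NSBO.Constants.one_le_κ hμ hμL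
  have hκ0 : 0 < c.κ μ := by linarith
  have hHC : H ≤ H * E + H + (cT + 1) := by linarith [mul_pos hH0 hE0]
  constructor
  · intro K hK T hT B hB m n Ξ Z Ω _ _ _ p P _ R hS
    refine (R.reaches_rate ht hμ hμL hγ hγL hK hT hB hS).mono ?_
    gcongr
    linarith
  · intro ε hε hε1
    -- The added `1` ensures `z ≥ 1`, whence `⌈z⌉₊ ≥ 1` and `⌈z⌉₊ ≤ 2 z`.
    set z := (c.rate cα cB Cb Δ + 1) * c.κ μ ^ 3 / ε with hz
    have hz1 : 1 ≤ z := by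
      rw [hz, le_div_iff₀ hε, one_mul]
      exact hε1.trans (one_le_mul_of_one_le_of_one_le (by linarith) (one_le_pow₀ hκ))
    have hKz : z ≤ ⌈z⌉₊ := Nat.le_ceil z
    have hK1 : 1 ≤ ⌈z⌉₊ := Nat.one_le_ceil_iff.mpr (by linarith)
    have hKH : (⌈z⌉₊ : ℝ) ≤ H * c.κ μ ^ 3 / ε := by
      have h1 := (Nat.ceil_lt_add_one (by linarith : 0 ≤ z)).le
      have h2 : H * c.κ μ ^ 3 / ε = 2 * z := by
        rw [hz, hH]
        ring
      linarith
    have hT : cT * c.κ μ ≤ ⌈cT * c.κ μ⌉₊ := Nat.le_ceil _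
    have hTle := NSBO.natCeil_le_mul (by positivity) hκ (le_refl (cT * c.κ μ))
    obtain ⟨hF, hG, hV⟩ := NSBO.count_bounds hcB hcT hκ hε hε1 hH0.le hKH hTle
    have hB := NSBO.BatchSizes.atLeast_uniform cB (c.κ μ) ⌈z⌉₊ ⌈cT * c.κ μ⌉₊
    have hsmall : H * (cB * (H + 1) + 1) ≤ H * E + H + (cT + 1) := by
      have : H * (cB * (H + 1) + 1) ≤ H * E :=
        mul_le_mul_of_nonneg_left (le_add_of_nonneg_right (by positivity)) hH0.le
      linarith
    have hlarge : H * E ≤ H * E + H + (cT + 1) := by linarith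
    have hmono : ∀ {a : ℝ} (n : ℕ), a ≤ H * E + H + (cT + 1) →
        a * c.κ μ ^ n / ε ^ 2 ≤ (H * E + H + (cT + 1)) * c.κ μ ^ n / ε ^ 2 := fun n h => by
      gcongr
    refine ⟨⌈z⌉₊, ⌈cT * c.κ μ⌉₊, _, hK1, hKH.trans (by gcongr), hT,
      hTle.trans (mul_le_mul_of_nonneg_right (by linarith [mul_pos hH0 hE0]) hκ0.le), hB, ?_⟩
    intro m n Ξ Z Ω _ _ _ p P _ R hS
    refine ⟨(R.reaches_rate ht hμ hμL hγ hγL hK1 hT hB hS).mono ?_, fun ω => ?_⟩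
    · rw [div_le_iff₀ (by linarith : (0 : ℝ) < ⌈z⌉₊)]
      refine le_trans ?_ (mul_le_mul_of_nonneg_left hKz hε.le)
      rw [hz, mul_div_cancel₀ _ hε.ne']
      gcongr
      linarith
    · rw [R.count_uniform]
      push_cast
      exact ⟨hF.trans (hmono 5 hsmall), hG.trans (hmono 9 hsmall), hF.trans (hmono 5 hsmall),
        hV.trans (hmono 7 hlarge)⟩
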